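/- **Setting.** A join is a finite set $\mathcal E$ of hyperedges (finite sets of attributes); an instance $\mathcal R$ assigns to every $e\in\mathcal E$ a finite set $R(e)$ of tuples over $e$. The join results are the combinations $(t_e)_{e\in\mathcal E}$, $t_e\in R(e)$, that agree on common attributes; $\mathrm{IN}=\sum_e|R(e)|$, $\mathrm{OUT}$ is the number of join results, and $\mathfrak R(\mathrm{IN},\mathrm{OUT})$ is the class of all instances with these sizes. Removing repeatedly an edge that is contained in another edge gives the reduced hypergraph; the join is *r-hierarchical* if in the reduced hypergraph the sets $\mathcal E_x=\{e: x\in e\}$, $\mathcal E_y$ of any two attributes $x,y$ are nested or disjoint. In the (tuple-based) MPC model the input tuples are distributed evenly over $p\ge 1$ servers. In each round every server sends messages to servers, which depend in an arbitrary way on all it knows; a message consists of tuples, each a copy of a tuple held by the sender, and of other information. The algorithm computes the join on $\mathcal R$ if for every join result all its tuples are present together on some server. The load is the maximum amount of data that a server holds initially or receives in one round. In upper bounds the other information consists of integers of $O(\log \mathrm{IN})$ bits, and every tuple and every integer counts as one unit; in lower bounds only tuples are counted and all other information is free. Let $$B(p,\mathrm{IN},\mathrm{OUT})=\frac{\mathrm{IN}}{p^{1/\max\{1,k^*-1\}}}+\Big(\frac{\mathrm{OUT}}{p}\Big)^{1/k^*},\qquad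 k^*=\lceil\log_{\mathrm{IN}}\mathrm{OUT}\rceil ,$$ where $k^*=1$ if $\mathrm{OUT}\le\mathrm{IN}$. **Theorem.** Let $\mathcal E$ be an r-hierarchical join. Constants below depend only on $\mathcal E$ and on what is named. 1. For every $\epsilon>0$ there is a deterministic MPC algorithm that, for all $p\ge1$ and all instances with $\mathrm{IN}\ge p^{1+\epsilon}$, and for every even initial distribution, computes the join in $O(1)$ rounds with load $O(B(p,\mathrm{IN},\mathrm{OUT}))$ (constants depending on $\epsilon$). This algorithm $\mathcal A$ is output-optimal: for all such $p,\mathrm{IN},\mathrm{OUT}$ and every MPC algorithm $\mathcal A'$ on $p$ servers that computes the join on all instances in $\mathfrak R(\mathrm{IN},\mathrm{OUT})$, the maximum load of $\mathcal A$ over $\mathfrak R(\mathrm{IN},\mathrm{OUT})$ and all even distributions is at most a constant, depending on $\epsilon$ and the number of rounds of $\mathcal A'$, times that of $\mathcal A'$. 2. The bound is output-optimal, if all attribute domains are infinite: for all $p\ge1$, $\mathrm{IN}\ge1$ and $\mathrm{OUT}$ with $\mathfrak R(\mathrm{IN},\mathrm{OUT})\neq\emptyset$ and every $T$ there is an instance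 with input size $\Theta(\mathrm{IN})$ and output size $\Theta(\mathrm{OUT})$ such that every MPC algorithm with at most $T$ rounds that computes the join on this instance has load $\Omega(B(p,\mathrm{IN},\mathrm{OUT}))$ on it, for every even distribution (the constant in $\Omega$ depends on $T$). -/

import Mathlib

/-! ## Joins, r-hierarchical hypergraphs, and the tuple-based MPC model -/

universe u v w

noncomputable section

namespace MPCJoin

/-! ### Hypergraphs.  A join is given by its finite set `E` of hyperedges (finite sets of
attributes). -/

open Classical in
/-- The hyperedges containing the attribute `x`. -/
def edgesAt {V : Type*} (E : Finset (Finset V)) (x : V) : Finset (Finset V) :=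
  E.filter (fun e => x ∈ e)

/-- Hierarchical joins: the sets of hyperedges of any two attributes are nested or disjoint. -/
def IsHierarchical {V : Type*} (E : Finset (Finset V)) : Prop :=
  ∀ x y : V, edgesAt E x ⊆ edgesAt E y ∨ edgesAt E y ⊆ edgesAt E x ∨
    Disjoint (edgesAt E x) (edgesAt E y)

open Classical in
/-- One step of the reduce procedure: remove an edge that is contained in another edge. -/
def ReduceStep {V : Type*} (E E' : Finset (Finset V)) : Prop :=
  ∃ e ∈ E, ∃ e' ∈ E, e ≠ e' ∧ e ⊆ e' ∧ E' = E.erase e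

/-- `E'` is obtained from `E` by repeating the reduce procedure until no edge can be removed. -/
def IsReductionOf {V : Type*} (E' E : Finset (Finset V)) : Prop :=
  Relation.ReflTransGen ReduceStep E E' ∧ ∀ E'', ¬ ReduceStep E' E''

/-- A join is r-hierarchical if its reduced hypergraph is hierarchical. -/
def IsRHierarchical {V : Type*} (E : Finset (Finset V)) : Prop :=
  ∃ E', IsReductionOf E' E ∧ IsHierarchical E'

/-! ### Instances and join results -/

/-- A tuple over the attribute set `e`. -/
abbrev Tup {V : Type*} (dom : V → Type*) (e : Finset V) : Type _ :=
  (x : {x // x ∈ e}) → dom x.1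

/-- A tuple tagged with the relation (hyperedge) it belongs to. -/
abbrev RelTuple {V : Type*} (dom : V → Type*) (E : Finset (Finset V)) : Type _ :=
  (e : {e // e ∈ E}) × Tup dom e.1

/-- An instance of the join: a finite relation for every hyperedge. -/
abbrev Database {V : Type*} (dom : V → Type*) (E : Finset (Finset V)) : Type _ :=
  (e : {e // e ∈ E}) → Finset (Tup dom e.1)

section Instances

variable {V : Type*} {dom : V → Type*} {E : Finset (Finset V)}

/-- All input tuples of the instance. -/
def Database.tuples (R : Database dom E) : Finset (RelTuple dom E) :=
  Finset.univ.sigma R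

/-- The input size `IN`. -/
def Database.inSize (R : Database dom E) : ℕ := ∑ e, (R e).card

open Classical in
/-- The join results: all combinations of tuples, one from each relation, that agree on their
common attributes. -/
def Database.joinResults (R : Database dom E) : Finset ((e : {e // e ∈ E}) → Tup dom e.1) :=
  (Fintype.piFinset R).filter fun t =>
    ∀ (e e' : {e // e ∈ E}) (x : V) (hx : x ∈ e.1) (hx' : x ∈ e'.1),
      t e ⟨x, hx⟩ = t e' ⟨x, hx'⟩

/-- The output size `OUT`. -/
def Database.outSize (R : Database dom E) : ℕ := R.joinResults.card

/-- The class of instances with input size `N` and output size `M`. -/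
def Database.InClass (R : Database dom E) (N M : ℕ) : Prop :=
  R.inSize = N ∧ R.outSize = M

/-- An even initial distribution of the input tuples over `p` servers. -/
structure Database.IsEvenDistribution (R : Database dom E) {p : ℕ}
    (D : Fin p → Finset (RelTuple dom E)) : Prop where
  covers : ∀ t, t ∈ R.tuples ↔ ∃ i, t ∈ D i
  disjoint : ∀ i j, i ≠ j → Disjoint (D i) (D j)
  even : ∀ i, R.inSize / p ≤ (D i).card ∧ (D i).card ≤ R.inSize ⌈/⌉ p

end Instances

/-! ### The tuple-based MPC model.  A message is a sequence of units; a unit is a tuple (from `τ`)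
or an item of other information (from `B`). -/

/-- What a server knows: the tuples it holds initially, and the messages it has received in each
of the past rounds (oldest first), indexed by the sender. -/
structure View (τ B : Type*) (p : ℕ) where
  initial : Finset τ
  inbox : List (Fin p → List (τ ⊕ B))

/-- The server with this view holds (a copy of) the tuple `t`. -/
def View.Holds {τ B : Type*} {p : ℕ} (v : View τ B p) (t : τ) : Prop :=
  t ∈ v.initial ∨ ∃ r ∈ v.inbox, ∃ j, Sum.inl t ∈ r j

/-- A (deterministic) tuple-based MPC algorithm on `p` servers.  In round `t`, server `j` sends the
message `send t j v i` to server `i`, where `v` is all that server `j` knows at that time; local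
computation is unrestricted.  Tuples are atomic: only copies of tuples held by the sender can be
sent. -/
structure Algorithm (τ B : Type*) (p : ℕ) where
  rounds : ℕ
  send : ℕ → Fin p → View τ B p → Fin p → List (τ ⊕ B)
  tuple_based : ∀ t j v i x, Sum.inl x ∈ send t j v i → v.Holds x

section Execution

variable {τ B : Type*} {p : ℕ}

/-- What server `i` knows after `t` rounds, when the data is initially distributed as `D`. -/
def Algorithm.view (A : Algorithm τ B p) (D : Fin p → Finset τ) : ℕ → Fin p → View τ B p
  | 0, i => ⟨D i, []⟩
  | t + 1, i =>
      ⟨D i, (A.view D t i).inbox ++ [fun j => A.send t j (A.view D t j) i]⟩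

/-- The message sent from server `j` to server `i` in round `t`. -/
def Algorithm.message (A : Algorithm τ B p) (D : Fin p → Finset τ) (t : ℕ) (j i : Fin p) :
    List (τ ⊕ B) :=
  A.send t j (A.view D t j) i

/-- The load, every tuple and every other item counted as one unit: the maximum amount of data
that a server holds initially or receives in one round. -/
def Algorithm.load (A : Algorithm τ B p) (D : Fin p → Finset τ) : ℕ :=
  max (Finset.univ.sup fun i => (D i).card)
    ((Finset.range A.rounds).sup fun t => Finset.univ.sup fun i =>
      ∑ j, (A.message D t j i).length)

/-- The load when only tuples are counted and all other information is free. -/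
def Algorithm.tupleLoad (A : Algorithm τ B p) (D : Fin p → Finset τ) : ℕ :=
  max (Finset.univ.sup fun i => (D i).card)
    ((Finset.range A.rounds).sup fun t => Finset.univ.sup fun i =>
      ∑ j, (A.message D t j i).countP Sum.isLeft)

/-- All integers sent in the execution are at most `K`. -/
def Algorithm.IntegersAtMost (A : Algorithm τ ℕ p) (D : Fin p → Finset τ) (K : ℕ) : Prop :=
  ∀ t < A.rounds, ∀ i j, ∀ n : ℕ, Sum.inr n ∈ A.message D t j i → n ≤ K

end Execution

/-- The algorithm computes the join on the instance `R` distributed as `D`: the tuples of every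
join result come together on some server. -/
def Algorithm.Computes {V : Type*} {dom : V → Type*} {E : Finset (Finset V)} {B : Type*} {p : ℕ}
    (A : Algorithm (RelTuple dom E) B p) (R : Database dom E)
    (D : Fin p → Finset (RelTuple dom E)) : Prop :=
  ∀ s ∈ R.joinResults, ∃ i, ∀ e, (A.view D A.rounds i).Holds ⟨e, s e⟩

/-! ### The bound -/

/-- `k* = ⌈log_IN OUT⌉`, read as `1` when `OUT ≤ IN`. -/
def kStar (N M : ℕ) : ℕ := max 1 ⌈Real.logb N M⌉₊

/-- `IN / p ^ (1 / max {1, k* - 1}) + (OUT / p) ^ (1 / k*)`. -/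
def loadBound (p N M : ℕ) : ℝ :=
  (N : ℝ) / (p : ℝ) ^ ((1 : ℝ) / max 1 ((kStar N M : ℝ) - 1)) +
    ((M : ℝ) / p) ^ ((1 : ℝ) / kStar N M)

end MPCJoin

end

/-! Both halves of the theorem rest on one counting quantity. For a set S of edges of the reduced
hypergraph F, let q_S be the number of projections of join results to S. Call X admissible for an
instance if IN ≤ pX and q_S ≤ p X^|S| for every nonempty S ⊆ F. If an algorithm with r rounds has
load L, each server ends with at most (r+1)L tuples and so assembles at most ((r+1)L)^|S|
projections; hence X = (r+1)L is admissible (`Algorithm.card_subResults_le`, `Algorithm.inSize_le`).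
Conversely, `exists_joinAlgorithm` gives a single algorithm whose load is O(X) for every admissible
X. The comparison with other algorithms thus holds even instance by instance.

The bound B is admissible because q_S ≤ min(IN^|S|, OUT): its first summand handles |S| < k*, its
second handles |S| ≥ k* (`card_le_mul_loadBound_pow`). For tightness, a reduced hierarchical
hypergraph with at least two edges has a private attribute in every edge, so Cartesian products of
prescribed sizes can be realized. With k* - 1 factors of size IN and one of size about OUT / IN^(k*
- 1), every admissible X is at least B/2 (`exists_hardInstance`).

The join algorithm works on a forest. At level k, tuples over F are grouped by their values on the
attributes that lie in at least k edges. Since F is hierarchical, two tuples agree on their common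
attributes exactly when they are coherent, that is, nowhere in alternative groups. Once tuples
without partners are removed, every nonempty coherent set is the projection of a join result, so
coherent sets are counted by the q_S. Their generating functions satisfy 1 + ψ_{k+1} = ∏ (1 + ∑
ψ_k), a product over labels and a sum over the alternatives with that label (`one_add_psi_succ`).

For a load L, ψ is evaluated at 1/L and the join is spread over cells: the labels are the digits of
a mixed radix number, and the alternatives with one label receive intervals of that digit, placed by
weight. Every result finds a common cell for its tuples (`exists_cell`), every cell receives O(L)
tuples (`card_neededIn_le`), and O(p) cells suffice when the coefficients of ψ are O(p L^j)
(`cells_le`).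

All weights, offsets and leaders come from a constant number of prefix sums over keys
(`Protocol.prefixSum`). These are computed by columnsort, iterated to a constant depth d as an
oblivious network, followed by scans along trees of degree g. The assumption IN ≥ p^(1+ε) leaves
room for a g with p ≤ g^d and 2g² at most the local input size. Distributed computations are
described by the messages sent on every input; a server knows a quantity if its view determines that
quantity. -/

noncomputable section
namespace MPCJoin

/-! ### An oblivious sorting network (Leighton's columnsort) -/

section SortingNetwork

/-- `Z'` has as many elements as `Z` in every block of `b`, and is a lower set of every block. -/
def LowerStep (b : ℕ → ℕ) (Z Z' : Finset ℕ) : Prop :=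
  (∀ c, (Z.filter (b · = c)).card = (Z'.filter (b · = c)).card) ∧
    ∀ q ∈ Z', ∀ q' < q, b q' = b q → q' ∈ Z'

/-- If `q` were missing from `Z'`, the part of `Z'` in its block would lie below `q`, hence inside
`Z`. It would then omit `q ∈ Z`, contradicting the equal block counts. -/
theorem LowerStep.below {b : ℕ → ℕ} {Z Z' : Finset ℕ} (h : LowerStep b Z Z') {n lo : ℕ}
    (hlo : ∀ q < lo, q < n → q ∈ Z) : ∀ q < lo, q < n → q ∈ Z' := by
  intro q hq hqn
  by_contra hcon
  have hss : Z'.filter (b · = b q) ⊂ Z.filter (b · = b q) := by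
    refine ⟨?_, ?_⟩
    · intro x hx
      rw [Finset.mem_filter] at hx ⊢
      rcases lt_trichotomy x q with hxq | hxq | hxq
      · exact ⟨hlo x (by omega) (by omega), hx.2⟩
      · exact absurd (hxq ▸ hx.1) hcon
      · exact absurd (h.2 x hx.1 q hxq hx.2.symm) hcon
    · intro hsub
      have := hsub (Finset.mem_filter.2 ⟨hlo q hq hqn, rfl⟩)
      exact hcon (Finset.mem_filter.1 this).1
  have := Finset.card_lt_card hss
  rw [h.1 (b q)] at this
  exact lt_irrefl _ this

/-- Dual to `LowerStep.below`: an element beyond `hi` forces all smaller elements of its block into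
`Z'`, more than `Z` has there. -/
theorem LowerStep.above {b : ℕ → ℕ} {Z Z' : Finset ℕ} (h : LowerStep b Z Z') {hi : ℕ}
    (hhi : ∀ q ∈ Z, q < hi) : ∀ q ∈ Z', q < hi := by
  intro q hq
  by_contra hcon
  push Not at hcon
  have hss : Z.filter (b · = b q) ⊂ Z'.filter (b · = b q) := by
    refine ⟨?_, ?_⟩
    · intro x hx
      rw [Finset.mem_filter] at hx ⊢
      exact ⟨h.2 q hq x (lt_of_lt_of_le (hhi x hx.1) hcon) hx.2, hx.2⟩
    · intro hsub
      have := hsub (Finset.mem_filter.2 ⟨hq, rfl⟩)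
      exact absurd (hhi q (Finset.mem_filter.1 this).1) (by omega)
  have := Finset.card_lt_card hss
  rw [h.1 (b q)] at this
  exact lt_irrefl _ this

/-- A lower set is some `[0, k)`, and the two preceding bounds with `lo = hi = k` preserve it. This
keeps a sorted array sorted in the last step of columnsort. -/
theorem LowerStep.lower {b : ℕ → ℕ} {Z Z' : Finset ℕ} (h : LowerStep b Z Z')
    (hl : ∀ q ∈ Z, ∀ q' < q, q' ∈ Z) : ∀ q ∈ Z', ∀ q' < q, q' ∈ Z' := by
  have key : ∃ k, ∀ q, q ∈ Z ↔ q < k := by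
    refine ⟨Z.card, fun q => ⟨fun hq => ?_, fun hq => ?_⟩⟩
    · have : Finset.range (q + 1) ⊆ Z := by
        intro x hx
        rcases Nat.lt_succ_iff_lt_or_eq.1 (Finset.mem_range.1 hx) with h1 | h1
        · exact hl q hq x h1
        · exact h1 ▸ hq
      have := Finset.card_le_card this
      simp at this; omega
    · by_contra hcon
      have : Z ⊆ Finset.range q := by
        intro x hx
        rw [Finset.mem_range]
        by_contra hxq
        rcases eq_or_lt_of_le (not_lt.1 hxq) with h1 | h1
        · exact hcon (h1 ▸ hx)
        · exact hcon (hl x hx q h1)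
      have := Finset.card_le_card this
      simp at this; omega
  obtain ⟨k, hk⟩ := key
  intro q hq q' hq'
  have h1 := h.below (n := k) (lo := k) (fun q hq _ => (hk q).2 hq)
  have h2 := h.above (fun q hq => (hk q).1 hq)
  have := h2 q hq
  exact h1 q' (by omega) (by omega)

theorem card_filter_mod_range (s q : ℕ) (hs : 0 < s) (c : ℕ) (hc : c < s) :
    ((Finset.range q).filter (· % s = c)).card = q / s + if c < q % s then 1 else 0 := by
  have := Nat.count_modEq_card q hs c
  rw [Nat.mod_eq_of_lt hc] at this
  rw [← this, Nat.count_eq_card_filter_range]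
  congr 1
  ext x
  simp [Nat.ModEq, Nat.mod_eq_of_lt hc]

theorem card_filter_mod_Ico (s u v : ℕ) (hs : 0 < s) (huv : u ≤ v) (c c' : ℕ) (hc : c < s)
    (hc' : c' < s) : ((Finset.Ico u v).filter (· % s = c)).card ≤
      ((Finset.Ico u v).filter (· % s = c')).card + 1 := by
  have split : ∀ c, ((Finset.range v).filter (· % s = c)).card =
      ((Finset.range u).filter (· % s = c)).card + ((Finset.Ico u v).filter (· % s = c)).card := by
    intro c
    rw [← Finset.card_union_of_disjoint]
    · congr 1
      ext x
      simp only [Finset.mem_filter, Finset.mem_range, Finset.mem_union, Finset.mem_Ico]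
      constructor
      · rintro ⟨h1, h2⟩
        by_cases h : x < u
        · exact Or.inl ⟨h, h2⟩
        · exact Or.inr ⟨⟨by omega, h1⟩, h2⟩
      · rintro (⟨h1, h2⟩ | ⟨h1, h2⟩)
        · exact ⟨by omega, h2⟩
        · exact ⟨h1.2, h2⟩
    · rw [Finset.disjoint_left]
      intro x hx hx'
      simp only [Finset.mem_filter, Finset.mem_range, Finset.mem_Ico] at hx hx'
      omega
  have e1 := split c
  have e2 := split c'
  rw [card_filter_mod_range s _ hs _ hc, card_filter_mod_range s _ hs _ hc] at e1
  rw [card_filter_mod_range s _ hs _ hc', card_filter_mod_range s _ hs _ hc'] at e2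
  split_ifs at e1 e2 <;> omega

/-- The zero-one form of columnsort. -/
theorem columnsort_lower {n s r : ℕ} (hs : 0 < s) (hn : n ≤ s * r) (hr : 2 * s ^ 2 ≤ r)
    {Z₀ Z₁ Z₂ Z₃ Z₄ : Finset ℕ} (h1n : ∀ q ∈ Z₁, q < n)
    (h3n : ∀ q ∈ Z₃, q < n) (h4n : ∀ q ∈ Z₄, q < n)
    (h1 : LowerStep (· / r) Z₀ Z₁) (h2 : LowerStep (· % s) Z₁ Z₂)
    (h3 : LowerStep (· / r) Z₂ Z₃) (h4 : LowerStep (fun q => (q + s ^ 2) / r) Z₃ Z₄) :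
    ∀ q ∈ Z₄, ∀ q' < q, q' ∈ Z₄ := by
  have hr0 : 0 < r := lt_of_lt_of_le (by positivity) hr
  set k : ℕ → ℕ := fun c => (Z₁.filter (· % s = c)).card with hk
  -- the residue classes are balanced after the first step
  have hbal : ∀ c < s, ∀ c' < s, k c ≤ k c' + s := by
    intro c hc c' hc'
    have hsum : ∀ c, k c = ∑ j ∈ Finset.range s,
        ((Z₁.filter (· / r = j)).filter (· % s = c)).card := by
      intro c
      have := Finset.card_eq_sum_card_fiberwise (s := Z₁.filter (· % s = c)) (f := (· / r))
        (t := Finset.range s) (by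
          intro q hq
          have hq' := h1n q (Finset.mem_filter.1 hq).1
          simp only [Finset.coe_range, Set.mem_Iio]
          rw [Nat.div_lt_iff_lt_mul hr0]
          omega)
      rw [hk]
      simp only
      rw [this]
      refine Finset.sum_congr rfl fun j _ => ?_
      rw [Finset.filter_filter, Finset.filter_filter]
      congr 1
      ext; simp [and_comm]
    rw [hsum c, hsum c']
    have : ∀ j ∈ Finset.range s, ((Z₁.filter (· / r = j)).filter (· % s = c)).card ≤
        ((Z₁.filter (· / r = j)).filter (· % s = c')).card + 1 := by
      intro j _
      -- Inside a block of length `r` the set is an interval from the block's left end, so it meets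
      -- any two residue classes modulo `s` equally often up to one. The at most `s` blocks together
      -- give the imbalance `s`.
      have hIco : Z₁.filter (· / r = j) =
          Finset.Ico (j * r) (j * r + (Z₁.filter (· / r = j)).card) := by
        have hcl : ∀ q ∈ Z₁.filter (· / r = j), ∀ q', j * r ≤ q' → q' < q →
            q' ∈ Z₁.filter (· / r = j) := by
          intro q hq q' hq' hlt
          rw [Finset.mem_filter] at hq ⊢
          have e1 : q' / r = j := by
            apply le_antisymm
            · rw [← hq.2]; exact Nat.div_le_div_right hlt.le
            · exact (Nat.le_div_iff_mul_le hr0).2 hq'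
          exact ⟨h1.2 q hq.1 q' hlt (by simp [e1, hq.2]), e1⟩
        have hge : ∀ q ∈ Z₁.filter (· / r = j), j * r ≤ q := by
          intro q hq
          rw [Finset.mem_filter] at hq
          exact (Nat.le_div_iff_mul_le hr0).1 hq.2.ge
        set S := Z₁.filter (· / r = j)
        ext q
        rw [Finset.mem_Ico]
        constructor
        · intro hq
          refine ⟨hge q hq, ?_⟩
          have : Finset.Ico (j * r) (q + 1) ⊆ S := by
            intro x hx
            rw [Finset.mem_Ico] at hx
            rcases Nat.lt_succ_iff_lt_or_eq.1 hx.2 with h | h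
            · exact hcl q hq x hx.1 h
            · exact h ▸ hq
          have := Finset.card_le_card this
          rw [Nat.card_Ico] at this
          have := hge q hq
          omega
        · rintro ⟨hq1, hq2⟩
          by_contra hcon
          have : S ⊆ Finset.Ico (j * r) q := by
            intro x hx
            rw [Finset.mem_Ico]
            refine ⟨hge x hx, ?_⟩
            by_contra hxq
            rcases eq_or_lt_of_le (not_lt.1 hxq) with h | h
            · exact hcon (h ▸ hx)
            · exact hcon (hcl x hx q hq1 h)
          have := Finset.card_le_card this
          rw [Nat.card_Ico] at this
          omega
      rw [hIco]
      exact card_filter_mod_Ico s _ _ hs (by omega) c c' hc hc'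
    calc _ ≤ ∑ j ∈ Finset.range s,
          (((Z₁.filter (· / r = j)).filter (· % s = c')).card + 1) := Finset.sum_le_sum this
      _ = _ := by rw [Finset.sum_add_distrib]; simp
  -- With `K` the size of the smallest residue class, sorting by residues fills everything below `s
  -- * K` and leaves nothing from `s * (K + s)` on: only a window of length `s ^ 2` is unsorted.
  obtain ⟨c₀, hc₀, hmin⟩ := Finset.exists_min_image (Finset.range s) k ⟨0, by simpa using hs⟩
  rw [Finset.mem_range] at hc₀
  set K := k c₀
  have hcount : ∀ q, ((Finset.range q).filter (· % s = q % s)).card = q / s := by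
    intro q
    rw [card_filter_mod_range s q hs _ (Nat.mod_lt _ hs)]
    simp
  have hk2 : ∀ c, k c = (Z₂.filter (· % s = c)).card := fun c => h2.1 c
  have hlo2 : ∀ q < s * K, q < n → q ∈ Z₂ := by
    intro q hq hqn
    by_contra hcon
    have hsub : Z₂.filter (· % s = q % s) ⊆ (Finset.range q).filter (· % s = q % s) := by
      intro x hx
      rw [Finset.mem_filter] at hx ⊢
      refine ⟨Finset.mem_range.2 ?_, hx.2⟩
      by_contra hxq
      rcases eq_or_lt_of_le (not_lt.1 hxq) with h | h
      · exact hcon (h ▸ hx.1)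
      · exact hcon (h2.2 x hx.1 q h hx.2.symm)
    have := Finset.card_le_card hsub
    rw [hcount, ← hk2] at this
    have hK := hmin (q % s) (Finset.mem_range.2 (Nat.mod_lt _ hs))
    have : q / s < K := Nat.div_lt_of_lt_mul hq
    omega
  have hhi2 : ∀ q ∈ Z₂, q < s * (K + s) := by
    intro q hq
    have hsub : insert q ((Finset.range q).filter (· % s = q % s)) ⊆
        Z₂.filter (· % s = q % s) := by
      intro x hx
      rw [Finset.mem_insert, Finset.mem_filter, Finset.mem_range] at hx
      rw [Finset.mem_filter]
      rcases hx with rfl | hx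
      · exact ⟨hq, rfl⟩
      · exact ⟨h2.2 q hq x hx.1 hx.2, hx.2⟩
    have := Finset.card_le_card hsub
    rw [Finset.card_insert_of_notMem (by simp), hcount, ← hk2] at this
    have hb := hbal (q % s) (Nat.mod_lt _ hs) c₀ hc₀
    have : q / s < K + s := by omega
    rw [mul_comm]
    exact (Nat.div_lt_iff_lt_mul hs).1 this
  have hlo3 := h3.below hlo2
  have hhi3 := h3.above hhi2
  have hlo4 := h4.below hlo3
  have hhi4 := h4.above hhi3
  have hwin : s * (K + s) = s * K + s ^ 2 := by ring
  set lo := s * K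
  rw [hwin] at hhi2 hhi3 hhi4
  -- If the window lies in a single block, the third step has already sorted it. Otherwise it
  -- crosses a block boundary and is sorted by the shifted blocks of the fourth step.
  by_cases hcase : ∀ q q', lo ≤ q' → q' < q → q < lo + s ^ 2 → q' / r = q / r
  · apply h4.lower
    intro q hq q' hq'
    by_cases hl : q' < lo
    · exact hlo3 q' hl (lt_trans hq' (h3n q hq))
    · exact h3.2 q hq q' hq' (hcase q q' (by omega) hq' (hhi3 q hq))
  · push Not at hcase
    obtain ⟨u, u', hu1, hu2, hu3, hu4⟩ := hcase
    have hlt : u' / r < u / r := lt_of_le_of_ne (Nat.div_le_div_right hu2.le) hu4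
    intro q hq q' hq'
    by_cases hl : q' < lo
    · exact hlo4 q' hl (lt_trans hq' (h4n q hq))
    · refine h4.2 q hq q' hq' ?_
      have hqhi := hhi4 q hq
      set j := u / r with hj
      have b1 : u' < j * r := (Nat.div_lt_iff_lt_mul hr0).1 hlt
      have b2 : j * r ≤ u := Nat.div_mul_le_self u r
      -- The boundary `j * r` lies in the window, so adding `s ^ 2` moves every point of the window
      -- past it. As `2 * s ^ 2 ≤ r`, the next boundary is not reached.
      have val : ∀ x, lo ≤ x → x < lo + s ^ 2 → (x + s ^ 2) / r = j := by
        intro x hx1 hx2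
        apply Nat.div_eq_of_lt_le
        · omega
        · rw [Nat.succ_mul]; omega
      simp only
      rw [val q' (by omega) (by omega), val q (by omega) hqhi]

/-- `a'` arises from `a` by permuting the contents of the positions in every block of `b`, and is
sorted on every block. -/
def BlockStep {κ : Type*} [LinearOrder κ] (P : Finset ℕ) (b : ℕ → ℕ) (a a' : ℕ → κ) : Prop :=
  ∃ π : ℕ → ℕ, Set.InjOn π P ∧ (∀ q ∈ P, π q ∈ P ∧ b (π q) = b q ∧ a' q = a (π q)) ∧
    ∀ q ∈ P, ∀ q' ∈ P, b q' = b q → q' ≤ q → a' q' ≤ a' q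

variable {κ : Type*} [LinearOrder κ]

/-- This is the zero-one principle: fix a threshold `x` and keep only the set of positions with key
at most `x`. A permutation inside the blocks preserves its block counts, and sortedness of a block
makes its part a lower set. The map `idx` numbers the positions of `P` increasingly without gaps. -/
theorem BlockStep.lowerStep {P : Finset ℕ} {idx β : ℕ → ℕ}
    (hidx : ∀ q ∈ P, ∀ q' ∈ P, idx q < idx q' → q < q') (hinj : Set.InjOn idx P)
    (hsur : ∀ x, ∀ q ∈ P, x < idx q → ∃ q' ∈ P, idx q' = x)
    {a a' : ℕ → κ} (h : BlockStep P (fun q => β (idx q)) a a') (x : κ) :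
    LowerStep β ((P.filter (a · ≤ x)).image idx) ((P.filter (a' · ≤ x)).image idx) := by
  obtain ⟨π, hi, hπ, hs⟩ := h
  have hsurj : ∀ q ∈ P, ∃ q' ∈ P, π q' = q := by
    have hmap : P.image π = P := by
      apply Finset.eq_of_subset_of_card_le
      · intro q hq
        obtain ⟨q', hq', rfl⟩ := Finset.mem_image.1 hq
        exact (hπ q' hq').1
      · rw [Finset.card_image_of_injOn hi]
    intro q hq
    rw [← hmap] at hq
    simpa using hq
  constructor
  · intro c
    have hform : ∀ f : ℕ → κ, ((P.filter (f · ≤ x)).image idx).filter (β · = c) =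
        (P.filter (fun q => f q ≤ x ∧ β (idx q) = c)).image idx := by
      intro f
      ext y
      simp only [Finset.mem_filter, Finset.mem_image]
      constructor
      · rintro ⟨⟨q, ⟨h1, h2⟩, rfl⟩, h3⟩
        exact ⟨q, ⟨h1, h2, h3⟩, rfl⟩
      · rintro ⟨q, ⟨h1, h2, h3⟩, rfl⟩
        exact ⟨⟨q, ⟨h1, h2⟩, rfl⟩, h3⟩
    have hsubP : ∀ f : ℕ → κ, ((P.filter (fun q => f q ≤ x ∧ β (idx q) = c) : Finset ℕ) : Set ℕ)
        ⊆ P := fun f => Finset.coe_subset.2 (Finset.filter_subset _ _)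
    rw [hform, hform, Finset.card_image_of_injOn (hinj.mono (hsubP a)),
      Finset.card_image_of_injOn (hinj.mono (hsubP a'))]
    symm
    apply Finset.card_bij (fun q _ => π q)
    · intro q hq
      rw [Finset.mem_filter] at hq ⊢
      obtain ⟨h1, h2, h3⟩ := hπ q hq.1
      refine ⟨h1, ?_, ?_⟩
      · rw [← h3]; exact hq.2.1
      · exact h2.trans hq.2.2
    · intro q hq q' hq' he
      exact hi (Finset.mem_filter.1 hq).1 (Finset.mem_filter.1 hq').1 he
    · intro q hq
      rw [Finset.mem_filter] at hq
      obtain ⟨q', hq', rfl⟩ := hsurj q hq.1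
      obtain ⟨h1, h2, h3⟩ := hπ q' hq'
      refine ⟨q', Finset.mem_filter.2 ⟨hq', ?_, ?_⟩, rfl⟩
      · rw [h3]; exact hq.2.1
      · exact h2.symm.trans hq.2.2
  · intro y hy y' hlt he
    obtain ⟨q, hq, rfl⟩ := Finset.mem_image.1 hy
    rw [Finset.mem_filter] at hq
    obtain ⟨q', hq', rfl⟩ := hsur y' q hq.1 hlt
    have := hs q hq.1 q' hq' he (hidx q' hq' q hq.1 hlt).le
    exact Finset.mem_image.2 ⟨q', Finset.mem_filter.2 ⟨hq', this.trans hq.2⟩, rfl⟩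

/-- It suffices to apply `columnsort_lower` to the single threshold `a₄ q'`: the position `q'`
belongs to the resulting lower set, hence so does every earlier position. -/
theorem columnsort {P : Finset ℕ} {idx : ℕ → ℕ} {s r : ℕ}
    (hidx : ∀ q ∈ P, ∀ q' ∈ P, idx q < idx q' ↔ q < q') (hinj : Set.InjOn idx P)
    (hsur : ∀ x, ∀ q ∈ P, x < idx q → ∃ q' ∈ P, idx q' = x)
    (hlt : ∀ q ∈ P, idx q < P.card)
    (hs : 0 < s) (hn : P.card ≤ s * r) (hr : 2 * s ^ 2 ≤ r) {a₀ a₁ a₂ a₃ a₄ : ℕ → κ}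
    (h1 : BlockStep P (fun q => idx q / r) a₀ a₁) (h2 : BlockStep P (fun q => idx q % s) a₁ a₂)
    (h3 : BlockStep P (fun q => idx q / r) a₂ a₃)
    (h4 : BlockStep P (fun q => (idx q + s ^ 2) / r) a₃ a₄) : MonotoneOn a₄ P := by
  intro q hq q' hq' hle
  rcases eq_or_lt_of_le hle with rfl | hlt'
  · exact le_rfl
  have hidx' : ∀ q ∈ P, ∀ q' ∈ P, idx q < idx q' → q < q' := fun q hq q' hq' => (hidx q hq q' hq').1
  have hb : ∀ f : ℕ → κ, ∀ y ∈ (P.filter (f · ≤ a₄ q')).image idx, y < P.card := by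
    intro f y hy
    obtain ⟨z, hz, rfl⟩ := Finset.mem_image.1 hy
    exact hlt z (Finset.mem_filter.1 hz).1
  have := columnsort_lower hs hn hr (hb _) (hb _) (hb _)
    (h1.lowerStep (β := (· / r)) hidx' hinj hsur (a₄ q'))
    (h2.lowerStep (β := (· % s)) hidx' hinj hsur (a₄ q'))
    (h3.lowerStep (β := (· / r)) hidx' hinj hsur (a₄ q'))
    (h4.lowerStep (β := fun x => (x + s ^ 2) / r) hidx' hinj hsur (a₄ q')) (idx q')
    (Finset.mem_image_of_mem _ (Finset.mem_filter.2 ⟨hq', le_rfl⟩)) (idx q)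
    ((hidx q hq q' hq').2 hlt')
  obtain ⟨z, hz, he⟩ := Finset.mem_image.1 this
  rw [Finset.mem_filter] at hz
  rw [← hinj hz.1 hq he]
  exact hz.2

/-- The layers `L` sort the positions `P` in `k` steps. -/
def SortsIn (κ : Type*) [LinearOrder κ] (P : Finset ℕ) (k : ℕ) (L : ℕ → ℕ → ℕ) : Prop :=
  ∀ seq : ℕ → ℕ → κ, (∀ i < k, BlockStep P (L i) (seq i) (seq (i + 1))) →
    MonotoneOn (seq k) P

/-- Block numbers encode a pair, the outer block `β q` and the inner block `b' q < W`. Decoding it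
shows that one combined step acts on each outer block separately. -/
theorem BlockStep.restrict {P : Finset ℕ} {β b b' : ℕ → ℕ} {W c : ℕ} {a a' : ℕ → κ}
    (hb : ∀ q ∈ P, b q = β q * W + b' q) (hW : ∀ q ∈ P, b' q < W)
    (hc : ∀ q ∈ P, β q = c → ∀ q' ∈ P, β q' = c → b' q = b' q' → b q = b q')
    (h : BlockStep P b a a') : BlockStep (P.filter (β · = c)) b' a a' := by
  obtain ⟨π, hi, hπ, hs⟩ := h
  have dec : ∀ q ∈ P, ∀ q' ∈ P, b q = b q' → β q = β q' ∧ b' q = b' q' := by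
    intro q hq q' hq' he
    rw [hb q hq, hb q' hq'] at he
    have w1 := hW q hq
    have w2 := hW q' hq'
    have e1 : β q = β q' := by
      have := congrArg (· / W) he
      rwa [mul_comm, mul_comm (β q'), Nat.mul_add_div (by omega), Nat.mul_add_div (by omega),
        Nat.div_eq_of_lt w1, Nat.div_eq_of_lt w2, add_zero, add_zero] at this
    rw [e1] at he
    exact ⟨e1, by omega⟩
  refine ⟨π, hi.mono (Finset.coe_subset.2 (Finset.filter_subset _ _)), ?_, ?_⟩
  · intro q hq
    rw [Finset.mem_filter] at hq
    obtain ⟨h1, h2, h3⟩ := hπ q hq.1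
    obtain ⟨d1, d2⟩ := dec _ h1 _ hq.1 h2
    exact ⟨Finset.mem_filter.2 ⟨h1, d1.trans hq.2⟩, d2, h3⟩
  · intro q hq q' hq' he hle
    rw [Finset.mem_filter] at hq hq'
    exact hs q hq.1 q' hq'.1 (hc _ hq'.1 hq'.2 _ hq.1 hq.2 he) hle

/-- Sorting all the blocks of `β` in parallel is a block step for `β`. -/
theorem blockStep_of_sortsIn {P : Finset ℕ} {β : ℕ → ℕ} {W k : ℕ} {L : ℕ → ℕ → ℕ → ℕ}
    (hW : ∀ c i, ∀ q ∈ P, β q = c → L c i q < W)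
    (hsort : ∀ c, SortsIn κ (P.filter (β · = c)) k (L c)) (seq : ℕ → ℕ → κ)
    (hseq : ∀ i < k, BlockStep P (fun q => β q * W + L (β q) i q) (seq i) (seq (i + 1))) :
    BlockStep P β (seq 0) (seq k) := by
  -- Each layer permutes inside the combined blocks, hence inside the blocks of `β`; composing the
  -- permutations shows that no entry ever leaves its outer block.
  have hperm : ∀ i ≤ k, ∃ π : ℕ → ℕ, Set.InjOn π P ∧
      ∀ q ∈ P, π q ∈ P ∧ β (π q) = β q ∧ seq i q = seq 0 (π q) := by
    intro i
    induction i with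
    | zero => exact fun _ => ⟨id, Set.injOn_id _, fun q hq => ⟨hq, rfl, rfl⟩⟩
    | succ i ih =>
      intro hi
      obtain ⟨π, hπi, hπ⟩ := ih (by omega)
      obtain ⟨ρ, hρi, hρ, -⟩ := hseq i (by omega)
      refine ⟨π ∘ ρ, hπi.comp hρi fun q hq => (hρ q hq).1, fun q hq => ?_⟩
      obtain ⟨h1, h2, h3⟩ := hρ q hq
      obtain ⟨g1, g2, g3⟩ := hπ _ h1
      refine ⟨g1, ?_, by rw [h3, g3]; rfl⟩
      rw [Function.comp_apply, g2]
      beta_reduce at h2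
      have w1 := hW _ i _ h1 rfl
      have w2 := hW _ i _ hq rfl
      have := congrArg (· / W) h2
      rwa [mul_comm, mul_comm (β q), Nat.mul_add_div (by omega), Nat.mul_add_div (by omega),
        Nat.div_eq_of_lt w1, Nat.div_eq_of_lt w2, add_zero, add_zero] at this
  obtain ⟨π, hπi, hπ⟩ := hperm k le_rfl
  refine ⟨π, hπi, hπ, ?_⟩
  intro q hq q' hq' he hle
  refine hsort (β q) seq (fun i hi => ?_) (Finset.mem_filter.2 ⟨hq', he⟩)
    (Finset.mem_filter.2 ⟨hq, rfl⟩) hle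
  have := hseq i hi
  obtain ⟨ρ, hρi, hρ, hs⟩ := this
  have hW' : ∀ q ∈ P, L (β q) i q < W := fun q hq => hW _ i q hq rfl
  have h1 := BlockStep.restrict (β := β) (b' := fun q => L (β q) i q) (W := W) (c := β q)
    (fun _ _ => rfl) hW' (fun x _ hx' y _ hy' hxy => by
      show β x * W + L (β x) i x = β y * W + L (β y) i y
      rw [show L (β x) i x = L (β y) i y from hxy, hx', hy'])
    ⟨ρ, hρi, hρ, hs⟩
  obtain ⟨σ, hσi, hσ, hs'⟩ := h1
  refine ⟨σ, hσi, fun z hz => ?_, fun z hz z' hz' he hle => ?_⟩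
  · obtain ⟨g1, g2, g3⟩ := hσ z hz
    refine ⟨g1, ?_, g3⟩
    simp only [(Finset.mem_filter.1 hz).2, (Finset.mem_filter.1 g1).2] at g2
    exact g2
  · refine hs' z hz z' hz' ?_ hle
    simp only [(Finset.mem_filter.1 hz).2, (Finset.mem_filter.1 hz').2]
    exact he

/-- The number of elements of `P` below `q`. -/
def rankIn (P : Finset ℕ) (q : ℕ) : ℕ := (P.filter (· < q)).card

theorem rankIn_lt_iff {P : Finset ℕ} {q q' : ℕ} (hq : q ∈ P) (_ : q' ∈ P) :
    rankIn P q < rankIn P q' ↔ q < q' := by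
  constructor
  · intro h
    by_contra hcon
    have : P.filter (· < q') ⊆ P.filter (· < q) := by
      intro x hx
      rw [Finset.mem_filter] at hx ⊢
      exact ⟨hx.1, by omega⟩
    exact absurd (Finset.card_le_card this) (not_le.2 h)
  · intro h
    apply Finset.card_lt_card
    refine ⟨fun x hx => ?_, fun hsub => ?_⟩
    · rw [Finset.mem_filter] at hx ⊢
      exact ⟨hx.1, by omega⟩
    · have := hsub (Finset.mem_filter.2 ⟨hq, h⟩)
      simp at this

theorem rankIn_lt_card {P : Finset ℕ} {q : ℕ} (hq : q ∈ P) : rankIn P q < P.card := by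
  apply Finset.card_lt_card
  refine ⟨Finset.filter_subset _ _, fun hsub => ?_⟩
  have := hsub hq
  simp at this

theorem rankIn_injOn (P : Finset ℕ) : Set.InjOn (rankIn P) P := by
  intro q hq q' hq' he
  rcases lt_trichotomy q q' with h | h | h
  · exact absurd ((rankIn_lt_iff hq hq').2 h) (by omega)
  · exact h
  · exact absurd ((rankIn_lt_iff hq' hq).2 h) (by omega)

theorem exists_rankIn_eq {P : Finset ℕ} {x : ℕ} (hx : x < P.card) : ∃ q ∈ P, rankIn P q = x := by
  have : P.image (rankIn P) = Finset.range P.card := by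
    apply Finset.eq_of_subset_of_card_le
    · intro y hy
      obtain ⟨q, hq, rfl⟩ := Finset.mem_image.1 hy
      exact Finset.mem_range.2 (rankIn_lt_card hq)
    · rw [Finset.card_image_of_injOn (rankIn_injOn P), Finset.card_range]
  have hx' : x ∈ P.image (rankIn P) := by rw [this]; exact Finset.mem_range.2 hx
  simpa using hx'

theorem card_block_le {P : Finset ℕ} {β f : ℕ → ℕ} {r c : ℕ}
    (hf : ∀ x, x < P.card → β x = c → f x < r)
    (hinj : ∀ x y, β x = c → β y = c → f x = f y → x = y) :
    (P.filter (fun q => β (rankIn P q) = c)).card ≤ r := by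
  rw [← Finset.card_range r]
  apply Finset.card_le_card_of_injOn (fun q => f (rankIn P q))
  · intro q hq
    obtain ⟨h1, h2⟩ := Finset.mem_filter.1 hq
    exact Finset.mem_coe.2 (Finset.mem_range.2 (hf _ (rankIn_lt_card h1) h2))
  · intro q hq q' hq' he
    obtain ⟨h1, h2⟩ := Finset.mem_filter.1 hq
    obtain ⟨h1', h2'⟩ := Finset.mem_filter.1 hq'
    exact rankIn_injOn P h1 h1' (hinj _ _ h2 h2' he)

/-- Every set of at most `ℓ * g ^ d` positions is sorted by `4 ^ d` layers of at most
`(g + 1) ^ d` blocks of at most `ℓ` positions. -/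
theorem exists_sortsIn (κ : Type*) [LinearOrder κ] {ℓ g : ℕ} (hg : 0 < g) (hℓ : 2 * g ^ 2 ≤ ℓ)
    (d : ℕ) (P : Finset ℕ) (hP : P.card ≤ ℓ * g ^ d) :
    ∃ L : ℕ → ℕ → ℕ, (∀ i, ∀ q ∈ P, L i q < (g + 1) ^ d) ∧
      (∀ i c, (P.filter (L i · = c)).card ≤ ℓ) ∧ SortsIn κ P (4 ^ d) L := by
  induction d generalizing P with
  | zero =>
    refine ⟨fun _ _ => 0, by simp, fun i c => ?_, fun seq hseq => ?_⟩
    · exact (Finset.card_filter_le _ _).trans (by simpa using hP)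
    · obtain ⟨π, -, -, hs⟩ := hseq 0 (by simp)
      intro q hq q' hq' hle
      exact hs q' hq' q hq rfl hle
  | succ d ih =>
    set r := ℓ * g ^ d with hr
    have hgr : 2 * g ^ 2 ≤ r := hℓ.trans (Nat.le_mul_of_pos_right _ (by positivity))
    have hr0 : 0 < r := lt_of_lt_of_le (by positivity) hgr
    have hPr : P.card ≤ g * r := by rw [hr]; calc _ ≤ _ := hP
                                               _ = _ := by ring
    -- The partitions of the four phases of columnsort, in terms of ranks in `P`: columns in phases
    -- 0 and 2, residues in phase 1, shifted columns in phase 3. The shift can create one extra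
    -- block, which is why the base is `g + 1`.
    let B : ℕ → ℕ → ℕ := fun j x =>
      if j = 1 then x % g else if j = 3 then (x + g ^ 2) / r else x / r
    have hB : ∀ j x, x < P.card → B j x < g + 1 := by
      intro j x hx
      simp only [B]
      split_ifs
      · exact (Nat.mod_lt _ hg).trans (Nat.lt_succ_self g)
      · rw [Nat.div_lt_iff_lt_mul hr0, Nat.succ_mul]; omega
      · rw [Nat.div_lt_iff_lt_mul hr0, Nat.succ_mul]; omega
    have hcard : ∀ j c, (P.filter (fun q => B j (rankIn P q) = c)).card ≤ r := by
      intro j c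
      by_cases h1 : j = 1
      · apply card_block_le (f := (· / g))
        · intro x hx _
          rw [Nat.div_lt_iff_lt_mul hg, mul_comm]; omega
        · intro x y hx hy he
          simp only [B, h1, if_true] at hx hy he
          rw [← Nat.div_add_mod x g, ← Nat.div_add_mod y g, hx, hy, he]
      by_cases h3 : j = 3
      · apply card_block_le (f := fun x => (x + g ^ 2) % r)
        · intro x hx _
          exact Nat.mod_lt _ hr0
        · intro x y hx hy he
          simp only [B, h3] at hx hy he
          norm_num at hx hy
          have e1 := Nat.div_add_mod (x + g ^ 2) r
          have e2 := Nat.div_add_mod (y + g ^ 2) r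
          rw [hx, he] at e1
          rw [hy] at e2
          omega
      · apply card_block_le (f := fun x => x % r)
        · intro x hx _
          exact Nat.mod_lt _ hr0
        · intro x y hx hy he
          simp only [B, h1, h3, if_false] at hx hy he
          rw [← Nat.div_add_mod x r, ← Nat.div_add_mod y r, hx, hy, he]
    choose M hM1 hM2 hM3 using fun j c => ih (P.filter (fun q => B j (rankIn P q) = c)) (hcard j c)
    set k := 4 ^ d with hk
    have hk0 : 0 < k := by positivity
    set W := (g + 1) ^ d with hW
    -- Layer `i` belongs to phase `i / 4 ^ d` and performs step `i % 4 ^ d` of the recursive network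
    -- inside each block of that phase.
    let L : ℕ → ℕ → ℕ := fun i q => B (i / k) (rankIn P q) * W +
      M (i / k) (B (i / k) (rankIn P q)) (i % k) q
    have hMW : ∀ j i, ∀ q ∈ P, M j (B j (rankIn P q)) i q < W := fun j i q hq =>
      hM1 j _ i q (Finset.mem_filter.2 ⟨hq, rfl⟩)
    refine ⟨L, ?_, ?_, ?_⟩
    · intro i q hq
      have h1 := hB (i / k) _ (rankIn_lt_card hq)
      have h2 := hMW (i / k) (i % k) q hq
      calc L i q < B (i / k) (rankIn P q) * W + W := by simp only [L]; omega
        _ = (B (i / k) (rankIn P q) + 1) * W := by ring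
        _ ≤ (g + 1) * W := Nat.mul_le_mul_right _ h1
        _ = (g + 1) ^ (d + 1) := by rw [hW]; ring
    · intro i c
      refine le_trans (Finset.card_le_card ?_) (hM2 (i / k) (c / W) (i % k) (c % W))
      intro q hq
      rw [Finset.mem_filter] at hq
      have h2 := hMW (i / k) (i % k) q hq.1
      have hW0 : 0 < W := by positivity
      have e1 : c / W = B (i / k) (rankIn P q) := by
        rw [← hq.2]; simp only [L]
        rw [mul_comm, Nat.mul_add_div hW0, Nat.div_eq_of_lt h2, add_zero]
      have e2 : c % W = M (i / k) (B (i / k) (rankIn P q)) (i % k) q := by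
        rw [← hq.2]; simp only [L]
        rw [mul_comm, Nat.mul_add_mod, Nat.mod_eq_of_lt h2]
      rw [Finset.mem_filter, Finset.mem_filter]
      refine ⟨⟨hq.1, e1.symm⟩, ?_⟩
      rw [e1, e2]
    · intro seq hseq
      have hph : ∀ j < 4, BlockStep P (fun q => B j (rankIn P q)) (seq (j * k))
          (seq ((j + 1) * k)) := by
        intro j hj
        have := blockStep_of_sortsIn (κ := κ) (P := P) (β := fun q => B j (rankIn P q)) (W := W)
          (k := k) (L := M j) (fun c i q hq hc => hM1 j c i q (Finset.mem_filter.2 ⟨hq, hc⟩))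
          (hM3 j) (fun i => seq (j * k + i)) (fun i hi => by
            have h := hseq (j * k + i) (by
              rw [pow_succ]
              calc j * k + i < (j + 1) * k := by rw [Nat.succ_mul]; omega
                _ ≤ 4 * k := Nat.mul_le_mul_right _ hj
                _ = 4 ^ d * 4 := by rw [hk]; ring)
            have e1 : (j * k + i) / k = j := by
              rw [mul_comm, Nat.mul_add_div hk0, Nat.div_eq_of_lt hi, add_zero]
            have e2 : (j * k + i) % k = i := by
              rw [mul_comm, Nat.mul_add_mod, Nat.mod_eq_of_lt hi]
            simp only [L, e1, e2] at h
            exact h)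
        simpa [Nat.succ_mul] using this
      have h0 := hph 0 (by norm_num)
      have h1 := hph 1 (by norm_num)
      have h2 := hph 2 (by norm_num)
      have h3 := hph 3 (by norm_num)
      have e4 : (3 + 1) * k = 4 ^ (d + 1) := by rw [hk]; ring
      rw [e4] at h3
      exact columnsort (idx := rankIn P) (fun q hq q' hq' => rankIn_lt_iff hq hq')
        (rankIn_injOn P) (fun x q hq hx => exists_rankIn_eq (hx.trans (rankIn_lt_card hq)))
        (fun q hq => rankIn_lt_card hq) hg hPr hgr
        (by simpa [B] using h0) (by simpa [B] using h1) (by simpa [B] using h2)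
        (by simpa [B] using h3)

end SortingNetwork

end MPCJoin

end

noncomputable section
namespace MPCJoin

/-! ### Protocols: executions described by what is sent on every input -/

section Protocols

variable {τ : Type*} {p : ℕ}

/-- Server `i` sees the same on the inputs `D` and `D'` before round `t`. -/
def SameView (msg : ℕ → (Fin p → Finset τ) → Fin p → Fin p → List (τ ⊕ ℕ)) (t : ℕ) (i : Fin p)
    (D D' : Fin p → Finset τ) : Prop :=
  D i = D' i ∧ ∀ s < t, ∀ j, msg s D j i = msg s D' j i

/-- Server `i` holds the tuple `x` before round `t`. -/
def HoldsAt (msg : ℕ → (Fin p → Finset τ) → Fin p → Fin p → List (τ ⊕ ℕ)) (t : ℕ)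
    (D : Fin p → Finset τ) (i : Fin p) (x : τ) : Prop :=
  x ∈ D i ∨ ∃ s < t, ∃ j, Sum.inl x ∈ msg s D j i

/-- A protocol for the inputs in `I`, given by the messages sent on every input: they are
determined by what the sender knows.  On the input `D` every server receives at most `cap D` units
in a round, and all integers are at most `K D`. -/
structure Protocol (I : Set (Fin p → Finset τ)) (cap K : (Fin p → Finset τ) → ℕ) where
  rounds : ℕ
  msg : ℕ → (Fin p → Finset τ) → Fin p → Fin p → List (τ ⊕ ℕ)
  determined : ∀ t < rounds, ∀ D ∈ I, ∀ D' ∈ I, ∀ j, SameView msg t j D D' →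
    msg t D j = msg t D' j
  held : ∀ t < rounds, ∀ D ∈ I, ∀ j i x, Sum.inl x ∈ msg t D j i → HoldsAt msg t D j x
  load_le : ∀ t < rounds, ∀ D ∈ I, ∀ i, ∑ j, (msg t D j i).length ≤ cap D
  int_le : ∀ t < rounds, ∀ D ∈ I, ∀ j i n, Sum.inr n ∈ msg t D j i → n ≤ K D

namespace Protocol

variable {I : Set (Fin p → Finset τ)} {cap K : (Fin p → Finset τ) → ℕ}

/-- Server `i` can compute `f` from what it knows at the end. -/
def Knows {α : Type*} (P : Protocol I cap K) (i : Fin p) (f : (Fin p → Finset τ) → α) : Prop :=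
  ∀ D ∈ I, ∀ D' ∈ I, SameView P.msg P.rounds i D D' → f D = f D'

/-- Server `i` holds the tuple `x` at the end. -/
def Holds (P : Protocol I cap K) (D : Fin p → Finset τ) (i : Fin p) (x : τ) : Prop :=
  HoldsAt P.msg P.rounds D i x

/-- Every server can compute `f` for all tuples that it holds initially. -/
def HomeKnows {α : Type*} (P : Protocol I cap K) (f : (Fin p → Finset τ) → τ → α) : Prop :=
  ∀ i, ∀ D ∈ I, ∀ D' ∈ I, SameView P.msg P.rounds i D D' → ∀ t ∈ D i, f D t = f D' t

/-- `Q` extends `P` by at most `n` rounds. -/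
structure Ext (P Q : Protocol I cap K) (n : ℕ) : Prop where
  le : P.rounds ≤ Q.rounds
  le_add : Q.rounds ≤ P.rounds + n
  eq : ∀ t < P.rounds, Q.msg t = P.msg t

theorem Ext.refl (P : Protocol I cap K) (n : ℕ := 0) : Ext P P n := ⟨le_rfl, by omega, fun _ _ => rfl⟩

theorem Ext.trans {P Q R : Protocol I cap K} {m n : ℕ} (h : Ext P Q m) (h' : Ext Q R n) :
    Ext P R (m + n) :=
  ⟨h.le.trans h'.le, by have := h.le_add; have := h'.le_add; omega,
    fun t ht => (h'.eq t (lt_of_lt_of_le ht h.le)).trans (h.eq t ht)⟩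

theorem Ext.weaken {P Q : Protocol I cap K} {m n : ℕ} (h : Ext P Q m) (hmn : m ≤ n) : Ext P Q n :=
  ⟨h.le, h.le_add.trans (by omega), h.eq⟩

theorem Ext.sameView {P Q : Protocol I cap K} {m : ℕ} (h : Ext P Q m) {i : Fin p}
    {D D' : Fin p → Finset τ} (hv : SameView Q.msg Q.rounds i D D') :
    SameView P.msg P.rounds i D D' :=
  ⟨hv.1, fun s hs j => by rw [← h.eq s hs]; exact hv.2 s (lt_of_lt_of_le hs h.le) j⟩

theorem Ext.knows {α : Type*} {P Q : Protocol I cap K} {m : ℕ} (h : Ext P Q m) {i : Fin p}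
    {f : (Fin p → Finset τ) → α} (hf : P.Knows i f) : Q.Knows i f :=
  fun D hD D' hD' hv => hf D hD D' hD' (h.sameView hv)

theorem Ext.homeKnows {α : Type*} {P Q : Protocol I cap K} {m : ℕ} (h : Ext P Q m)
    {f : (Fin p → Finset τ) → τ → α} (hf : P.HomeKnows f) : Q.HomeKnows f :=
  fun i D hD D' hD' hv => hf i D hD D' hD' (h.sameView hv)

theorem Ext.holds {P Q : Protocol I cap K} {m : ℕ} (h : Ext P Q m) {D : Fin p → Finset τ}
    {i : Fin p} {x : τ} (hx : P.Holds D i x) : Q.Holds D i x := by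
  rcases hx with hx | ⟨s, hs, j, hx⟩
  · exact Or.inl hx
  · exact Or.inr ⟨s, lt_of_lt_of_le hs h.le, j, by rw [h.eq s hs]; exact hx⟩

theorem Knows.const {α : Type*} {P : Protocol I cap K} {i : Fin p} (a : α) :
    P.Knows i (fun _ => a) := fun _ _ _ _ _ => rfl

theorem Knows.initial (P : Protocol I cap K) (i : Fin p) : P.Knows i (fun D => D i) :=
  fun _ _ _ _ hv => hv.1

theorem Knows.comp {α β : Type*} {P : Protocol I cap K} {i : Fin p}
    {f : (Fin p → Finset τ) → α} (hf : P.Knows i f) (φ : α → β) :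
    P.Knows i (fun D => φ (f D)) :=
  fun D hD D' hD' hv => congrArg φ (hf D hD D' hD' hv)

theorem Knows.comp₂ {α β γ : Type*} {P : Protocol I cap K} {i : Fin p}
    {f : (Fin p → Finset τ) → α} {g : (Fin p → Finset τ) → β} (hf : P.Knows i f)
    (hg : P.Knows i g) (φ : α → β → γ) : P.Knows i (fun D => φ (f D) (g D)) :=
  fun D hD D' hD' hv => by beta_reduce; rw [hf D hD D' hD' hv, hg D hD D' hD' hv]

theorem Knows.pi {ι : Type*} {α : ι → Type*} {P : Protocol I cap K} {i : Fin p}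
    {f : (Fin p → Finset τ) → (k : ι) → α k} (hf : ∀ k, P.Knows i (fun D => f D k)) :
    P.Knows i f := fun D hD D' hD' hv => funext fun k => hf k D hD D' hD' hv

theorem Knows.congr {α : Type*} {P : Protocol I cap K} {i : Fin p}
    {f g : (Fin p → Finset τ) → α} (hf : P.Knows i f) (h : ∀ D ∈ I, f D = g D) :
    P.Knows i g := fun D hD D' hD' hv => by rw [← h D hD, ← h D' hD', hf D hD D' hD' hv]

theorem HomeKnows.comp {α β : Type*} {P : Protocol I cap K} {f : (Fin p → Finset τ) → τ → α}
    (hf : P.HomeKnows f) (φ : τ → α → β) : P.HomeKnows (fun D t => φ t (f D t)) :=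
  fun i D hD D' hD' hv t ht => by beta_reduce; rw [hf i D hD D' hD' hv t ht]

theorem HomeKnows.comp₂ {α β γ : Type*} {P : Protocol I cap K} {f : (Fin p → Finset τ) → τ → α}
    {g : (Fin p → Finset τ) → τ → β} (hf : P.HomeKnows f) (hg : P.HomeKnows g)
    (φ : τ → α → β → γ) : P.HomeKnows (fun D t => φ t (f D t) (g D t)) :=
  fun i D hD D' hD' hv t ht => by beta_reduce; rw [hf i D hD D' hD' hv t ht, hg i D hD D' hD' hv t ht]

theorem HomeKnows.congr {α : Type*} {P : Protocol I cap K} {f g : (Fin p → Finset τ) → τ → α}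
    (hf : P.HomeKnows f) (h : ∀ D ∈ I, ∀ i, ∀ t ∈ D i, f D t = g D t) : P.HomeKnows g :=
  fun i D hD D' hD' hv t ht => by
    rw [← h D hD i t ht, ← h D' hD' i t (hv.1 ▸ ht), hf i D hD D' hD' hv t ht]

/-- One more round. -/
theorem extend (P : Protocol I cap K) (m : (Fin p → Finset τ) → Fin p → Fin p → List (τ ⊕ ℕ))
    (hk : ∀ j i, P.Knows j (fun D => m D j i))
    (hheld : ∀ D ∈ I, ∀ j i x, Sum.inl x ∈ m D j i → P.Holds D j x)
    (hload : ∀ D ∈ I, ∀ i, ∑ j, (m D j i).length ≤ cap D)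
    (hint : ∀ D ∈ I, ∀ j i n, Sum.inr n ∈ m D j i → n ≤ K D) :
    ∃ Q : Protocol I cap K, Ext P Q 1 ∧ (∀ i j, Q.Knows i (fun D => m D j i)) ∧
      (∀ D ∈ I, ∀ j i x, Sum.inl x ∈ m D j i → Q.Holds D i x) := by
  classical
  let msg' : ℕ → (Fin p → Finset τ) → Fin p → Fin p → List (τ ⊕ ℕ) :=
    fun t => if t < P.rounds then P.msg t else m
  have hlt : ∀ t < P.rounds, msg' t = P.msg t := fun t ht => if_pos ht
  have heq : msg' P.rounds = m := if_neg (lt_irrefl _)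
  have hsv : ∀ t ≤ P.rounds, ∀ i D D', SameView msg' t i D D' → SameView P.msg t i D D' := by
    intro t ht i D D' hv
    refine ⟨hv.1, fun s hs j => ?_⟩
    rw [← hlt s (by omega)]
    exact hv.2 s hs j
  have hh : ∀ t ≤ P.rounds, ∀ D i x, HoldsAt P.msg t D i x → HoldsAt msg' t D i x := by
    rintro t ht D i x (hx | ⟨s, hs, j, hx⟩)
    · exact Or.inl hx
    · exact Or.inr ⟨s, hs, j, by rw [hlt s (by omega)]; exact hx⟩
  refine ⟨⟨P.rounds + 1, msg', ?_, ?_, ?_, ?_⟩, ⟨?_, ?_, ?_⟩, ?_, ?_⟩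
  · intro t ht D hD D' hD' j hv
    have hv' := hsv t (by omega) j D D' hv
    rcases Nat.lt_succ_iff_lt_or_eq.1 ht with h | rfl
    · rw [hlt t h]; exact P.determined t h D hD D' hD' j hv'
    · rw [heq]; funext i; exact hk j i D hD D' hD' hv'
  · intro t ht D hD j i x hx
    rcases Nat.lt_succ_iff_lt_or_eq.1 ht with h | rfl
    · rw [hlt t h] at hx; exact hh t (by omega) _ _ _ (P.held t h D hD j i x hx)
    · rw [heq] at hx; exact hh _ le_rfl _ _ _ (hheld D hD j i x hx)
  · intro t ht D hD i
    rcases Nat.lt_succ_iff_lt_or_eq.1 ht with h | rfl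
    · rw [hlt t h]; exact P.load_le t h D hD i
    · rw [heq]; exact hload D hD i
  · intro t ht D hD j i n hn
    rcases Nat.lt_succ_iff_lt_or_eq.1 ht with h | rfl
    · rw [hlt t h] at hn; exact P.int_le t h D hD j i n hn
    · rw [heq] at hn; exact hint D hD j i n hn
  · exact Nat.le_succ _
  · exact le_rfl
  · exact fun t ht => hlt t ht
  · intro i j D _ D' _ hv
    have := hv.2 P.rounds (Nat.lt_succ_self _) j
    simp only [heq] at this
    exact this
  · intro D _ j i x hx
    exact Or.inr ⟨P.rounds, Nat.lt_succ_self _, j, by simp only [heq]; exact hx⟩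

/-- One more round, in which server `j` sends the units in `S D j i` to server `i`. -/
theorem send (P : Protocol I cap K) (S : (Fin p → Finset τ) → Fin p → Fin p → Finset (τ ⊕ ℕ))
    (hk : ∀ j i, P.Knows j (fun D => S D j i))
    (hheld : ∀ D ∈ I, ∀ j i x, Sum.inl x ∈ S D j i → P.Holds D j x)
    (hload : ∀ D ∈ I, ∀ i, ∑ j, (S D j i).card ≤ cap D)
    (hint : ∀ D ∈ I, ∀ j i n, Sum.inr n ∈ S D j i → n ≤ K D) :
    ∃ Q : Protocol I cap K, Ext P Q 1 ∧ (∀ i j, Q.Knows i (fun D => S D j i)) ∧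
      (∀ D ∈ I, ∀ j i x, Sum.inl x ∈ S D j i → Q.Holds D i x) := by
  classical
  obtain ⟨Q, hQ, h1, h2⟩ := P.extend (fun D j i => (S D j i).toList)
    (fun j i => (hk j i).comp Finset.toList)
    (fun D hD j i x hx => hheld D hD j i x (Finset.mem_toList.1 hx))
    (fun D hD i => by simpa using hload D hD i)
    (fun D hD j i n hn => hint D hD j i n (Finset.mem_toList.1 hn))
  refine ⟨Q, hQ, fun i j => ?_, fun D hD j i x hx => h2 D hD j i x (Finset.mem_toList.2 hx)⟩
  exact ((h1 i j).comp List.toFinset).congr fun D _ => Finset.toList_toFinset _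

/-- One more round with fixed senders and receivers: the unit in slot `q` is sent from `src q` to
`dst q`. -/
theorem route {Q : Type*} [Fintype Q] (P : Protocol I cap K) (src dst : Q → Fin p)
    (u : (Fin p → Finset τ) → Q → τ ⊕ ℕ) (hk : ∀ q, P.Knows (src q) (fun D => u D q))
    (hheld : ∀ D ∈ I, ∀ q x, u D q = Sum.inl x → P.Holds D (src q) x)
    (hload : ∀ D ∈ I, ∀ i, (Finset.univ.filter (dst · = i)).card ≤ cap D)
    (hint : ∀ D ∈ I, ∀ q n, u D q = Sum.inr n → n ≤ K D) :
    ∃ P' : Protocol I cap K, Ext P P' 1 ∧ (∀ q, P'.Knows (dst q) (fun D => u D q)) ∧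
      (∀ D ∈ I, ∀ q x, u D q = Sum.inl x → P'.Holds D (dst q) x) := by
  classical
  let l : Fin p → Fin p → List Q := fun j i =>
    (Finset.univ.filter fun q => dst q = i ∧ src q = j).toList
  have hl : ∀ j i q, q ∈ l j i ↔ dst q = i ∧ src q = j := by simp [l]
  obtain ⟨P', hP', h1, h2⟩ := P.extend (fun D j i => (l j i).map (u D))
    (fun j i D hD D' hD' hv => List.map_congr_left fun q hq =>
      hk q D hD D' hD' (((hl j i q).1 hq).2 ▸ hv))
    (fun D hD j i x hx => by
      obtain ⟨q, hq, he⟩ := List.mem_map.1 hx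
      exact ((hl j i q).1 hq).2 ▸ hheld D hD q x he)
    (fun D hD i => by
      refine le_trans (le_of_eq ?_) (hload D hD i)
      rw [Finset.card_eq_sum_card_fiberwise (f := src) (t := Finset.univ) (by simp)]
      simp [l, Finset.filter_filter])
    (fun D hD j i n hn => by
      obtain ⟨q, hq, he⟩ := List.mem_map.1 hn
      exact hint D hD q n he)
  refine ⟨P', hP', fun q D hD D' hD' hv => ?_, fun D hD q x hx => ?_⟩
  · exact List.map_inj_left.1 (h1 (dst q) (src q) D hD D' hD' hv) q ((hl _ _ q).2 ⟨rfl, rfl⟩)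
  · exact h2 D hD (src q) (dst q) x (List.mem_map.2 ⟨q, (hl _ _ q).2 ⟨rfl, rfl⟩, hx⟩)

/-- The units that represent an entry of a distributed array. -/
def encodeEntry : Option (τ × ℕ) → Bool → τ ⊕ ℕ
  | none, _ => Sum.inr 0
  | some (t, _), true => Sum.inl t
  | some (_, w), false => Sum.inr w

/-- An absent entry has an integer in the slot `true`, where a present one has a tuple, so the
padding `0` is never mistaken for data. -/
theorem encodeEntry_injective : Function.Injective (encodeEntry (τ := τ)) := by
  intro a b h
  have h1 := congrFun h true
  have h2 := congrFun h false
  rcases a with _ | ⟨t, w⟩ <;> rcases b with _ | ⟨t', w'⟩ <;> simp_all [encodeEntry]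

/-- One more round in which the entries of an array are moved. -/
theorem routeEntries {Q : Type*} [Fintype Q] (P : Protocol I cap K) (src dst : Q → Fin p)
    (a : (Fin p → Finset τ) → Q → Option (τ × ℕ)) (hk : ∀ q, P.Knows (src q) (fun D => a D q))
    (hheld : ∀ D ∈ I, ∀ q t w, a D q = some (t, w) → P.Holds D (src q) t)
    (hload : ∀ D ∈ I, ∀ i, 2 * (Finset.univ.filter (dst · = i)).card ≤ cap D)
    (hint : ∀ D ∈ I, ∀ q t w, a D q = some (t, w) → w ≤ K D) :
    ∃ P' : Protocol I cap K, Ext P P' 1 ∧ (∀ q, P'.Knows (dst q) (fun D => a D q)) ∧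
      (∀ D ∈ I, ∀ q t w, a D q = some (t, w) → P'.Holds D (dst q) t) := by
  classical
  obtain ⟨P', hP', h1, h2⟩ := P.route (Q := Q × Bool) (fun q => src q.1) (fun q => dst q.1)
    (fun D q => encodeEntry (a D q.1) q.2) (fun q => (hk q.1).comp fun x => encodeEntry x q.2)
    (by
      rintro D hD ⟨q, b⟩ x hx
      rcases h : a D q with _ | ⟨t, w⟩
      · simp [h, encodeEntry] at hx
      · cases b
        · simp [h, encodeEntry] at hx
        · simp only [h, encodeEntry, Sum.inl.injEq] at hx
          exact hx ▸ hheld D hD q t w h)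
    (by
      intro D hD i
      refine le_trans (le_of_eq ?_) (hload D hD i)
      rw [mul_comm, ← Fintype.card_bool, ← Finset.card_univ (α := Bool), ← Finset.card_product]
      congr 1
      ext ⟨q, b⟩
      simp)
    (by
      rintro D hD ⟨q, b⟩ n hn
      rcases h : a D q with _ | ⟨t, w⟩
      · simp only [h, encodeEntry, Sum.inr.injEq] at hn
        omega
      · cases b
        · simp only [h, encodeEntry, Sum.inr.injEq] at hn
          exact hn ▸ hint D hD q t w h
        · simp [h, encodeEntry] at hn)
  refine ⟨P', hP', fun q D hD D' hD' hv => encodeEntry_injective (funext fun b => ?_),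
    fun D hD q t w h => h2 D hD (q, true) t (by simp [h, encodeEntry])⟩
  exact h1 (q, b) D hD D' hD' hv

/-- The protocol without communication. -/
def nil (I : Set (Fin p → Finset τ)) (cap K : (Fin p → Finset τ) → ℕ) : Protocol I cap K where
  rounds := 0
  msg := fun _ _ _ _ => []
  determined := by simp
  held := by simp
  load_le := by simp
  int_le := by simp

open Classical in
/-- The view of a server in the execution of a protocol. -/
def view (P : Protocol I cap K) (D : Fin p → Finset τ) (t : ℕ) (i : Fin p) : View τ ℕ p :=
  ⟨D i, (List.range t).map fun s j => P.msg s D j i⟩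

theorem view_eq_iff (P : Protocol I cap K) (D D' : Fin p → Finset τ) (t : ℕ) (i : Fin p) :
    P.view D t i = P.view D' t i ↔ SameView P.msg t i D D' := by
  unfold view SameView
  rw [View.mk.injEq, List.map_inj_left]
  simp [funext_iff]

theorem view_holds_iff (P : Protocol I cap K) (D : Fin p → Finset τ) (t : ℕ) (i : Fin p) (x : τ) :
    (P.view D t i).Holds x ↔ HoldsAt P.msg t D i x := by
  unfold view View.Holds HoldsAt
  simp

open Classical in
/-- The algorithm that executes a protocol. -/
def toAlgorithm (P : Protocol I cap K) : Algorithm τ ℕ p where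
  rounds := P.rounds
  send := fun t j v i =>
    -- The sender picks any admissible input compatible with its view. By `determined` the choice
    -- does not affect the message; on views that arise from no admissible input nothing is sent.
    if h : t < P.rounds ∧ ∃ D ∈ I, P.view D t j = v then P.msg t h.2.choose j i else []
  tuple_based := by
    intro t j v i x hx
    split_ifs at hx with h
    · have := P.held t h.1 _ h.2.choose_spec.1 j i x hx
      rw [← P.view_holds_iff, h.2.choose_spec.2] at this
      exact this
    · simp at hx

theorem toAlgorithm_view_message (P : Protocol I cap K) {D : Fin p → Finset τ} (hD : D ∈ I)
    (t : ℕ) (ht : t ≤ P.rounds) : ∀ i, P.toAlgorithm.view D t i = P.view D t i := by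
  induction t with
  | zero => intro i; rfl
  | succ t ih =>
    intro i
    have ih := ih (by omega)
    have hm : ∀ j, P.toAlgorithm.send t j (P.view D t j) i = P.msg t D j i := by
      intro j
      have h : t < P.rounds ∧ ∃ D' ∈ I, P.view D' t j = P.view D t j := ⟨ht, D, hD, rfl⟩
      unfold toAlgorithm
      simp only
      rw [dif_pos h]
      exact congrFun (P.determined t ht _ h.2.choose_spec.1 D hD j
        ((P.view_eq_iff _ _ _ _).1 h.2.choose_spec.2)) i
    unfold Algorithm.view
    simp only [ih, hm]
    simp [view, List.range_succ]

theorem toAlgorithm_message (P : Protocol I cap K) {D : Fin p → Finset τ} (hD : D ∈ I)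
    {t : ℕ} (ht : t < P.rounds) (j i : Fin p) : P.toAlgorithm.message D t j i = P.msg t D j i := by
  have h : t < P.rounds ∧ ∃ D' ∈ I, P.view D' t j = P.view D t j := ⟨ht, D, hD, rfl⟩
  unfold Algorithm.message
  rw [P.toAlgorithm_view_message hD t ht.le]
  unfold toAlgorithm
  simp only
  rw [dif_pos h]
  exact congrFun (P.determined t ht _ h.2.choose_spec.1 D hD j
    ((P.view_eq_iff _ _ _ _).1 h.2.choose_spec.2)) i

theorem toAlgorithm_holds (P : Protocol I cap K) {D : Fin p → Finset τ} (hD : D ∈ I)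
    (i : Fin p) (x : τ) :
    (P.toAlgorithm.view D P.toAlgorithm.rounds i).Holds x ↔ P.Holds D i x := by
  rw [show P.toAlgorithm.rounds = P.rounds from rfl, P.toAlgorithm_view_message hD _ le_rfl,
    P.view_holds_iff]
  rfl

theorem toAlgorithm_load_le (P : Protocol I cap K) {D : Fin p → Finset τ} (hD : D ∈ I)
    (h0 : ∀ i, (D i).card ≤ cap D) : P.toAlgorithm.load D ≤ cap D := by
  refine max_le (Finset.sup_le fun i _ => h0 i) (Finset.sup_le fun t ht => Finset.sup_le fun i _ => ?_)
  have ht' : t < P.rounds := Finset.mem_range.1 ht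
  simp only [P.toAlgorithm_message hD ht']
  exact P.load_le t ht' D hD i

theorem toAlgorithm_integersAtMost (P : Protocol I cap K) {D : Fin p → Finset τ} (hD : D ∈ I) :
    P.toAlgorithm.IntegersAtMost D (K D) := by
  intro t ht i j n hn
  rw [P.toAlgorithm_message hD ht] at hn
  exact P.int_le t ht D hD _ _ n hn

/-- Protocols for the possible values of `size D`, which server `i₀` can see, are combined to one
protocol: first this value is broadcast. -/
theorem exists_glue (i₀ : Fin p) {size : Finset τ → ℕ} {T : ℕ}
    (P : (ℓ : ℕ) → Protocol {D ∈ I | size (D i₀) = ℓ} cap K) (hT : ∀ ℓ, (P ℓ).rounds ≤ T)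
    (hcap : ∀ D ∈ I, 1 ≤ cap D) (hK : ∀ D ∈ I, size (D i₀) ≤ K D) :
    ∃ Q : Protocol I cap K, Q.rounds ≤ T + 1 ∧
      ∀ D ∈ I, ∀ i x, (P (size (D i₀))).Holds D i x → Q.Holds D i x := by
  classical
  let R : ℕ → ℕ := fun ℓ => (P ℓ).rounds
  let M : ℕ → ℕ → (Fin p → Finset τ) → Fin p → Fin p → List (τ ⊕ ℕ) := fun ℓ => (P ℓ).msg
  -- Round `0` announces the size seen by `i₀`; round `t + 1` plays round `t` of the protocol for
  -- that size, and rounds beyond its length are silent.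
  let msg' : ℕ → (Fin p → Finset τ) → Fin p → Fin p → List (τ ⊕ ℕ) := fun t D j i =>
    match t with
    | 0 => if j = i₀ then [Sum.inr (size (D i₀))] else []
    | t + 1 => if t < R (size (D i₀)) then M (size (D i₀)) t D j i else []
  have hsz : ∀ t j D D', SameView msg' (t + 1) j D D' → size (D i₀) = size (D' i₀) := by
    intro t j D D' hv
    have := hv.2 0 (by omega) i₀
    simpa [msg'] using this
  have hsv : ∀ t j D D', SameView msg' (t + 1) j D D' → t ≤ R (size (D i₀)) →
      SameView (M (size (D i₀))) t j D D' := by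
    intro t j D D' hv ht
    refine ⟨hv.1, fun s hs i => ?_⟩
    have := hv.2 (s + 1) (by omega) i
    simp only [msg'] at this
    rw [← hsz t j D D' hv] at this
    rwa [if_pos (by omega), if_pos (by omega)] at this
  have hho : ∀ t D j x, t ≤ R (size (D i₀)) → HoldsAt (M (size (D i₀))) t D j x →
      ∀ t', t ≤ t' → HoldsAt msg' (t' + 1) D j x := by
    rintro t D j x ht (hx | ⟨s, hs, i, hx⟩) t' ht'
    · exact Or.inl hx
    · refine Or.inr ⟨s + 1, by omega, i, ?_⟩
      simp only [msg']
      rwa [if_pos (by omega)]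
  refine ⟨⟨T + 1, msg', ?_, ?_, ?_, ?_⟩, le_rfl, ?_⟩
  · intro t _ D hD D' hD' j hv
    funext i
    cases t with
    | zero =>
      by_cases h : j = i₀
      · subst h
        simp only [msg', hv.1]
      · simp [msg', h]
    | succ t =>
      have he := hsz t j D D' hv
      simp only [msg']
      rw [← he]
      by_cases ht : t < R (size (D i₀))
      · rw [if_pos ht, if_pos ht]
        exact congrFun ((P _).determined t ht D ⟨hD, rfl⟩ D' ⟨hD', he.symm⟩ j
          (hsv t j D D' hv ht.le)) i
      · rw [if_neg ht, if_neg ht]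
  · intro t _ D hD j i x hx
    cases t with
    | zero =>
      simp only [msg'] at hx
      split_ifs at hx <;> simp at hx
    | succ t =>
      simp only [msg'] at hx
      split_ifs at hx with ht
      · exact hho t D j x ht.le ((P _).held t ht D ⟨hD, rfl⟩ j i x hx) t le_rfl
      · simp at hx
  · intro t _ D hD i
    cases t with
    | zero =>
      simp only [msg']
      rw [Finset.sum_eq_single i₀]
      · simpa using hcap D hD
      · intro j _ hj; simp [hj]
      · simp
    | succ t =>
      simp only [msg']
      by_cases ht : t < R (size (D i₀))
      · simp only [if_pos ht]
        exact (P _).load_le t ht D ⟨hD, rfl⟩ i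
      · simp [if_neg ht]
  · intro t _ D hD j i n hn
    cases t with
    | zero =>
      simp only [msg'] at hn
      split_ifs at hn
      · simp at hn
        exact hn ▸ hK D hD
      · simp at hn
    | succ t =>
      simp only [msg'] at hn
      split_ifs at hn with ht
      · exact (P _).int_le t ht D ⟨hD, rfl⟩ j i n hn
      · simp at hn
  · intro D hD i x hx
    exact hho _ D i x le_rfl hx _ (hT _)

end Protocol

end Protocols

end MPCJoin

end

noncomputable section
namespace MPCJoin

/-! ### Sorting a distributed array -/

section DistributedSort

theorem exists_sortIdx {κ : Type*} [LinearOrder κ] (B : Finset ℕ) (f : {q // q ∈ B} → κ) :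
    ∃ π : {q // q ∈ B} → {q // q ∈ B}, Function.Injective π ∧ Monotone (f ∘ π) := by
  let e : Fin B.card ≃o B := B.orderIsoOfFin rfl
  let σ := Tuple.sort (f ∘ e)
  refine ⟨fun q => e (σ (e.symm q)), ?_, ?_⟩
  · intro a b h
    exact e.symm.injective (σ.injective (e.injective h))
  · intro a b h
    exact Tuple.monotone_sort (f ∘ e) (e.symm.monotone h)

/-- A sorting permutation of a block. -/
def sortPerm {κ : Type*} [LinearOrder κ] (B : Finset ℕ) (f : {q // q ∈ B} → κ) :
    {q // q ∈ B} → {q // q ∈ B} := (exists_sortIdx B f).choose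

open Classical in
/-- The position in the block `B` from which the entry at `q` comes when `B` is sorted. -/
def sortIdx {κ : Type*} [LinearOrder κ] (B : Finset ℕ) (f : ℕ → κ) (q : ℕ) : ℕ :=
  if h : q ∈ B then (sortPerm B (fun x => f x) ⟨q, h⟩ : ℕ) else q

variable {κ : Type*} [LinearOrder κ]

theorem sortIdx_mem {B : Finset ℕ} (f : ℕ → κ) {q : ℕ} (hq : q ∈ B) : sortIdx B f q ∈ B := by
  unfold sortIdx
  rw [dif_pos hq]
  exact Subtype.prop _

theorem sortIdx_injOn (B : Finset ℕ) (f : ℕ → κ) : Set.InjOn (sortIdx B f) B := by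
  intro q hq q' hq' h
  unfold sortIdx at h
  rw [dif_pos (Finset.mem_coe.1 hq), dif_pos (Finset.mem_coe.1 hq')] at h
  have := (exists_sortIdx B fun x => f x).choose_spec.1 (Subtype.ext h)
  exact congrArg Subtype.val this

theorem sortIdx_mono {B : Finset ℕ} (f : ℕ → κ) {q q' : ℕ} (hq : q ∈ B) (hq' : q' ∈ B)
    (h : q ≤ q') : f (sortIdx B f q) ≤ f (sortIdx B f q') := by
  unfold sortIdx
  rw [dif_pos hq, dif_pos hq']
  exact (exists_sortIdx B fun x => f x).choose_spec.2 (show (⟨q, hq⟩ : {q // q ∈ B}) ≤ ⟨q', hq'⟩ from h)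

theorem sortIdx_congr {B : Finset ℕ} {f f' : ℕ → κ} (h : ∀ q ∈ B, f q = f' q) (q : ℕ) :
    sortIdx B f q = sortIdx B f' q := by
  have : (fun x : {q // q ∈ B} => f x.1) = fun x : {q // q ∈ B} => f' x.1 := funext fun x => h x.1 x.2
  unfold sortIdx
  rw [this]

/-- The block of the position `q`. -/
def blockOf (n : ℕ) (b : ℕ → ℕ) (q : ℕ) : Finset ℕ := (Finset.range n).filter fun x => b x = b q

theorem mem_blockOf {n : ℕ} {b : ℕ → ℕ} {q x : ℕ} : x ∈ blockOf n b q ↔ x < n ∧ b x = b q := by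
  simp [blockOf]

/-- The array `x` with every block of `b` sorted by `key`. -/
def sortLayer {X : Type*} (n : ℕ) (key : X → κ) (b : ℕ → ℕ) (x : ℕ → X) (q : ℕ) : X :=
  x (sortIdx (blockOf n b q) (fun q => key (x q)) q)

/-- `x'` is a rearrangement of `x`. -/
def IsRearrangement {X : Type*} (n : ℕ) (x x' : ℕ → X) : Prop :=
  ∃ π : ℕ → ℕ, Set.InjOn π (Finset.range n) ∧
    ∀ q ∈ Finset.range n, π q ∈ Finset.range n ∧ x' q = x (π q)

theorem IsRearrangement.trans {X : Type*} {n : ℕ} {x y z : ℕ → X} (h : IsRearrangement n x y)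
    (h' : IsRearrangement n y z) : IsRearrangement n x z := by
  obtain ⟨π, hi, hπ⟩ := h
  obtain ⟨ρ, hj, hρ⟩ := h'
  exact ⟨π ∘ ρ, hi.comp hj fun q hq => (hρ q hq).1, fun q hq =>
    ⟨(hπ _ (hρ q hq).1).1, by rw [(hρ q hq).2, (hπ _ (hρ q hq).1).2]; rfl⟩⟩

theorem IsRearrangement.refl {X : Type*} (n : ℕ) (x : ℕ → X) : IsRearrangement n x x :=
  ⟨id, Set.injOn_id _, fun _ hq => ⟨hq, rfl⟩⟩

theorem IsRearrangement.image_eq {X : Type*} {n : ℕ} {x y : ℕ → X} (h : IsRearrangement n x y) :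
    ∃ π : ℕ → ℕ, Set.InjOn π (Finset.range n) ∧ (Finset.range n).image π = Finset.range n ∧
      ∀ q ∈ Finset.range n, y q = x (π q) := by
  obtain ⟨π, hi, hπ⟩ := h
  refine ⟨π, hi, ?_, fun q hq => (hπ q hq).2⟩
  apply Finset.eq_of_subset_of_card_le
  · intro q hq
    obtain ⟨q', hq', rfl⟩ := Finset.mem_image.1 hq
    exact (hπ q' hq').1
  · rw [Finset.card_image_of_injOn hi]

theorem IsRearrangement.sum_eq {X : Type*} {n : ℕ} {x y : ℕ → X} (h : IsRearrangement n x y)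
    (φ : X → ℕ) : ∑ q ∈ Finset.range n, φ (y q) = ∑ q ∈ Finset.range n, φ (x q) := by
  obtain ⟨π, hi, him, hπ⟩ := h.image_eq
  conv_rhs => rw [← him, Finset.sum_image hi]
  exact Finset.sum_congr rfl fun q hq => by rw [hπ q hq]

section

variable {X : Type*} (n : ℕ) (key : X → κ) (b : ℕ → ℕ) (x : ℕ → X)

theorem sortLayer_idx {q : ℕ} (hq : q < n) :
    sortIdx (blockOf n b q) (fun q => key (x q)) q < n ∧
      b (sortIdx (blockOf n b q) (fun q => key (x q)) q) = b q :=
  mem_blockOf.1 (sortIdx_mem _ (mem_blockOf.2 ⟨hq, rfl⟩))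

theorem sortLayer_injOn : Set.InjOn (fun q =>
    sortIdx (blockOf n b q) (fun q => key (x q)) q) (Finset.range n) := by
  intro q hq q' hq' h
  have hq := Finset.mem_range.1 (Finset.mem_coe.1 hq)
  have hq' := Finset.mem_range.1 (Finset.mem_coe.1 hq')
  have h1 := (sortLayer_idx n key b x hq).2
  have h2 := (sortLayer_idx n key b x hq').2
  beta_reduce at h
  have hb : b q = b q' := by rw [← h1, ← h2, h]
  have he : blockOf n b q = blockOf n b q' := by unfold blockOf; rw [hb]
  rw [he] at h
  exact sortIdx_injOn _ _ (Finset.mem_coe.2 (mem_blockOf.2 ⟨hq, hb⟩))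
    (Finset.mem_coe.2 (mem_blockOf.2 ⟨hq', rfl⟩)) h

theorem sortLayer_rearrangement : IsRearrangement n x (sortLayer n key b x) :=
  ⟨_, sortLayer_injOn n key b x, fun _ hq =>
    ⟨Finset.mem_range.2 (sortLayer_idx n key b x (Finset.mem_range.1 hq)).1, rfl⟩⟩

theorem sortLayer_blockStep : BlockStep (Finset.range n) b (fun q => key (x q))
    (fun q => key (sortLayer n key b x q)) := by
  refine ⟨_, sortLayer_injOn n key b x, fun q hq =>
    ⟨Finset.mem_range.2 (sortLayer_idx n key b x (Finset.mem_range.1 hq)).1,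
      (sortLayer_idx n key b x (Finset.mem_range.1 hq)).2, rfl⟩, ?_⟩
  intro q hq q' hq' he hle
  have hB : blockOf n b q' = blockOf n b q := by unfold blockOf; rw [he]
  simp only [sortLayer, hB]
  exact sortIdx_mono (fun q => key (x q)) (mem_blockOf.2 ⟨Finset.mem_range.1 hq', he⟩)
    (mem_blockOf.2 ⟨Finset.mem_range.1 hq, rfl⟩) hle

variable {n b x}

/-- Sorting acts on each block separately, so a server that knows one block can compute the new
contents of that block without further communication. -/
theorem sortLayer_congr {x' : ℕ → X} {q : ℕ} (hq : q < n)
    (h : ∀ q' < n, b q' = b q → x q' = x' q') :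
    sortLayer n key b x q = sortLayer n key b x' q := by
  unfold sortLayer
  have h' : ∀ q' ∈ blockOf n b q, x q' = x' q' :=
    fun q' hq' => h q' (mem_blockOf.1 hq').1 (mem_blockOf.1 hq').2
  rw [sortIdx_congr (f := fun q => key (x q)) (f' := fun q => key (x' q))
    (fun q' hq' => by rw [h' q' hq'])]
  exact h' _ (sortIdx_mem _ (mem_blockOf.2 ⟨hq, rfl⟩))

end

variable {τ : Type*} {p : ℕ} {I : Set (Fin p → Finset τ)} {cap K : (Fin p → Finset τ) → ℕ}

/-- The entries of the array `a` at the positions below `n` are distributed by `σ`. -/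
structure Protocol.ArrayAt (P : Protocol I cap K) (n : ℕ) (σ : ℕ → Fin p)
    (a : (Fin p → Finset τ) → ℕ → Option (τ × ℕ)) : Prop where
  knows : ∀ q < n, P.Knows (σ q) (fun D => a D q)
  holds : ∀ D ∈ I, ∀ q < n, ∀ t w, a D q = some (t, w) → P.Holds D (σ q) t

/-- The server for the block or position `x`. -/
def serverOf [NeZero p] (x : ℕ) : Fin p := Fin.ofNat p x

theorem serverOf_val [NeZero p] (x : ℕ) : (serverOf x : Fin p).val = x % p := rfl

/-- One round per layer: block `c` is gathered on server `c % p` and sorted there locally. The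
layers do not depend on the data, so sources and destinations are fixed and no addresses are sent.
The factor `2` in the load arises because an entry is sent as two units. -/
theorem Protocol.sortByLayers [NeZero p] (P : Protocol I cap K) {n : ℕ} {σ : ℕ → Fin p}
    {a : (Fin p → Finset τ) → ℕ → Option (τ × ℕ)} (ha : P.ArrayAt n σ a)
    (key : Option (τ × ℕ) → κ) (L : ℕ → ℕ → ℕ) (k : ℕ)
    (hint : ∀ D ∈ I, ∀ q < n, ∀ t w, a D q = some (t, w) → w ≤ K D)
    (hload : ∀ D ∈ I, ∀ i < k, ∀ s : Fin p,
      2 * ((Finset.range n).filter fun q => serverOf (L i q) = s).card ≤ cap D) :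
    ∃ P' : Protocol I cap K, Protocol.Ext P P' k ∧
      ∃ seq : (Fin p → Finset τ) → ℕ → ℕ → Option (τ × ℕ), (∀ D, seq D 0 = a D) ∧
        (∀ D, ∀ i < k, BlockStep (Finset.range n) (L i) (fun q => key (seq D i q))
          (fun q => key (seq D (i + 1) q))) ∧
        (∀ D, IsRearrangement n (a D) (seq D k)) ∧
        ∃ σ' : ℕ → Fin p, P'.ArrayAt n σ' (fun D => seq D k) := by
  let seq : (Fin p → Finset τ) → ℕ → ℕ → Option (τ × ℕ) := fun D i =>
    Nat.rec (a D) (fun i x => sortLayer n key (L i) x) i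
  have hsucc : ∀ D i, seq D (i + 1) = sortLayer n key (L i) (seq D i) := fun D i => rfl
  have hre : ∀ D i, IsRearrangement n (a D) (seq D i) := by
    intro D i
    induction i with
    | zero => exact IsRearrangement.refl _ _
    | succ i ih => exact ih.trans (by rw [hsucc]; exact sortLayer_rearrangement _ _ _ _)
  have main : ∃ P' : Protocol I cap K, Protocol.Ext P P' k ∧
      ∃ σ' : ℕ → Fin p, P'.ArrayAt n σ' (fun D => seq D k) := by
    induction k with
    | zero => exact ⟨P, Protocol.Ext.refl P, σ, ha⟩
    | succ k ih =>
      obtain ⟨P₁, h₁, σ₁, h₂⟩ := ih fun D hD i hi s => hload D hD i (by omega) s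
      obtain ⟨P₂, h₃, h₄, h₅⟩ := P₁.routeEntries (Q := Fin n) (fun q => σ₁ q)
        (fun q => serverOf (L k q)) (fun D q => seq D k q) (fun q => h₂.knows q q.2)
        (fun D hD q t w h => h₂.holds D hD q q.2 t w h)
        (fun D hD s => by
          refine le_trans (Nat.mul_le_mul_left 2 ?_) (hload D hD k (by omega) s)
          apply Finset.card_le_card_of_injOn (fun q : Fin n => (q : ℕ))
          · intro q hq
            simpa using hq
          · intro q _ q' _ h
            exact Fin.ext h)
        (fun D hD q t w h => by
          obtain ⟨π, -, hπ⟩ := hre D k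
          obtain ⟨h1, h2⟩ := hπ q (Finset.mem_range.2 q.2)
          rw [h2] at h
          exact hint D hD _ (Finset.mem_range.1 h1) t w h)
      refine ⟨P₂, h₁.trans h₃, fun q => serverOf (L k q), ⟨?_, ?_⟩⟩
      · intro q hq D hD D' hD' hv
        beta_reduce
        rw [hsucc, hsucc]
        exact sortLayer_congr key hq fun q' hq' hb => h₄ ⟨q', hq'⟩ D hD D' hD' (by rw [hb]; exact hv)
      · intro D hD q hq t w h
        rw [hsucc] at h
        have h1 := sortLayer_idx n key (L k) (seq D k) hq
        have := h₅ D hD ⟨_, h1.1⟩ t w h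
        simp only [h1.2] at this
        exact this
  obtain ⟨P', h1, σ', h2⟩ := main
  exact ⟨P', h1, seq, fun D => rfl, fun D i _ => by rw [hsucc]; exact sortLayer_blockStep _ _ _ _,
    fun D => hre D k, σ', h2⟩

end DistributedSort

/-! ### Aggregation along trees of servers -/

section Scan

variable {τ : Type*} {p : ℕ} {I : Set (Fin p → Finset τ)} {cap K : (Fin p → Finset τ) → ℕ}

/-- `F D` is computed from its values on the parts of a partition. -/
def Decomposable (F : (Fin p → Finset τ) → Finset ℕ → ℕ) (op : ℕ → ℕ → ℕ) : Prop :=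
  (∀ D, F D ∅ = 0) ∧ ∀ D A B, Disjoint A B → F D (A ∪ B) = op (F D A) (F D B)

theorem Decomposable.knows_union {F : (Fin p → Finset τ) → Finset ℕ → ℕ} {op : ℕ → ℕ → ℕ}
    (hF : Decomposable F op) {P : Protocol I cap K} {i : Fin p} {A B C : Finset ℕ}
    (hA : P.Knows i (fun D => F D A)) (hB : P.Knows i (fun D => F D B)) (hAB : Disjoint A B)
    (hC : A ∪ B = C) : P.Knows i (fun D => F D C) := by
  rw [← hC]
  exact (hA.comp₂ hB op).congr fun D _ => (hF.2 D A B hAB).symm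

theorem Decomposable.knows_empty {F : (Fin p → Finset τ) → Finset ℕ → ℕ} {op : ℕ → ℕ → ℕ}
    (hF : Decomposable F op) (P : Protocol I cap K) (i : Fin p) : P.Knows i (fun D => F D ∅) :=
  (Protocol.Knows.const 0).congr fun D _ => (hF.1 D).symm

/-- Aggregation over the servers along a tree of degree `g` and depth `d`. -/
theorem Protocol.scanServers (P : Protocol I cap K) {F : (Fin p → Finset τ) → Finset ℕ → ℕ}
    {op : ℕ → ℕ → ℕ} (hF : Decomposable F op) (hk : ∀ i : Fin p, P.Knows i (fun D => F D {i.val}))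
    {g d : ℕ} (hg : 0 < g) (hgd : p ≤ g ^ d) (hint : ∀ D ∈ I, ∀ A, F D A ≤ K D)
    (hload : ∀ D ∈ I, g ≤ cap D) :
    ∃ P' : Protocol I cap K, Protocol.Ext P P' d ∧
      ∀ i : Fin p, P'.Knows i (fun D => F D (Finset.range i)) ∧
        P'.Knows i (fun D => F D (Finset.range p)) := by
  classical
  -- At height `j` server `i` knows the aggregate over its block of `g ^ j` consecutive servers and
  -- over the part of that block before `i`. In the next round it learns the aggregates of the `g`
  -- sibling blocks from their first servers.
  let blk : ℕ → ℕ → Finset ℕ := fun j i => (Finset.range p).filter fun s => s / g ^ j = i / g ^ j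
  let pre : ℕ → ℕ → Finset ℕ := fun j i => (blk j i).filter (· < i)
  have main : ∀ j ≤ d, ∃ P' : Protocol I cap K, Protocol.Ext P P' j ∧
      ∀ i : Fin p, P'.Knows i (fun D => F D (pre j i)) ∧ P'.Knows i (fun D => F D (blk j i)) := by
    intro j
    induction j with
    | zero =>
      refine fun _ => ⟨P, Protocol.Ext.refl P, fun i => ⟨?_, ?_⟩⟩
      · have : pre 0 i = ∅ := by
          ext s; simp only [pre, blk, Finset.mem_filter]; simp; omega
        rw [this]; exact hF.knows_empty P i
      · have : blk 0 i = {i.val} := by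
          ext s; simp only [blk, Finset.mem_filter]; simp; omega
        rw [this]; exact hk i
    | succ j ih =>
      intro hj
      obtain ⟨P₁, h₁, h₂⟩ := ih (by omega)
      set G := g ^ j with hG
      have hG0 : 0 < G := by positivity
      have hGs : g ^ (j + 1) = G * g := by rw [hG, pow_succ]
      -- the leader of the `a`-th part of the block of `i`
      let ld : ℕ → ℕ → ℕ := fun i a => (i / (G * g) * g + a) * G
      obtain ⟨P₂, h₃, h₄, -⟩ := P₁.route (Q := Fin p × Fin g)
        -- A leader index beyond the last server belongs to an empty block; there the receiver
        -- formally sends itself a dummy `0`.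
        (fun q => if h : ld q.1 q.2 < p then ⟨ld q.1 q.2, h⟩ else q.1) (fun q => q.1)
        (fun D q => if ld q.1 q.2 < p then Sum.inr (F D (blk j (ld q.1 q.2))) else Sum.inr 0)
        (by
          intro q
          by_cases h : ld q.1 q.2 < p
          · simp only [h, dif_pos, if_true]
            exact (h₂ ⟨_, h⟩).2.comp Sum.inr
          · simp only [h, if_false]
            exact Protocol.Knows.const _)
        (by
          intro D _ q x hx
          split_ifs at hx)
        (by
          intro D hD i
          refine le_trans (le_of_eq ?_) (hload D hD)
          have : (Finset.univ.filter fun q : Fin p × Fin g => q.1 = i) = {i} ×ˢ Finset.univ := by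
            ext ⟨a, b⟩; simp [eq_comm]
          rw [this, Finset.card_product]; simp)
        (by
          intro D hD q n hn
          split_ifs at hn
          · simp only [Sum.inr.injEq] at hn
            exact hn ▸ hint D hD _
          · simp only [Sum.inr.injEq] at hn
            omega)
      refine ⟨P₂, h₁.trans h₃, fun i => ?_⟩
      let sub : ℕ → Finset ℕ := fun a =>
        (Finset.range p).filter fun s => s / G = i / (G * g) * g + a
      have hdd : ∀ s, s / g ^ (j + 1) = s / G / g := fun s => by rw [hGs, Nat.div_div_eq_div_mul]
      have hsub : ∀ a < g, P₂.Knows i (fun D => F D (sub a)) := by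
        intro a ha
        by_cases h : ld i a < p
        · have e : sub a = blk j (ld i a) := by
            simp only [sub, blk, ld, ← hG]
            rw [Nat.mul_div_cancel _ hG0]
          have := h₄ (i, ⟨a, ha⟩)
          simp only [h, if_true] at this
          rw [e]
          exact (this.comp (Sum.elim (fun _ => 0) id)).congr fun D _ => rfl
        · have e : sub a = ∅ := by
            apply Finset.filter_eq_empty_iff.2
            intro s hs he
            rw [Finset.mem_range] at hs
            have := Nat.div_mul_le_self s G
            rw [he] at this
            exact h (lt_of_le_of_lt this hs)
          rw [e]
          exact hF.knows_empty P₂ i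
      have hU : ∀ m ≤ g, P₂.Knows i (fun D => F D ((Finset.range p).filter fun s =>
          i / (G * g) * g ≤ s / G ∧ s / G < i / (G * g) * g + m)) := by
        intro m
        induction m with
        | zero =>
          intro _
          rw [Finset.filter_eq_empty_iff.2 (by intro s _; omega)]
          exact hF.knows_empty P₂ i
        | succ m ihm =>
          intro hm
          refine hF.knows_union (ihm (by omega)) (hsub m (by omega)) ?_ ?_
          · rw [Finset.disjoint_left]
            intro s hs hs'
            simp only [sub, Finset.mem_filter] at hs hs'
            omega
          · ext s
            simp only [sub, Finset.mem_union, Finset.mem_filter, Finset.mem_range]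
            constructor
            · rintro (h | h) <;> exact ⟨h.1, by omega, by omega⟩
            · rintro ⟨h1, h2, h3⟩
              by_cases h : s / G < i / (G * g) * g + m
              · exact Or.inl ⟨h1, h2, h⟩
              · exact Or.inr ⟨h1, by omega⟩
      have hiG : i.val / (G * g) = i.val / G / g := (Nat.div_div_eq_div_mul _ _ _).symm
      have hmod := Nat.div_add_mod (i.val / G) g
      have hmlt := Nat.mod_lt (i.val / G) hg
      constructor
      · refine hF.knows_union (h₃.knows (h₂ i).1) (hU (i.val / G % g) hmlt.le) ?_ ?_
        · rw [Finset.disjoint_left]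
          intro s hs hs'
          simp only [pre, blk, Finset.mem_filter] at hs hs'
          have h1 := hs.1.2
          rw [← hG] at h1
          rw [hiG, mul_comm (i.val / G / g) g] at hs'
          omega
        · ext s
          simp only [pre, blk, Finset.mem_union, Finset.mem_filter, Finset.mem_range, hdd]
          rw [hiG, mul_comm (i.val / G / g) g, hmod, ← hG]
          constructor
          · rintro (h | h)
            · exact ⟨⟨h.1.1, by rw [h.1.2]⟩, h.2⟩
            · have hlt : s < i := by
                by_contra hcon
                have := Nat.div_le_div_right (c := G) (not_lt.1 hcon)
                omega
              refine ⟨⟨h.1, ?_⟩, hlt⟩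
              apply le_antisymm
              · exact Nat.div_le_div_right h.2.2.le
              · rw [Nat.le_div_iff_mul_le hg, mul_comm]
                exact h.2.1
          · rintro ⟨⟨h1, h2⟩, h3⟩
            by_cases h : s / G = i.val / G
            · exact Or.inl ⟨⟨h1, h⟩, h3⟩
            · refine Or.inr ⟨h1, ?_, ?_⟩
              · rw [← h2]; exact Nat.mul_div_le _ _
              · exact lt_of_le_of_ne (Nat.div_le_div_right h3.le) h
      · have := hU g le_rfl
        have e : blk (j + 1) i = (Finset.range p).filter fun s =>
            i / (G * g) * g ≤ s / G ∧ s / G < i / (G * g) * g + g := by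
          ext s
          simp only [blk, Finset.mem_filter, hdd, hiG]
          constructor
          · rintro ⟨h1, h2⟩
            refine ⟨h1, ?_, ?_⟩
            · rw [← h2]; exact Nat.div_mul_le_self _ _
            · rw [← h2]; exact Nat.lt_div_mul_add hg
          · rintro ⟨h1, h2, h3⟩
            refine ⟨h1, ?_⟩
            apply Nat.div_eq_of_lt_le h2
            rw [Nat.succ_mul]; exact h3
        rw [e]
        exact this
  obtain ⟨P', h1, h2⟩ := main d le_rfl
  refine ⟨P', h1, fun i => ?_⟩
  have hz : ∀ s < p, s / g ^ d = 0 := fun s hs => Nat.div_eq_of_lt (lt_of_lt_of_le hs hgd)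
  have e1 : blk d i = Finset.range p := by
    apply Finset.filter_true_of_mem
    intro s hs
    rw [hz s (Finset.mem_range.1 hs), hz i i.2]
  have e2 : pre d i = Finset.range i := by
    simp only [pre, e1]
    ext s
    simp only [Finset.mem_filter, Finset.mem_range]
    have := i.2
    omega
  obtain ⟨h3, h4⟩ := h2 i
  rw [e2] at h3
  rw [e1] at h4
  exact ⟨h3, h4⟩

/-- Aggregation over the positions of a distributed array. -/
theorem Protocol.scanPositions [NeZero p] (P : Protocol I cap K)
    {F : (Fin p → Finset τ) → Finset ℕ → ℕ} {op : ℕ → ℕ → ℕ} (hF : Decomposable F op) {ℓ : ℕ}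
    (hℓ : 0 < ℓ) (hk : ∀ q < p * ℓ, P.Knows (serverOf (q / ℓ)) (fun D => F D {q}))
    {g d : ℕ} (hg : 0 < g) (hgd : p ≤ g ^ d) (hint : ∀ D ∈ I, ∀ A, F D A ≤ K D)
    (hload : ∀ D ∈ I, g ≤ cap D) :
    ∃ P' : Protocol I cap K, Protocol.Ext P P' d ∧
      (∀ q < p * ℓ, P'.Knows (serverOf (q / ℓ)) (fun D => F D (Finset.range q))) ∧
      ∀ i : Fin p, P'.Knows i (fun D => F D (Finset.range (p * ℓ))) := by
  classical
  -- Each server first aggregates its own `ℓ` positions, which reduces the problem to a scan over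
  -- servers; the local prefix is added at the end.
  let G : (Fin p → Finset τ) → Finset ℕ → ℕ := fun D A =>
    F D (A.biUnion fun s => Finset.Ico (s * ℓ) ((s + 1) * ℓ))
  have hdisj : ∀ s s' x, x ∈ Finset.Ico (s * ℓ) ((s + 1) * ℓ) →
      x ∈ Finset.Ico (s' * ℓ) ((s' + 1) * ℓ) → s = s' := by
    intro s s' x hx hx'
    rw [Finset.mem_Ico] at hx hx'
    have e1 : x / ℓ = s := Nat.div_eq_of_lt_le hx.1 hx.2
    have e2 : x / ℓ = s' := Nat.div_eq_of_lt_le hx'.1 hx'.2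
    omega
  have hG : Decomposable G op := by
    refine ⟨fun D => by simpa [G] using hF.1 D, fun D A B hAB => ?_⟩
    simp only [G]
    rw [Finset.union_biUnion]
    apply hF.2
    rw [Finset.disjoint_left]
    intro x hx hx'
    obtain ⟨s, hs, hxs⟩ := Finset.mem_biUnion.1 hx
    obtain ⟨s', hs', hxs'⟩ := Finset.mem_biUnion.1 hx'
    have := hdisj s s' x hxs hxs'
    exact Finset.disjoint_left.1 hAB hs (this ▸ hs')
  have hloc : ∀ s < p, ∀ m ≤ ℓ, P.Knows (serverOf s)
      (fun D => F D (Finset.Ico (s * ℓ) (s * ℓ + m))) := by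
    intro s hs m
    induction m with
    | zero => intro _; simpa using hF.knows_empty P (serverOf s)
    | succ m ih =>
      intro hm
      have hq : s * ℓ + m < p * ℓ := by
        calc s * ℓ + m < (s + 1) * ℓ := by rw [Nat.succ_mul]; omega
          _ ≤ p * ℓ := Nat.mul_le_mul_right _ hs
      have h1 := hk (s * ℓ + m) hq
      rw [mul_comm s ℓ, Nat.mul_add_div hℓ, Nat.div_eq_of_lt (by omega : m < ℓ), add_zero,
        mul_comm ℓ s] at h1
      refine hF.knows_union (ih (by omega)) h1 (by simp) ?_
      rw [← add_assoc, Finset.union_comm, ← Finset.insert_eq,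
        Nat.Ico_succ_right_eq_insert_Ico (by omega)]
  have hser : ∀ s, s < p → (serverOf s : Fin p).val = s := fun s hs => Nat.mod_eq_of_lt hs
  obtain ⟨P', h1, h2⟩ := P.scanServers hG (fun i => by
      have := hloc i i.2 ℓ le_rfl
      have e : (serverOf i.val : Fin p) = i := Fin.ext (hser i i.2)
      rw [e] at this
      simpa [G, Nat.succ_mul] using this) hg hgd (fun D hD A => hint D hD _) hload
  have hrange : ∀ s, (Finset.range s).biUnion (fun s => Finset.Ico (s * ℓ) ((s + 1) * ℓ)) =
      Finset.range (s * ℓ) := by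
    intro s
    ext x
    simp only [Finset.mem_biUnion, Finset.mem_range, Finset.mem_Ico]
    constructor
    · rintro ⟨s', h1, h2, h3⟩
      exact lt_of_lt_of_le h3 (Nat.mul_le_mul_right _ h1)
    · intro hx
      exact ⟨x / ℓ, (Nat.div_lt_iff_lt_mul hℓ).2 hx, Nat.div_mul_le_self _ _,
        by rw [Nat.succ_mul]; exact Nat.lt_div_mul_add hℓ⟩
  refine ⟨P', h1, fun q hq => ?_, fun i => ?_⟩
  · have hs : q / ℓ < p := (Nat.div_lt_iff_lt_mul hℓ).2 hq
    have h3 := (h2 (serverOf (q / ℓ))).1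
    rw [hser _ hs] at h3
    simp only [G, hrange] at h3
    have hm := Nat.mod_lt q hℓ
    have h4 := h1.knows (hloc (q / ℓ) hs (q % ℓ) hm.le)
    have he : q / ℓ * ℓ + q % ℓ = q := by rw [mul_comm]; exact Nat.div_add_mod q ℓ
    rw [he] at h4
    refine hF.knows_union h3 h4 ?_ ?_
    · rw [Finset.disjoint_left]
      intro x hx hx'
      rw [Finset.mem_range] at hx
      rw [Finset.mem_Ico] at hx'
      omega
    · ext x
      simp only [Finset.mem_union, Finset.mem_range, Finset.mem_Ico]
      have : q / ℓ * ℓ ≤ q := by omega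
      omega
  · have h3 := (h2 i).2
    simp only [G, hrange] at h3
    exact h3

end Scan

end MPCJoin

end

noncomputable section
namespace MPCJoin

/-! ### Prefix sums with respect to a key -/

section Prefix

/-- Prefix sums increase along a sorted array, so among the starts of groups up to `q` the start of
the group of `q` has the largest one. It is the weight of all strictly smaller keys. Thus sums over
smaller keys become a scan with `max`, even when a group extends over many servers. -/
theorem sup_groupStart {κ : Type*} [LinearOrder κ] {n : ℕ} {k : ℕ → κ} (w : ℕ → ℕ)
    (hk : MonotoneOn k (Finset.range n)) {q : ℕ} (hq : q < n) :
    (Finset.range (q + 1)).sup (fun x => if x = 0 ∨ k (x - 1) ≠ k x then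
      ∑ y ∈ Finset.range x, w y else 0) =
      ∑ y ∈ (Finset.range n).filter (fun y => k y < k q), w y := by
  have hmono : ∀ x y, x ≤ y → y < n → k x ≤ k y := fun x y h hy =>
    hk (by simp; omega) (by simpa using hy) h
  obtain ⟨c, hc⟩ : ∃ c, (Finset.range n).filter (fun y => k y < k q) = Finset.range c := by
    classical
    have hex : ∃ x, k q ≤ k x ∧ x < n := ⟨q, le_rfl, hq⟩
    refine ⟨Nat.find hex, ?_⟩
    have hs := Nat.find_spec hex
    ext y
    simp only [Finset.mem_filter, Finset.mem_range]
    constructor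
    · rintro ⟨h1, h2⟩
      by_contra hcon
      exact absurd (hs.1.trans (hmono _ _ (not_lt.1 hcon) h1)) (not_le.2 h2)
    · intro h
      have := Nat.find_min hex h
      have hn : y < n := h.trans hs.2
      exact ⟨hn, by by_contra hcon; exact this ⟨not_lt.1 hcon, hn⟩⟩
  have hmem : ∀ y, y < c ↔ y < n ∧ k y < k q := by
    intro y
    rw [← Finset.mem_range, ← hc, Finset.mem_filter, Finset.mem_range]
  have hcq : c ≤ q := by
    by_contra hcon
    exact lt_irrefl _ ((hmem q).1 (not_le.1 hcon)).2
  rw [hc]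
  apply le_antisymm
  · apply Finset.sup_le
    intro x hx
    rw [Finset.mem_range] at hx
    split_ifs with h
    · apply Finset.sum_le_sum_of_subset
      intro y hy
      rw [Finset.mem_range] at hy ⊢
      by_contra hcon
      have h1 : k (x - 1) < k x := lt_of_le_of_ne (hmono _ _ (by omega) (by omega))
        (h.resolve_left (by omega))
      have h2 : k x ≤ k q := hmono _ _ (by omega) hq
      have := (hmem (x - 1)).2 ⟨by omega, h1.trans_le h2⟩
      omega
    · exact Nat.zero_le _
  · have hstart : c = 0 ∨ k (c - 1) ≠ k c := by
      rcases Nat.eq_zero_or_pos c with h | h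
      · exact Or.inl h
      · right
        intro he
        have h1 := (hmem (c - 1)).1 (by omega)
        have := (hmem c).2 ⟨by omega, he ▸ h1.2⟩
        omega
    refine le_trans (le_of_eq ?_) (Finset.le_sup (f := fun x => if x = 0 ∨ k (x - 1) ≠ k x then
      ∑ y ∈ Finset.range x, w y else 0) (Finset.mem_range.2 (by omega : c < q + 1)))
    rw [if_pos hstart]

variable {τ : Type*} {p : ℕ}

open Classical in
/-- All tuples of the input. -/
def allTuples (D : Fin p → Finset τ) : Finset τ := Finset.univ.biUnion D

theorem mem_allTuples {D : Fin p → Finset τ} {t : τ} : t ∈ allTuples D ↔ ∃ i, t ∈ D i := by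
  simp [allTuples]

open Classical in
/-- An enumeration of a finite set. -/
def rankOf (S : Finset τ) (t : τ) : ℕ := if h : t ∈ S then S.equivFin ⟨t, h⟩ else 0

theorem rankOf_lt {S : Finset τ} {t : τ} (h : t ∈ S) : rankOf S t < S.card := by
  unfold rankOf; rw [dif_pos h]; exact Fin.is_lt _

theorem rankOf_inj {S : Finset τ} {t t' : τ} (h : t ∈ S) (h' : t' ∈ S)
    (he : rankOf S t = rankOf S t') : t = t' := by
  unfold rankOf at he
  rw [dif_pos h, dif_pos h'] at he
  have := S.equivFin.injective (Fin.ext he)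
  exact congrArg Subtype.val this

/-- The conditions under which the communication primitives work: `g` is the degree of the trees,
`d` their depth. -/
structure Regime (I : Set (Fin p → Finset τ)) (cap : (Fin p → Finset τ) → ℕ)
    (ℓ g d β : ℕ) : Prop where
  g_pos : 0 < g
  sq_le : 2 * g ^ 2 ≤ ℓ
  le_pow : p ≤ g ^ d
  pow_le : (g + 1) ^ d ≤ β * p
  disjoint : ∀ D ∈ I, ∀ i j, i ≠ j → Disjoint (D i) (D j)
  card_le : ∀ D ∈ I, ∀ i, (D i).card ≤ ℓ
  cap_ge : ∀ D ∈ I, 4 * (β + 1) * ℓ ≤ cap D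

variable {I : Set (Fin p → Finset τ)} {cap K : (Fin p → Finset τ) → ℕ} {ℓ g d β : ℕ}

theorem Regime.pos (h : Regime I cap ℓ g d β) : 0 < ℓ :=
  lt_of_lt_of_le (by have := h.g_pos; positivity) h.sq_le

theorem Regime.le_cap (h : Regime I cap ℓ g d β) {D : Fin p → Finset τ} (hD : D ∈ I) :
    4 * ℓ ≤ cap D := by
  have := h.cap_ge D hD
  nlinarith [Nat.zero_le (β * ℓ)]

theorem Regime.g_le_cap (h : Regime I cap ℓ g d β) {D : Fin p → Finset τ} (hD : D ∈ I) :
    g ≤ cap D := by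
  have h1 := h.le_cap hD
  have h2 := h.sq_le
  have : g ≤ g ^ 2 := Nat.le_self_pow (by norm_num) g
  omega

open Classical in
/-- The input as an array: server `i` has the positions from `i * ℓ` to `(i + 1) * ℓ`. -/
def inputArray [NeZero p] (ℓ : ℕ) (f : (Fin p → Finset τ) → τ → ℕ) (D : Fin p → Finset τ)
    (q : ℕ) : Option (τ × ℕ) :=
  if h : ∃ t ∈ D (serverOf (q / ℓ)), rankOf (D (serverOf (q / ℓ))) t = q % ℓ then
    -- The position travels with the weight so that the result can be returned to the home of the
    -- tuple after sorting.
    some (h.choose, Nat.pair (f D h.choose) q) else none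

/-- The position of a tuple of server `i` in the input array. -/
def slotOf (ℓ : ℕ) (S : Finset τ) (i : Fin p) (t : τ) : ℕ := i.val * ℓ + rankOf S t

theorem slotOf_div {S : Finset τ} {i : Fin p} {t : τ} (ht : t ∈ S) (hS : S.card ≤ ℓ) :
    slotOf ℓ S i t / ℓ = i.val ∧ slotOf ℓ S i t % ℓ = rankOf S t := by
  have h := (rankOf_lt ht).trans_le hS
  have hl : 0 < ℓ := by omega
  unfold slotOf
  rw [mul_comm, Nat.mul_add_div hl, Nat.div_eq_of_lt h, Nat.mul_add_mod, Nat.mod_eq_of_lt h]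
  exact ⟨by omega, rfl⟩

theorem slotOf_lt {S : Finset τ} {i : Fin p} {t : τ} (ht : t ∈ S) (hS : S.card ≤ ℓ) :
    slotOf ℓ S i t < p * ℓ := by
  have h := (rankOf_lt ht).trans_le hS
  unfold slotOf
  calc i.val * ℓ + rankOf S t < (i.val + 1) * ℓ := by rw [Nat.succ_mul]; omega
    _ ≤ p * ℓ := Nat.mul_le_mul_right _ i.2

section

variable [NeZero p]

theorem serverOf_fin (i : Fin p) : (serverOf i.val : Fin p) = i := Fin.ext (Nat.mod_eq_of_lt i.2)

theorem inputArray_eq_some {f : (Fin p → Finset τ) → τ → ℕ} {D : Fin p → Finset τ} {q : ℕ} {t : τ}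
    {w : ℕ} (h : inputArray ℓ f D q = some (t, w)) : t ∈ D (serverOf (q / ℓ)) ∧
      rankOf (D (serverOf (q / ℓ))) t = q % ℓ ∧ w = Nat.pair (f D t) q := by
  unfold inputArray at h
  split_ifs at h with hex
  rw [Option.some.injEq, Prod.mk.injEq] at h
  obtain ⟨rfl, rfl⟩ := h
  exact ⟨hex.choose_spec.1, hex.choose_spec.2, rfl⟩

theorem inputArray_slotOf {f : (Fin p → Finset τ) → τ → ℕ} {D : Fin p → Finset τ} {i : Fin p}
    {t : τ} (ht : t ∈ D i) (hS : (D i).card ≤ ℓ) :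
    inputArray ℓ f D (slotOf ℓ (D i) i t) =
      some (t, Nat.pair (f D t) (slotOf ℓ (D i) i t)) := by
  obtain ⟨h1, h2⟩ := slotOf_div (i := i) ht hS
  have hser : (serverOf (slotOf ℓ (D i) i t / ℓ) : Fin p) = i := by rw [h1, serverOf_fin]
  have hex : ∃ t' ∈ D (serverOf (slotOf ℓ (D i) i t / ℓ)),
      rankOf (D (serverOf (slotOf ℓ (D i) i t / ℓ))) t' = slotOf ℓ (D i) i t % ℓ := by
    rw [hser, h2]; exact ⟨t, ht, rfl⟩
  have hc : hex.choose = t := by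
    have h3 := hex.choose_spec
    generalize hex.choose = t' at h3
    rw [hser, h2] at h3
    exact rankOf_inj h3.1 ht h3.2
  unfold inputArray
  rw [dif_pos hex, hc]

-- The slots of tuples on different servers are disjoint and empty positions contribute nothing, so
-- a sum over the array is a sum over the input. With `IsRearrangement.sum_eq` this carries over to
-- the sorted array.
open Classical in
theorem sum_inputArray
    {D : Fin p → Finset τ} (hdis : ∀ i j, i ≠ j → Disjoint (D i) (D j))
    (hcard : ∀ i, (D i).card ≤ ℓ) (f : (Fin p → Finset τ) → τ → ℕ) (φ : Option (τ × ℕ) → ℕ)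
    (ψ : τ → ℕ) (h0 : φ none = 0) (hφ : ∀ t q, φ (some (t, Nat.pair (f D t) q)) = ψ t) :
    ∑ q ∈ Finset.range (p * ℓ), φ (inputArray ℓ f D q) = ∑ t ∈ allTuples D, ψ t := by
  unfold allTuples
  rw [Finset.sum_biUnion (fun i _ j _ hij => hdis i j hij)]
  rw [← Finset.sum_fiberwise_of_maps_to (s := Finset.range (p * ℓ)) (t := Finset.univ)
    (g := fun q => (serverOf (q / ℓ) : Fin p)) (by simp)]
  refine Finset.sum_congr rfl fun i _ => ?_
  symm
  apply Finset.sum_bij_ne_zero (fun t _ _ => slotOf ℓ (D i) i t)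
  · intro t ht _
    rw [Finset.mem_filter, Finset.mem_range, (slotOf_div ht (hcard i)).1, serverOf_fin]
    exact ⟨slotOf_lt ht (hcard i), rfl⟩
  · intro t ht _ t' ht' _ he
    have h1 := (slotOf_div (i := i) ht (hcard i)).2
    have h2 := (slotOf_div (i := i) ht' (hcard i)).2
    rw [he] at h1
    exact rankOf_inj ht ht' (h1.symm.trans h2)
  · intro q hq hne
    rw [Finset.mem_filter, Finset.mem_range] at hq
    rcases h : inputArray ℓ f D q with _ | ⟨t, w⟩
    · rw [h, h0] at hne; exact absurd rfl hne
    · obtain ⟨h1, h2, h3⟩ := inputArray_eq_some h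
      rw [hq.2] at h1 h2
      refine ⟨t, h1, ?_, ?_⟩
      · rw [h, h3, hφ] at hne; exact hne
      · unfold slotOf
        rw [h2]
        have : i.val = q / ℓ := by
          rw [← hq.2, serverOf_val, Nat.mod_eq_of_lt]
          exact Nat.div_lt_of_lt_mul (by rw [mul_comm]; exact hq.1)
        rw [this, mul_comm]
        exact Nat.div_add_mod q ℓ
  · intro t ht _
    rw [inputArray_slotOf ht (hcard i), hφ]

theorem card_chunk_le (hℓ : 0 < ℓ) (i : Fin p) :
    ((Finset.range (p * ℓ)).filter fun q => serverOf (q / ℓ) = i).card ≤ ℓ := by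
  have hsub : ((Finset.range (p * ℓ)).filter fun q => serverOf (q / ℓ) = i) ⊆
      Finset.Ico (i.val * ℓ) ((i.val + 1) * ℓ) := by
    intro q hq
    rw [Finset.mem_filter, Finset.mem_range] at hq
    have : i.val = q / ℓ := by
      rw [← hq.2, serverOf_val, Nat.mod_eq_of_lt]
      exact Nat.div_lt_of_lt_mul (by rw [mul_comm]; exact hq.1)
    rw [Finset.mem_Ico, this]
    exact ⟨Nat.div_mul_le_self _ _, by rw [Nat.succ_mul]; exact Nat.lt_div_mul_add hℓ⟩
  have := Finset.card_le_card hsub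
  rw [Nat.card_Ico, Nat.succ_mul] at this
  omega

/-- A layer has at most `(g + 1) ^ d ≤ β * p` blocks, assigned cyclically, so a server receives at
most `β + 1` of them, each of at most `ℓ` positions. -/
theorem Regime.card_layer_le (h : Regime I cap ℓ g d β) {b : ℕ → ℕ}
    (hb : ∀ q ∈ Finset.range (p * ℓ), b q < (g + 1) ^ d)
    (hc : ∀ c, ((Finset.range (p * ℓ)).filter (b · = c)).card ≤ ℓ) (s : Fin p) :
    ((Finset.range (p * ℓ)).filter fun q => serverOf (b q) = s).card ≤ (β + 1) * ℓ := by
  have hp : 0 < p := Nat.pos_of_ne_zero (NeZero.ne p)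
  rw [Finset.card_eq_sum_card_fiberwise (f := b)
    (t := (Finset.range ((g + 1) ^ d)).filter (· % p = s.val))]
  · calc _ ≤ ∑ _c ∈ (Finset.range ((g + 1) ^ d)).filter (· % p = s.val), ℓ := by
          refine Finset.sum_le_sum fun c _ => le_trans (Finset.card_le_card ?_) (hc c)
          intro q hq
          simp only [Finset.mem_filter] at hq ⊢
          exact ⟨hq.1.1, hq.2⟩
      _ = ((Finset.range ((g + 1) ^ d)).filter (· % p = s.val)).card * ℓ := by simp
      _ ≤ _ := by
          apply Nat.mul_le_mul_right
          rw [card_filter_mod_range p _ hp _ s.2]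
          have : (g + 1) ^ d / p ≤ β := Nat.div_le_of_le_mul (by rw [mul_comm]; exact h.pow_le)
          split_ifs <;> omega
  · intro q hq
    have hq := Finset.mem_filter.1 (Finset.mem_coe.1 hq)
    refine Finset.mem_coe.2 (Finset.mem_filter.2 ⟨Finset.mem_range.2 (hb q hq.1), ?_⟩)
    rw [← hq.2, serverOf_val]

end

/-- The number of rounds of the prefix computation. -/
def prefixRounds (d : ℕ) : ℕ := 4 ^ d + 1 + d + d + 1

namespace Protocol

/-- The home of every tuple learns the sum of the weights of all tuples with smaller keys. -/
theorem prefixSum [NeZero p] (P : Protocol I cap K) (h : Regime I cap ℓ g d β) {κ : Type*}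
    [LinearOrder κ] (key : τ → κ) {f : (Fin p → Finset τ) → τ → ℕ} (hf : P.HomeKnows f)
    (hK : ∀ D ∈ I, (∑ t ∈ allTuples D, f D t + p * ℓ + 1) ^ 2 ≤ K D) :
    ∃ P' : Protocol I cap K, Ext P P' (prefixRounds d) ∧
      P'.HomeKnows (fun D t => ∑ t' ∈ (allTuples D).filter (fun t' => key t' < key t), f D t') ∧
      ∀ i, P'.Knows i (fun D => ∑ t ∈ allTuples D, f D t) := by
  classical
  set n := p * ℓ with hn
  have hℓ := h.pos
  let a : (Fin p → Finset τ) → ℕ → Option (τ × ℕ) := inputArray ℓ f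
  -- Empty entries get the key `⊤` and are sorted behind all tuples; their weight is `0`.
  let keyX : Option (τ × ℕ) → WithTop κ := fun x => x.elim ⊤ fun y => (key y.1 : WithTop κ)
  let wt : Option (τ × ℕ) → ℕ := fun x => x.elim 0 fun y => y.2.unpair.1
  let org : Option (τ × ℕ) → ℕ := fun x => x.elim 0 fun y => y.2.unpair.2
  have hfle : ∀ D ∈ I, ∀ i, ∀ t ∈ D i, f D t ≤ ∑ t ∈ allTuples D, f D t := fun D _ i t ht =>
    Finset.single_le_sum (f := fun t => f D t) (fun _ _ => Nat.zero_le _) (mem_allTuples.2 ⟨i, ht⟩)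
  have hpair : ∀ D ∈ I, ∀ v o, v ≤ ∑ t ∈ allTuples D, f D t → o < n →
      Nat.pair v o ≤ K D ∧ Nat.pair o v ≤ K D := by
    intro D hD v o hv ho
    have h1 := hK D hD
    constructor
    · refine (Nat.pair_lt_max_add_one_sq v o).le.trans (le_trans ?_ h1)
      apply Nat.pow_le_pow_left
      have := max_le (a := v) (b := o) (c := ∑ t ∈ allTuples D, f D t + n) (by omega) (by omega)
      omega
    · refine (Nat.pair_lt_max_add_one_sq o v).le.trans (le_trans ?_ h1)
      apply Nat.pow_le_pow_left
      have := max_le (a := o) (b := v) (c := ∑ t ∈ allTuples D, f D t + n) (by omega) (by omega)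
      omega
  have hsumK : ∀ D ∈ I, ∑ t ∈ allTuples D, f D t ≤ K D := fun D hD =>
    le_trans (by have := Nat.le_self_pow (n := 2) (by norm_num)
                   (∑ t ∈ allTuples D, f D t + n + 1); omega) (hK D hD)
  have ha : P.ArrayAt n (fun q => serverOf (q / ℓ)) a := by
    constructor
    · intro q _ D hD D' hD' hv
      have he := hv.1
      have hf' := hf _ D hD D' hD' hv
      simp only [a, inputArray]
      simp only [he] at hf' ⊢
      split_ifs with hex
      · rw [hf' _ hex.choose_spec.1]
      · rfl
    · intro D _ q _ t w ht
      exact Or.inl (inputArray_eq_some ht).1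
  have haK : ∀ D ∈ I, ∀ q < n, ∀ t w, a D q = some (t, w) → w ≤ K D := by
    intro D hD q hq t w ht
    obtain ⟨h1, -, rfl⟩ := inputArray_eq_some ht
    exact (hpair D hD _ _ (hfle D hD _ t h1) hq).1
  obtain ⟨L, hL1, hL2, hL3⟩ := exists_sortsIn (WithTop κ) h.g_pos h.sq_le d (Finset.range n) (by
    rw [Finset.card_range, hn, mul_comm]; exact Nat.mul_le_mul_left _ h.le_pow)
  obtain ⟨P₁, hP₁, seq, hseq0, hseq, hre, σ, hσ⟩ := P.sortByLayers ha keyX L (4 ^ d) haK (by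
    intro D hD i _ s
    have h1 := h.card_layer_le (hL1 i) (hL2 i) s
    have h2 := h.cap_ge D hD
    have : 4 * (β + 1) * ℓ = 2 * (2 * ((β + 1) * ℓ)) := by ring
    have e : ∀ x y : ℕ, x ≤ y → 2 * (2 * y) ≤ cap D → 2 * x ≤ cap D := by intros; omega
    exact e _ _ h1 (by omega))
  let b : (Fin p → Finset τ) → ℕ → Option (τ × ℕ) := fun D => seq D (4 ^ d)
  have hsort : ∀ D, MonotoneOn (fun q => keyX (b D q)) (Finset.range n) := fun D =>
    hL3 (fun i q => keyX (seq D i q)) (hseq D)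
  have hbsome : ∀ D, ∀ q < n, ∀ t w, b D q = some (t, w) →
      t ∈ allTuples D ∧ w.unpair.1 = f D t ∧ w.unpair.2 < n ∧
        a D w.unpair.2 = some (t, w) := by
    intro D q hq t w hb
    obtain ⟨π, -, hπ⟩ := hre D
    obtain ⟨h1, h2⟩ := hπ q (Finset.mem_range.2 hq)
    have h3 : a D (π q) = some (t, w) := by rw [← h2]; exact hb
    obtain ⟨g1, g2, g3⟩ := inputArray_eq_some h3
    have h4 : w.unpair.2 = π q := by rw [g3, Nat.unpair_pair]
    refine ⟨mem_allTuples.2 ⟨_, g1⟩, by rw [g3, Nat.unpair_pair], ?_, ?_⟩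
    · rw [h4]; exact Finset.mem_range.1 h1
    · rw [h4]; exact h3
  -- Each entry returns to the server of its new position together with a copy of its predecessor,
  -- so that starts of groups are recognized locally. At position `0` the predecessor is the entry
  -- itself, which is harmless because `0` is always a start.
  obtain ⟨P₂, hP₂, hb₂, -⟩ := P₁.routeEntries (Q := Fin n × Bool)
    (fun q => if q.2 then σ (q.1 - 1) else σ q.1) (fun q => serverOf (q.1 / ℓ))
    (fun D q => if q.2 then b D (q.1 - 1) else b D q.1)
    (by
      rintro ⟨q, c⟩
      cases c
      · exact hσ.knows q q.2
      · exact hσ.knows (q - 1) (by have := q.2; omega))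
    (by
      rintro D hD ⟨q, c⟩ t w ht
      cases c
      · exact hσ.holds D hD q q.2 t w ht
      · exact hσ.holds D hD (q - 1) (by have := q.2; omega) t w ht)
    (by
      intro D hD i
      have h1 : (Finset.univ.filter fun q : Fin n × Bool => serverOf (q.1.val / ℓ) = i).card ≤
          2 * ℓ := by
        have : (Finset.univ.filter fun q : Fin n × Bool => serverOf (q.1.val / ℓ) = i) =
            (Finset.univ.filter fun q : Fin n => serverOf (q.val / ℓ) = i) ×ˢ Finset.univ := by
          ext ⟨q, c⟩; simp
        rw [this, Finset.card_product, Finset.card_univ, Fintype.card_bool, mul_comm]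
        refine Nat.mul_le_mul_left 2 (le_trans ?_ (card_chunk_le hℓ i))
        apply Finset.card_le_card_of_injOn (fun q : Fin n => (q : ℕ))
        · intro q hq
          have := q.2
          simp at hq
          simp [hq, ← hn]
        · intro q _ q' _ he
          exact Fin.ext he
      have := h.le_cap hD
      omega)
    (by
      rintro D hD ⟨q, c⟩ t w ht
      have hh : ∀ q < n, b D q = some (t, w) → w ≤ K D := fun q hq hb =>
        haK D hD _ (hbsome D q hq t w hb).2.2.1 t w (hbsome D q hq t w hb).2.2.2
      cases c
      · exact hh q q.2 ht
      · exact hh (q - 1) (by have := q.2; omega) ht)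
  have hkb : ∀ q < n, P₂.Knows (serverOf (q / ℓ)) (fun D => b D q) := fun q hq => hb₂ (⟨q, hq⟩, false)
  have hkb' : ∀ q < n, P₂.Knows (serverOf (q / ℓ)) (fun D => b D (q - 1)) :=
    fun q hq => hb₂ (⟨q, hq⟩, true)
  -- prefix sums over the positions
  let w : (Fin p → Finset τ) → ℕ → ℕ := fun D q => if q < n then wt (b D q) else 0
  have hwsum : ∀ D ∈ I, ∑ q ∈ Finset.range n, w D q = ∑ t ∈ allTuples D, f D t := by
    intro D hD
    rw [← sum_inputArray (h.disjoint D hD) (h.card_le D hD) f wt (fun t => f D t) rfl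
      (fun t q => by simp [wt]), ← (hre D).sum_eq wt]
    exact Finset.sum_congr rfl fun q hq => if_pos (Finset.mem_range.1 hq)
  have hwle : ∀ D ∈ I, ∀ A : Finset ℕ, ∑ q ∈ A, w D q ≤ ∑ t ∈ allTuples D, f D t := by
    intro D hD A
    rw [← hwsum D hD]
    apply Finset.sum_le_sum_of_ne_zero
    intro q _ hne
    by_contra hcon
    exact hne (if_neg (by simpa using hcon))
  obtain ⟨P₃, hP₃, hs₃, htot⟩ := P₂.scanPositions (F := fun D A => ∑ q ∈ A, w D q) (op := (· + ·))
    ⟨fun D => Finset.sum_empty, fun D A B hAB => Finset.sum_union hAB⟩ hℓ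
    (fun q hq => ((hkb q hq).comp wt).congr fun D _ => by
      simp only [Finset.sum_singleton, w, if_pos (show q < n from hq)])
    h.g_pos h.le_pow (fun D hD A => (hwle D hD A).trans (hsumK D hD)) (fun D hD => h.g_le_cap hD)
  -- maxima over the starts of groups
  let vs : (Fin p → Finset τ) → ℕ → ℕ := fun D q =>
    if q = 0 ∨ keyX (b D (q - 1)) ≠ keyX (b D q) then ∑ y ∈ Finset.range q, w D y else 0
  have hvle : ∀ D ∈ I, ∀ q, vs D q ≤ ∑ t ∈ allTuples D, f D t := by
    intro D hD q
    simp only [vs]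
    split_ifs
    · exact hwle D hD _
    · exact Nat.zero_le _
  have hkv : ∀ q < n, P₃.Knows (serverOf (q / ℓ)) (fun D => vs D q) := by
    intro q hq
    have h1 := (hP₃.knows (hkb q hq)).comp₂ (hP₃.knows (hkb' q hq)) fun x y => (x, y)
    exact (h1.comp₂ (hs₃ q hq) fun x s => if q = 0 ∨ keyX x.2 ≠ keyX x.1 then s else 0).congr
      fun D _ => rfl
  obtain ⟨P₄, hP₄, hs₄, -⟩ := P₃.scanPositions (F := fun D A => A.sup (vs D)) (op := max)
    ⟨fun D => Finset.sup_empty, fun D A B _ => Finset.sup_union⟩ hℓ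
    (fun q hq => (hkv q hq).congr fun D _ => Finset.sup_singleton.symm)
    h.g_pos h.le_pow (fun D hD A => (Finset.sup_le fun q _ => hvle D hD q).trans (hsumK D hD))
    (fun D hD => h.g_le_cap hD)
  let val : (Fin p → Finset τ) → ℕ → ℕ := fun D q => (Finset.range (q + 1)).sup (vs D)
  have hkval : ∀ q < n, P₄.Knows (serverOf (q / ℓ)) (fun D => val D q) := by
    intro q hq
    refine ((hs₄ q hq).comp₂ (hP₄.knows (hkv q hq)) max).congr fun D _ => ?_
    simp only [val]
    rw [Finset.range_add_one, Finset.sup_insert, max_comm]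
  have hval : ∀ D ∈ I, ∀ q < n, ∀ t u, b D q = some (t, u) →
      val D q = ∑ t' ∈ (allTuples D).filter (fun t' => key t' < key t), f D t' := by
    intro D hD q hq t u hb
    simp only [val, vs]
    rw [sup_groupStart (k := fun q => keyX (b D q)) (w D) (hsort D) hq]
    rw [Finset.sum_filter, Finset.sum_filter,
      ← sum_inputArray (h.disjoint D hD) (h.card_le D hD) f
        (fun x => if keyX x < key t then wt x else 0)
        (fun t' => if key t' < key t then f D t' else 0) (by simp [wt])
        (fun t' q => by simp [keyX, wt]), ← (hre D).sum_eq (fun x => if keyX x < key t then wt x else 0)]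
    refine Finset.sum_congr rfl fun y hy => ?_
    simp only [hb, w, if_pos (Finset.mem_range.1 hy)]
    rfl
  -- the results are returned
  let piece : Fin p → Fin p → (Fin p → Finset τ) → ℕ → Finset (τ ⊕ ℕ) := fun j i D q =>
    if serverOf (q / ℓ) = j ∧ (b D q).isSome ∧ serverOf (org (b D q) / ℓ) = i then
      {Sum.inr (Nat.pair (org (b D q)) (val D q))} else ∅
  have horg : ∀ D, ∀ q < n, (b D q).isSome → org (b D q) < n ∧ a D (org (b D q)) = b D q := by
    intro D q hq hb
    obtain ⟨⟨t, u⟩, hb⟩ := Option.isSome_iff_exists.1 hb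
    obtain ⟨-, -, h3, h4⟩ := hbsome D q hq t u hb
    rw [hb]
    exact ⟨h3, h4⟩
  have hinj : ∀ D, ∀ q < n, ∀ q' < n, (b D q).isSome → (b D q').isSome →
      org (b D q) = org (b D q') → q = q' := by
    intro D q hq q' hq' hb hb' he
    obtain ⟨π, hi, hπ⟩ := hre D
    have key : ∀ q < n, (b D q).isSome → org (b D q) = π q := by
      intro q hq hb
      obtain ⟨⟨t, u⟩, hb⟩ := Option.isSome_iff_exists.1 hb
      have h3 : a D (π q) = some (t, u) := by
        rw [← (hπ q (Finset.mem_range.2 hq)).2]; exact hb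
      rw [hb]
      simp only [org, Option.elim_some]
      rw [(inputArray_eq_some h3).2.2, Nat.unpair_pair]
    rw [key q hq hb, key q' hq' hb'] at he
    exact hi (by simpa using hq) (by simpa using hq') he
  obtain ⟨P₅, hP₅, hk₅, -⟩ := P₄.send (fun D j i => (Finset.range n).biUnion (piece j i D))
    (by
      intro j i
      have hp : ∀ q, P₄.Knows j (fun D => if q < n then piece j i D q else ∅) := by
        intro q
        by_cases hq : q < n ∧ serverOf (q / ℓ) = j
        · have h1 := hP₄.knows (hP₃.knows (hkb q hq.1))
          have h2 := hkval q hq.1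
          rw [hq.2] at h1 h2
          refine (h1.comp₂ h2 fun x v => if x.isSome ∧ serverOf (org x / ℓ) = i then
            ({Sum.inr (Nat.pair (org x) v)} : Finset (τ ⊕ ℕ)) else ∅).congr fun D _ => ?_
          simp only [piece, hq.1, hq.2, true_and, if_true]
        · refine (Knows.const ∅).congr fun D _ => ?_
          by_cases hqn : q < n
          · rw [if_pos hqn]
            simp only [piece]
            rw [if_neg fun hc => hq ⟨hqn, hc.1⟩]
          · rw [if_neg hqn]
      refine ((Knows.pi hp).comp fun x => (Finset.range n).biUnion x).congr fun D _ => ?_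
      refine Finset.biUnion_congr rfl fun q hq => ?_
      rw [if_pos (Finset.mem_range.1 hq)])
    (by
      intro D _ j i x hx
      obtain ⟨q, _, hx⟩ := Finset.mem_biUnion.1 hx
      simp only [piece] at hx
      split_ifs at hx <;> simp at hx)
    (by
      intro D hD i
      calc _ ≤ ∑ j, ((Finset.range n).filter fun q => ((b D q).isSome ∧
              serverOf (org (b D q) / ℓ) = i) ∧ serverOf (q / ℓ) = j).card := by
            refine Finset.sum_le_sum fun j _ => ?_
            rw [Finset.card_filter]
            refine Finset.card_biUnion_le.trans (Finset.sum_le_sum fun q _ => ?_)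
            simp only [piece]
            by_cases hc : serverOf (q / ℓ) = j ∧ (b D q).isSome ∧ serverOf (org (b D q) / ℓ) = i
            · rw [if_pos hc, if_pos ⟨hc.2, hc.1⟩]; simp
            · rw [if_neg hc]; simp
        _ = ((Finset.range n).filter fun q => (b D q).isSome ∧
              serverOf (org (b D q) / ℓ) = i).card := by
            rw [Finset.card_eq_sum_card_fiberwise (f := fun q => (serverOf (q / ℓ) : Fin p))
              (t := Finset.univ) (by simp)]
            simp only [Finset.filter_filter]
        _ ≤ ((Finset.range n).filter fun q => serverOf (q / ℓ) = i).card := by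
            apply Finset.card_le_card_of_injOn (fun q => org (b D q))
            · intro q hq
              have hq := Finset.mem_filter.1 (Finset.mem_coe.1 hq)
              have := (horg D q (Finset.mem_range.1 hq.1) hq.2.1).1
              exact Finset.mem_coe.2 (Finset.mem_filter.2 ⟨Finset.mem_range.2 this, hq.2.2⟩)
            · intro q hq q' hq' he
              have hq := Finset.mem_filter.1 (Finset.mem_coe.1 hq)
              have hq' := Finset.mem_filter.1 (Finset.mem_coe.1 hq')
              exact hinj D q (Finset.mem_range.1 hq.1) q' (Finset.mem_range.1 hq'.1) hq.2.1
                hq'.2.1 he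
        _ ≤ ℓ := card_chunk_le hℓ i
        _ ≤ cap D := by have := h.le_cap hD; omega)
    (by
      intro D hD j i m hm
      obtain ⟨q, hq, hm⟩ := Finset.mem_biUnion.1 hm
      simp only [piece] at hm
      split_ifs at hm with hc
      · rw [Finset.mem_singleton, Sum.inr.injEq] at hm
        rw [hm]
        exact (hpair D hD _ _ (Finset.sup_le fun q _ => hvle D hD q)
          (horg D q (Finset.mem_range.1 hq) hc.2.1).1).2
      · simp at hm)
  refine ⟨P₅, ((((hP₁.trans hP₂).trans hP₃).trans hP₄).trans hP₅), ?_, fun i => ?_⟩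
  · intro i D hD D' hD' hv t ht
    have hDi := hv.1
    set o := slotOf ℓ (D i) i t with ho
    have hao := inputArray_slotOf (f := f) ht (h.card_le D hD i)
    have ht' : t ∈ D' i := hDi ▸ ht
    have hao' := inputArray_slotOf (f := f) ht' (h.card_le D' hD' i)
    rw [← hDi, ← ho] at hao'
    rw [← ho] at hao
    have hon : o < n := slotOf_lt ht (h.card_le D hD i)
    obtain ⟨π, -, him, hπ⟩ := (hre D).image_eq
    obtain ⟨q, hq, hqo⟩ := Finset.mem_image.1 (him.symm ▸ Finset.mem_range.2 hon)
    have hbq : b D q = some (t, Nat.pair (f D t) o) := by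
      have := hπ q hq
      rw [hqo] at this
      exact this.trans hao
    have hqn := Finset.mem_range.1 hq
    have horgq : org (b D q) = o := by rw [hbq]; simp [org]
    -- The message for the slot `o` of `t` occurs in the view on `D`, hence also on `D'`. Origins
    -- identify tuples, so its second component is the value for `t` on both inputs.
    have hmem : Sum.inr (Nat.pair o (val D q)) ∈
        (Finset.range n).biUnion (piece (serverOf (q / ℓ)) i D) := by
      refine Finset.mem_biUnion.2 ⟨q, hq, ?_⟩
      simp only [piece]
      rw [if_pos ⟨trivial, by rw [hbq]; rfl, by rw [horgq, ho, (slotOf_div ht (h.card_le D hD i)).1, serverOf_fin]⟩,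
        horgq]
      exact Finset.mem_singleton_self _
    have heq := hk₅ i (serverOf (q / ℓ)) D hD D' hD' hv
    beta_reduce at heq
    rw [heq] at hmem
    obtain ⟨q', hq', hmem⟩ := Finset.mem_biUnion.1 hmem
    simp only [piece] at hmem
    split_ifs at hmem with hc
    · rw [Finset.mem_singleton, Sum.inr.injEq, Nat.pair_eq_pair] at hmem
      have hqn' := Finset.mem_range.1 hq'
      have := (horg D' q' hqn' hc.2.1).2
      rw [← hmem.1] at this
      beta_reduce
      rw [← hval D hD q hqn _ _ hbq, hmem.2]
      exact hval D' hD' q' hqn' _ _ (this.symm.trans hao')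
    · simp at hmem
  · exact (hP₅.knows (hP₄.knows (htot i))).congr fun D hD => hwsum D hD

end Protocol

end Prefix

end MPCJoin

end

noncomputable section
namespace MPCJoin

/-! ### Sums over groups of tuples -/

section Groups

variable {τ : Type*} {p : ℕ} {I : Set (Fin p → Finset τ)} {cap K : (Fin p → Finset τ) → ℕ}
  {ℓ g d β : ℕ}

namespace Protocol

/-- Subroutines run one after the other, each starting from the protocol reached so far; `hmono`
says that later rounds do not destroy what has been learned. -/
theorem Ext.family {ι : Type*} (P : Protocol I cap K) (s : Finset ι) (R : ℕ)
    (Q : ι → Protocol I cap K → Prop) (hmono : ∀ i P P' m, Ext P P' m → Q i P → Q i P')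
    (hstep : ∀ i ∈ s, ∀ P' m, Ext P P' m → ∃ P'', Ext P' P'' R ∧ Q i P'') :
    ∃ P', Ext P P' (s.card * R) ∧ ∀ i ∈ s, Q i P' := by
  classical
  induction s using Finset.induction_on with
  | empty => exact ⟨P, Ext.refl P _, by simp⟩
  | insert i s hi ih =>
    obtain ⟨P₁, h₁, h₂⟩ := ih fun i hi => hstep i (Finset.mem_insert_of_mem hi)
    obtain ⟨P₂, h₃, h₄⟩ := hstep i (Finset.mem_insert_self _ _) P₁ _ h₁
    refine ⟨P₂, (h₁.trans h₃).weaken (le_of_eq ?_), ?_⟩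
    · rw [Finset.card_insert_of_notMem hi, Nat.succ_mul]
    · intro j hj
      rcases Finset.mem_insert.1 hj with rfl | hj
      · exact h₄
      · exact hmono _ _ _ _ h₃ (h₂ j hj)

variable [NeZero p]

open Classical in
/-- The home of every tuple learns the total weight of the tuples with the same key. -/
theorem groupSum (P : Protocol I cap K) (h : Regime I cap ℓ g d β) {κ : Type*}
    (key : τ → κ) {f : (Fin p → Finset τ) → τ → ℕ} (hf : P.HomeKnows f)
    (hK : ∀ D ∈ I, (∑ t ∈ allTuples D, f D t + p * ℓ + 1) ^ 2 ≤ K D) :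
    ∃ P' : Protocol I cap K, Ext P P' (2 * prefixRounds d) ∧
      P'.HomeKnows (fun D t => ∑ t' ∈ (allTuples D).filter (fun t' => key t' = key t), f D t') := by
  -- Any linear order on the keys will do: a group sum is the total minus the sum over smaller keys
  -- minus the sum over larger keys, the latter being a prefix sum for the dual order.
  let _ : LinearOrder κ := IsWellOrder.linearOrder WellOrderingRel
  obtain ⟨P₁, h₁, h₂, h₃⟩ := P.prefixSum h key hf hK
  obtain ⟨P₂, h₄, h₅, -⟩ := P₁.prefixSum h (fun t => OrderDual.toDual (key t)) (h₁.homeKnows hf) hK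
  refine ⟨P₂, (h₁.trans h₄).weaken (by omega), fun i D hD D' hD' hv t ht => ?_⟩
  have e1 := h₄.homeKnows h₂ i D hD D' hD' hv t ht
  have e2 := h₅ i D hD D' hD' hv t ht
  have e3 := h₄.knows (h₃ i) D hD D' hD' hv
  have hkey : ∀ D : Fin p → Finset τ, ∑ t' ∈ (allTuples D).filter (fun t' => key t' = key t), f D t' +
      ∑ t' ∈ (allTuples D).filter (fun t' => key t' < key t), f D t' +
      ∑ t' ∈ (allTuples D).filter (fun t' => OrderDual.toDual (key t') < OrderDual.toDual (key t)),
        f D t' = ∑ t ∈ allTuples D, f D t := by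
    intro D
    simp only [Finset.sum_filter]
    rw [← Finset.sum_add_distrib, ← Finset.sum_add_distrib]
    refine Finset.sum_congr rfl fun t' _ => ?_
    rcases lt_trichotomy (key t') (key t) with hlt | heq | hgt
    · simp [hlt, hlt.ne, not_lt.2 hlt.le]
    · simp [heq]
    · simp [hgt, hgt.ne', not_lt.2 hgt.le]
  have k1 := hkey D
  have k2 := hkey D'
  beta_reduce at e1 e2 e3 ⊢
  rw [e1, e2, e3, ← k2] at k1
  have := Nat.add_right_cancel (Nat.add_right_cancel k1)
  convert this

open Classical in
/-- The home of every tuple learns the total weight of the tuples in the same group of `key₁` with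
smaller `key₂`. -/
theorem groupPrefix (P : Protocol I cap K) (h : Regime I cap ℓ g d β) {κ₁ κ₂ : Type*}
    [LinearOrder κ₂] (key₁ : τ → κ₁) (key₂ : τ → κ₂) {f : (Fin p → Finset τ) → τ → ℕ}
    (hf : P.HomeKnows f)
    (hK : ∀ D ∈ I, (∑ t ∈ allTuples D, f D t + p * ℓ + 1) ^ 2 ≤ K D) :
    ∃ P' : Protocol I cap K, Ext P P' (2 * prefixRounds d) ∧
      P'.HomeKnows (fun D t => ∑ t' ∈ (allTuples D).filter
        (fun t' => key₁ t' = key₁ t ∧ key₂ t' < key₂ t), f D t') := by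
  -- The prefix sum inside a group is the prefix sum for the lexicographic order of `(key₁, key₂)`
  -- minus the one for `key₁` alone.
  let _ : LinearOrder κ₁ := IsWellOrder.linearOrder WellOrderingRel
  obtain ⟨P₁, h₁, h₂, -⟩ := P.prefixSum h key₁ hf hK
  obtain ⟨P₂, h₄, h₅, -⟩ := P₁.prefixSum h (fun t => toLex (key₁ t, key₂ t)) (h₁.homeKnows hf) hK
  refine ⟨P₂, (h₁.trans h₄).weaken (by omega), fun i D hD D' hD' hv t ht => ?_⟩
  have e1 := h₄.homeKnows h₂ i D hD D' hD' hv t ht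
  have e2 := h₅ i D hD D' hD' hv t ht
  have hkey : ∀ D : Fin p → Finset τ, ∑ t' ∈ (allTuples D).filter
        (fun t' => key₁ t' = key₁ t ∧ key₂ t' < key₂ t), f D t' +
      ∑ t' ∈ (allTuples D).filter (fun t' => key₁ t' < key₁ t), f D t' =
      ∑ t' ∈ (allTuples D).filter (fun t' => toLex (key₁ t', key₂ t') < toLex (key₁ t, key₂ t)),
        f D t' := by
    intro D
    simp only [Finset.sum_filter]
    rw [← Finset.sum_add_distrib]
    refine Finset.sum_congr rfl fun t' _ => ?_
    simp only [Prod.Lex.toLex_lt_toLex]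
    rcases lt_trichotomy (key₁ t') (key₁ t) with hlt | heq | hgt
    · simp [hlt, hlt.ne]
    · simp [heq]
    · simp [hgt.ne', not_lt.2 hgt.le]
  have k1 := hkey D
  have k2 := hkey D'
  beta_reduce at e1 e2 ⊢
  rw [e1, e2, ← k2] at k1
  have := Nat.add_right_cancel k1
  convert this

end Protocol

end Groups

end MPCJoin

end

noncomputable section
namespace MPCJoin

/-! ### Forests of groups and the generating functions of coherent sets -/

/-- A forest of groups of tuples: at level `k` the tuples are grouped by `key k`, and groups are
merged from level to level.  The groups at level `k` in a group at level `k + 1` have labels; groups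
with different labels are combined with each other, groups with the same label are
alternatives. -/
structure LevelSystem (τ K Λ : Type*) where
  key : ℕ → τ → K
  lab : ℕ → τ → Λ
  labs : ℕ → Λ → Finset Λ
  carrier : Set τ
  key_succ : ∀ k t t', key k t = key k t' → key (k + 1) t = key (k + 1) t'
  lab_of_key : ∀ k t t', key k t = key k t' → lab k t = lab k t'
  lab_mem : ∀ k, ∀ t ∈ carrier, lab k t ∈ labs k (lab (k + 1) t)
  key_zero_inj : ∀ t ∈ carrier, ∀ t' ∈ carrier, key 0 t = key 0 t' → t = t'

namespace LevelSystem

variable {τ K Λ : Type*} (S : LevelSystem τ K Λ)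

theorem key_mono {j k : ℕ} (hjk : j ≤ k) {t t' : τ} (h : S.key j t = S.key j t') :
    S.key k t = S.key k t' := by
  induction k, hjk using Nat.le_induction with
  | base => exact h
  | succ k _ ih => exact S.key_succ k t t' ih

/-- Two tuples are coherent if they are nowhere in alternative groups. -/
def Coherent (t t' : τ) : Prop :=
  ∀ k, S.key (k + 1) t = S.key (k + 1) t' → S.lab k t = S.lab k t' → S.key k t = S.key k t'

def CoherentSet (U : Finset τ) : Prop := ∀ t ∈ U, ∀ t' ∈ U, S.Coherent t t'

variable {S} in
theorem Coherent.symm {t t' : τ} (h : S.Coherent t t') : S.Coherent t' t :=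
  fun k h1 h2 => (h k h1.symm h2.symm).symm

theorem Coherent.refl (t : τ) : S.Coherent t t := fun _ _ _ => rfl

variable {S} in
theorem CoherentSet.mono {U U' : Finset τ} (h : S.CoherentSet U) (hU : U' ⊆ U) :
    S.CoherentSet U' := fun t ht t' ht' => h t (hU ht) t' (hU ht')

/-- Tuples in the same group but with different labels below are coherent. -/
theorem coherent_of_lab_ne {k : ℕ} {t t' : τ} (h1 : S.key (k + 1) t = S.key (k + 1) t')
    (h2 : S.lab k t ≠ S.lab k t') : S.Coherent t t' := by
  intro j hj hl
  rcases lt_trichotomy j k with h | h | h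
  · exact absurd (S.lab_of_key _ _ _ (S.key_mono h hj)) h2
  · exact absurd (h ▸ hl) h2
  · exact S.key_mono h h1

open Classical in
/-- The tuples of `X` in the group of `t` at level `k`. -/
def grp (X : Finset τ) (k : ℕ) (t : τ) : Finset τ := X.filter fun t' => S.key k t' = S.key k t

theorem mem_grp {X : Finset τ} {k : ℕ} {t t' : τ} :
    t' ∈ S.grp X k t ↔ t' ∈ X ∧ S.key k t' = S.key k t := by simp [grp]

open Classical in
/-- The nonempty coherent sets of tuples in a group. -/
def cohSets (X : Finset τ) (k : ℕ) (t : τ) : Finset (Finset τ) :=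
  (S.grp X k t).powerset.filter fun U => U.Nonempty ∧ S.CoherentSet U

theorem mem_cohSets {X : Finset τ} {k : ℕ} {t : τ} {U : Finset τ} :
    U ∈ S.cohSets X k t ↔ U ⊆ S.grp X k t ∧ U.Nonempty ∧ S.CoherentSet U := by simp [cohSets]

/-- The generating function of the coherent sets. -/
def psi {R : Type*} [CommSemiring R] (X : Finset τ) (k : ℕ) (t : τ) (z : R) : R :=
  ∑ U ∈ S.cohSets X k t, z ^ U.card

section

variable [LinearOrder τ]

open Classical in
/-- The least tuples of the groups. -/
def leaders (X : Finset τ) (k : ℕ) : Finset τ :=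
  X.filter fun t => ∀ t' ∈ X, S.key k t' = S.key k t → t ≤ t'

theorem mem_leaders {X : Finset τ} {k : ℕ} {t : τ} :
    t ∈ S.leaders X k ↔ t ∈ X ∧ ∀ t' ∈ X, S.key k t' = S.key k t → t ≤ t' := by simp [leaders]

theorem exists_leader {X : Finset τ} (k : ℕ) {t : τ} (ht : t ∈ X) :
    ∃ b ∈ S.leaders X k, S.key k b = S.key k t := by
  obtain ⟨b, hb, hmin⟩ := Finset.exists_min_image (S.grp X k t) id ⟨t, S.mem_grp.2 ⟨ht, rfl⟩⟩
  rw [mem_grp] at hb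
  refine ⟨b, S.mem_leaders.2 ⟨hb.1, fun t' ht' he => ?_⟩, hb.2⟩
  exact hmin t' (S.mem_grp.2 ⟨ht', he.trans hb.2⟩)

theorem leader_unique {X : Finset τ} {k : ℕ} {b b' : τ} (hb : b ∈ S.leaders X k)
    (hb' : b' ∈ S.leaders X k) (h : S.key k b = S.key k b') : b = b' := by
  rw [mem_leaders] at hb hb'
  exact le_antisymm (hb.2 b' hb'.1 h.symm) (hb'.2 b hb.1 h)

open Classical in
/-- The leaders of the groups with label `A` in the group of `t` at level `k + 1`. -/
def kids (X : Finset τ) (k : ℕ) (t : τ) (A : Λ) : Finset τ :=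
  (S.leaders X k).filter fun b => S.key (k + 1) b = S.key (k + 1) t ∧ S.lab k b = A

theorem mem_kids {X : Finset τ} {k : ℕ} {t b : τ} {A : Λ} : b ∈ S.kids X k t A ↔
    b ∈ S.leaders X k ∧ S.key (k + 1) b = S.key (k + 1) t ∧ S.lab k b = A := by simp [kids]

theorem kids_congr {X : Finset τ} {k : ℕ} {t t' : τ} (h : S.key (k + 1) t = S.key (k + 1) t')
    (A : Λ) : S.kids X k t A = S.kids X k t' A := by
  ext a; rw [mem_kids, mem_kids, h]

end

variable {S} in
theorem psi_zero {R : Type*} [CommSemiring R] {X : Finset τ} (hX : ∀ t ∈ X, t ∈ S.carrier) {t : τ}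
    (ht : t ∈ X) (z : R) : S.psi X 0 t z = z := by
  have hg : ∀ t', t' ∈ S.grp X 0 t ↔ t' = t := by
    intro t'
    rw [mem_grp]
    exact ⟨fun h => S.key_zero_inj _ (hX _ h.1) _ (hX _ ht) h.2, by rintro rfl; exact ⟨ht, rfl⟩⟩
  have : S.cohSets X 0 t = {{t}} := by
    ext U
    rw [mem_cohSets, Finset.mem_singleton]
    constructor
    · rintro ⟨h1, h2, -⟩
      exact Finset.eq_singleton_iff_nonempty_unique_mem.2 ⟨h2, fun x hx => (hg x).1 (h1 hx)⟩
    · rintro rfl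
      refine ⟨fun x hx => (hg x).2 (Finset.mem_singleton.1 hx), Finset.singleton_nonempty _, ?_⟩
      intro a ha b hb
      rw [Finset.mem_singleton.1 ha, Finset.mem_singleton.1 hb]
      exact Coherent.refl S t
  simp [psi, this]

-- A coherent set in a group, possibly empty, consists of independent choices for the labels: tuples
-- with different labels below are always coherent, whereas tuples with the same label must lie in
-- one common child. This gives a product over labels, and for each label the empty set or a set in
-- exactly one child.
variable {S} in
open Classical in
theorem one_add_psi_succ [LinearOrder τ] {R : Type*} [CommSemiring R] {X : Finset τ}
    (hX : ∀ t ∈ X, t ∈ S.carrier) (k : ℕ) (t : τ) (z : R) :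
    1 + S.psi X (k + 1) t z = ∏ A ∈ S.labs k (S.lab (k + 1) t),
      (1 + ∑ b ∈ S.kids X k t A, S.psi X k b z) := by
  -- Coherent sets, the empty one included, whose labels lie in `s`. The product formula is proved
  -- by adding one label at a time.
  let C : Finset Λ → Finset (Finset τ) := fun s =>
    (S.grp X (k + 1) t).powerset.filter fun U => (∀ u ∈ U, S.lab k u ∈ s) ∧ S.CoherentSet U
  have hC : ∀ s U, U ∈ C s ↔ U ⊆ S.grp X (k + 1) t ∧ (∀ u ∈ U, S.lab k u ∈ s) ∧
      S.CoherentSet U := by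
    intro s U; simp only [C, Finset.mem_filter, Finset.mem_powerset]
  have hfull : ∑ U ∈ C (S.labs k (S.lab (k + 1) t)), z ^ U.card = 1 + S.psi X (k + 1) t z := by
    have : C (S.labs k (S.lab (k + 1) t)) = insert ∅ (S.cohSets X (k + 1) t) := by
      ext U
      rw [hC, Finset.mem_insert, mem_cohSets]
      constructor
      · rintro ⟨h1, -, h3⟩
        rcases U.eq_empty_or_nonempty with h | h
        · exact Or.inl h
        · exact Or.inr ⟨h1, h, h3⟩
      · rintro (rfl | ⟨h1, -, h3⟩)
        · exact ⟨by simp, by simp, by intro t ht; simp at ht⟩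
        · refine ⟨h1, fun u hu => ?_, h3⟩
          have := S.mem_grp.1 (h1 hu)
          rw [← S.lab_of_key _ _ _ this.2]
          exact S.lab_mem k u (hX u this.1)
    rw [this, Finset.sum_insert (by simp [mem_cohSets])]
    simp [psi]
  have hempty : ∑ U ∈ C ∅, z ^ U.card = 1 := by
    have : C ∅ = {∅} := by
      ext U
      rw [hC, Finset.mem_singleton]
      constructor
      · rintro ⟨-, h2, -⟩
        exact Finset.eq_empty_of_forall_notMem fun u hu => by simpa using h2 u hu
      · rintro rfl
        exact ⟨by simp, by simp, by intro t ht; simp at ht⟩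
    simp [this]
  -- Taking unions is a bijection with splitting a set by label; the cardinalities add because the
  -- two parts have different labels.
  have hins : ∀ A s, A ∉ s → ∑ U ∈ C (insert A s), z ^ U.card =
      (∑ U ∈ C {A}, z ^ U.card) * ∑ U ∈ C s, z ^ U.card := by
    intro A s hA
    rw [Finset.sum_mul_sum, ← Finset.sum_product']
    symm
    apply Finset.sum_nbij' (fun U => U.1 ∪ U.2)
      (fun U => (U.filter (fun u => S.lab k u = A), U.filter (fun u => S.lab k u ∈ s)))
    · rintro ⟨U, U'⟩ h
      rw [Finset.mem_product, hC, hC] at h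
      obtain ⟨⟨h1, h2, h3⟩, h4, h5, h6⟩ := h
      rw [hC]
      have hcross : ∀ a ∈ U, ∀ b ∈ U', S.Coherent a b := by
        intro a ha b hb
        have e1 := S.mem_grp.1 (h1 ha)
        have e2 := S.mem_grp.1 (h4 hb)
        refine S.coherent_of_lab_ne (e1.2.trans e2.2.symm) fun he => hA ?_
        have := Finset.mem_singleton.1 (h2 a ha)
        rw [← this, he]
        exact h5 b hb
      refine ⟨Finset.union_subset h1 h4, ?_, ?_⟩
      · intro u hu
        rcases Finset.mem_union.1 hu with hu | hu
        · exact Finset.mem_insert.2 (Or.inl (Finset.mem_singleton.1 (h2 u hu)))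
        · exact Finset.mem_insert.2 (Or.inr (h5 u hu))
      · intro a ha b hb
        rcases Finset.mem_union.1 ha with ha | ha <;> rcases Finset.mem_union.1 hb with hb | hb
        · exact h3 a ha b hb
        · exact hcross a ha b hb
        · exact (hcross b hb a ha).symm
        · exact h6 a ha b hb
    · intro U h
      rw [hC] at h
      rw [Finset.mem_product, hC, hC]
      refine ⟨⟨(Finset.filter_subset _ _).trans h.1, fun u hu => ?_,
        h.2.2.mono (Finset.filter_subset _ _)⟩, (Finset.filter_subset _ _).trans h.1,
        fun u hu => (Finset.mem_filter.1 hu).2, h.2.2.mono (Finset.filter_subset _ _)⟩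
      exact Finset.mem_singleton.2 (Finset.mem_filter.1 hu).2
    · rintro ⟨U, U'⟩ h
      rw [Finset.mem_product, hC, hC] at h
      obtain ⟨⟨h1, h2, h3⟩, h4, h5, h6⟩ := h
      simp only [Prod.mk.injEq]
      constructor
      · ext u
        simp only [Finset.mem_filter, Finset.mem_union]
        constructor
        · rintro ⟨hu | hu, he⟩
          · exact hu
          · exact absurd (he ▸ h5 u hu) hA
        · exact fun hu => ⟨Or.inl hu, Finset.mem_singleton.1 (h2 u hu)⟩
      · ext u
        simp only [Finset.mem_filter, Finset.mem_union]
        constructor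
        · rintro ⟨hu | hu, he⟩
          · exact absurd (Finset.mem_singleton.1 (h2 u hu) ▸ he) hA
          · exact hu
        · exact fun hu => ⟨Or.inr hu, h5 u hu⟩
    · intro U h
      rw [hC] at h
      ext u
      simp only [Finset.mem_filter, Finset.mem_union]
      constructor
      · rintro (hu | hu) <;> exact hu.1
      · intro hu
        rcases Finset.mem_insert.1 (h.2.1 u hu) with he | he
        · exact Or.inl ⟨hu, he⟩
        · exact Or.inr ⟨hu, he⟩
    · rintro ⟨U, U'⟩ h
      rw [Finset.mem_product, hC, hC] at h
      obtain ⟨⟨h1, h2, h3⟩, h4, h5, h6⟩ := h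
      rw [Finset.card_union_of_disjoint, pow_add]
      rw [Finset.disjoint_left]
      intro u hu hu'
      exact hA (Finset.mem_singleton.1 (h2 u hu) ▸ h5 u hu')
  -- Two coherent tuples with the same label under the same parent have the same key, so a nonempty
  -- set picks out a unique child, represented by its leader.
  have hone : ∀ A, ∑ U ∈ C {A}, z ^ U.card = 1 + ∑ b ∈ S.kids X k t A, S.psi X k b z := by
    intro A
    have : C {A} = insert ∅ ((S.kids X k t A).biUnion fun b => S.cohSets X k b) := by
      ext U
      rw [hC, Finset.mem_insert, Finset.mem_biUnion]
      constructor
      · rintro ⟨h1, h2, h3⟩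
        rcases U.eq_empty_or_nonempty with h | ⟨u, hu⟩
        · exact Or.inl h
        · right
          have hu1 := S.mem_grp.1 (h1 hu)
          obtain ⟨b, hb, hbu⟩ := S.exists_leader k hu1.1
          refine ⟨b, S.mem_kids.2 ⟨hb, ?_, ?_⟩, S.mem_cohSets.2 ⟨fun v hv => ?_, ⟨u, hu⟩, h3⟩⟩
          · rw [S.key_succ _ _ _ hbu, hu1.2]
          · rw [S.lab_of_key _ _ _ hbu]
            exact Finset.mem_singleton.1 (h2 u hu)
          · have hv1 := S.mem_grp.1 (h1 hv)
            refine S.mem_grp.2 ⟨hv1.1, ?_⟩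
            rw [hbu]
            refine h3 v hv u hu k (hv1.2.trans hu1.2.symm) ?_
            rw [Finset.mem_singleton.1 (h2 u hu), Finset.mem_singleton.1 (h2 v hv)]
      · rintro (rfl | ⟨b, hb, hU⟩)
        · exact ⟨by simp, by simp, by intro t ht; simp at ht⟩
        · rw [mem_kids] at hb
          rw [mem_cohSets] at hU
          refine ⟨fun u hu => ?_, fun u hu => ?_, hU.2.2⟩
          · have := S.mem_grp.1 (hU.1 hu)
            exact S.mem_grp.2 ⟨this.1, (S.key_succ _ _ _ this.2).trans hb.2.1⟩
          · have := S.mem_grp.1 (hU.1 hu)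
            rw [Finset.mem_singleton, S.lab_of_key _ _ _ this.2, hb.2.2]
    rw [this, Finset.sum_insert (by simp [mem_cohSets]), Finset.sum_biUnion]
    · simp [psi]
    · intro b hb b' hb' hne
      rw [Function.onFun, Finset.disjoint_left]
      intro U hU hU'
      rw [mem_cohSets] at hU hU'
      obtain ⟨u, hu⟩ := hU.2.1
      have e1 := (S.mem_grp.1 (hU.1 hu)).2
      have e2 := (S.mem_grp.1 (hU'.1 hu)).2
      exact hne (S.leader_unique (S.mem_kids.1 hb).1 (S.mem_kids.1 hb').1 (e1.symm.trans e2))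
  rw [← hfull]
  generalize S.labs k (S.lab (k + 1) t) = s
  induction s using Finset.induction_on with
  | empty => simpa using hempty
  | insert A s hA ih => rw [hins A s hA, Finset.prod_insert hA, ih, hone A]

end LevelSystem

end MPCJoin

end

noncomputable section
namespace MPCJoin

/-! ### Allocation of cells to groups -/

/-- Disjoint intervals that meet a point up to `Λ` have a bounded total length, when each is cut
off at length `Λ`. -/
theorem sum_min_le_of_disjoint {β : Type*} (s : Finset β) (off nu : β → ℕ) {Λ lo : ℕ} (hΛ : 1 ≤ Λ)
    (hdisj : ∀ b ∈ s, ∀ b' ∈ s, b ≠ b' → off b + nu b ≤ off b' ∨ off b' + nu b' ≤ off b)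
    (h1 : ∀ b ∈ s, off b ≤ lo + Λ) (h2 : ∀ b ∈ s, lo < off b + nu b + Λ) :
    ∑ b ∈ s, min Λ (nu b) ≤ 5 * Λ := by
  -- Clipping to the window of radius `2 * Λ` around `lo` leaves at least `min Λ (nu b)` of every
  -- interval, since it comes within `Λ` of `lo`. The clipped intervals are disjoint in a window of
  -- at most `4 * Λ + 1 ≤ 5 * Λ` points.
  let J : β → Finset ℕ := fun b => Finset.Ico (max (off b) (lo - 2 * Λ))
    (min (off b + nu b) (lo + 2 * Λ + 1))
  calc ∑ b ∈ s, min Λ (nu b) ≤ ∑ b ∈ s, (J b).card := by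
        refine Finset.sum_le_sum fun b hb => ?_
        have := h1 b hb
        have := h2 b hb
        rw [Nat.card_Ico]
        omega
    _ = (s.biUnion J).card := by
        rw [Finset.card_biUnion]
        intro b hb b' hb' hne
        rw [Function.onFun, Finset.disjoint_left]
        intro x hx hx'
        rw [Finset.mem_Ico] at hx hx'
        have := hdisj b hb b' hb' hne
        omega
    _ ≤ (Finset.Ico (lo - 2 * Λ) (lo + 2 * Λ + 1)).card := by
        refine Finset.card_le_card fun x hx => ?_
        obtain ⟨b, -, hx⟩ := Finset.mem_biUnion.1 hx
        rw [Finset.mem_Ico] at hx ⊢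
        omega
    _ ≤ 5 * Λ := by rw [Nat.card_Ico]; omega

theorem exists_digits {Λ : Type*} (s : Finset Λ) (C : Λ → ℕ) : ∃ f : ℕ → Λ → ℕ,
    ∀ δ : Λ → ℕ, (∀ A ∈ s, δ A < C A) → ∃ c < ∏ A ∈ s, C A, ∀ A ∈ s, f c A = δ A := by
  classical
  let P := s.pi fun A => Finset.range (C A)
  have hP : P.card = ∏ A ∈ s, C A := by simp [P]
  let e := P.equivFin
  refine ⟨fun c A => if h : c < P.card ∧ A ∈ s then (e.symm ⟨c, h.1⟩).1 A h.2 else 0,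
    fun δ hδ => ?_⟩
  have hmem : (fun A (_ : A ∈ s) => δ A) ∈ P := by
    simp only [P, Finset.mem_pi, Finset.mem_range]
    exact hδ
  refine ⟨e ⟨_, hmem⟩, hP ▸ Fin.is_lt _, fun A hA => ?_⟩
  exact (dif_pos ⟨Fin.is_lt _, hA⟩).trans (by simp)

/-- The digits of a number in a mixed radix system with radices `C`. -/
def digits {Λ : Type*} (s : Finset Λ) (C : Λ → ℕ) : ℕ → Λ → ℕ := (exists_digits s C).choose

theorem digits_spec {Λ : Type*} (s : Finset Λ) (C : Λ → ℕ) {δ : Λ → ℕ} (h : ∀ A ∈ s, δ A < C A) :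
    ∃ c < ∏ A ∈ s, C A, ∀ A ∈ s, digits s C c A = δ A := (exists_digits s C).choose_spec δ h

namespace LevelSystem

variable {τ K Λ : Type*} (S : LevelSystem τ K Λ)

/-- The number of coherent sets in a group, a set with `j` elements weighted by `L ^ (m - j)`. -/
def weight (X : Finset τ) (m L k : ℕ) (t : τ) : ℕ := ∑ U ∈ S.cohSets X k t, L ^ (m - U.card)

-- Coherent sets have at most `m` elements, so the subtraction in the exponent is genuine and the
-- weight is the generating function at `1 / L`, scaled to an integer.
variable {S} in
theorem weight_eq {X : Finset τ} {m L k : ℕ} {t : τ} (hL : 0 < L)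
    (hm : ∀ U ⊆ X, S.CoherentSet U → U.card ≤ m) :
    (S.weight X m L k t : ℝ) = (L : ℝ) ^ m * S.psi X k t (1 / L : ℝ) := by
  have hL' : (L : ℝ) ≠ 0 := by positivity
  unfold weight psi
  rw [Finset.mul_sum]
  push_cast
  refine Finset.sum_congr rfl fun U hU => ?_
  rw [mem_cohSets] at hU
  have := hm U (fun x hx => (S.mem_grp.1 (hU.1 hx)).1) hU.2.2
  rw [one_div, inv_pow, ← div_eq_mul_inv, eq_div_iff (pow_ne_zero _ hL'), ← pow_add,
    Nat.sub_add_cancel this]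

/-- Singletons are coherent and each has weight `L ^ (m - 1)`. Hence a group of weight below `L ^ m`
has fewer than `L` tuples. -/
theorem card_grp_mul_le {X : Finset τ} {m L k : ℕ} {t : τ} (hm : 0 < m) :
    (S.grp X k t).card * L ^ m ≤ L * S.weight X m L k t := by
  classical
  have hsub : (S.grp X k t).image (fun u => ({u} : Finset τ)) ⊆ S.cohSets X k t := by
    intro U hU
    obtain ⟨u, hu, rfl⟩ := Finset.mem_image.1 hU
    refine S.mem_cohSets.2 ⟨Finset.singleton_subset_iff.2 hu, Finset.singleton_nonempty _, ?_⟩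
    intro a ha b hb
    rw [Finset.mem_singleton.1 ha, Finset.mem_singleton.1 hb]
    exact Coherent.refl S u
  have := Finset.sum_le_sum_of_subset (f := fun U => L ^ (m - U.card)) hsub
  rw [Finset.sum_image (fun a _ b _ h => Finset.singleton_injective h)] at this
  simp only [Finset.card_singleton, Finset.sum_const, smul_eq_mul] at this
  calc (S.grp X k t).card * L ^ m = L * ((S.grp X k t).card * L ^ (m - 1)) := by
        obtain ⟨m, rfl⟩ := Nat.exists_eq_succ_of_ne_zero hm.ne'
        simp only [Nat.succ_eq_add_one, Nat.add_sub_cancel, pow_succ]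
        ring
    _ ≤ L * S.weight X m L k t := Nat.mul_le_mul_left _ this

/-- Constants that depend only on the level and the number of labels. -/
def cellFactor (m : ℕ) : ℕ → ℕ
  | 0 => 1
  | k + 1 => (cellFactor m k + 1) ^ m

theorem cellFactor_pos (m k : ℕ) : 0 < cellFactor m k := by
  cases k <;> simp [cellFactor]

section

variable [LinearOrder τ]

/-- The total weight of the groups with label `A` in a group at level `k + 1`. -/
def labelWeight (X : Finset τ) (m L k : ℕ) (t : τ) (A : Λ) : ℕ :=
  ∑ b ∈ S.kids X k t A, S.weight X m L k b

/-- The number of alternatives for the label `A`. -/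
def radix (X : Finset τ) (m L k : ℕ) (t : τ) (A : Λ) : ℕ :=
  cellFactor m k * S.labelWeight X m L k t A / L ^ m + cellFactor m k + 1

/-- The number of cells on which the results in a group at level `k` are computed. -/
def cells (X : Finset τ) (m L : ℕ) : ℕ → τ → ℕ
  | 0, _ => 1
  | k + 1, t => ∏ A ∈ S.labs k (S.lab (k + 1) t), S.radix X m L k t A

theorem radix_congr {X : Finset τ} {m L k : ℕ} {t t' : τ}
    (h : S.key (k + 1) t = S.key (k + 1) t') : S.radix X m L k t = S.radix X m L k t' := by
  funext A
  simp only [radix, labelWeight, S.kids_congr h]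

theorem cells_congr {X : Finset τ} {m L k : ℕ} {t t' : τ} (h : S.key k t = S.key k t') :
    S.cells X m L k t = S.cells X m L k t' := by
  cases k with
  | zero => rfl
  | succ k => simp only [cells, S.radix_congr h, S.lab_of_key _ _ _ h]

-- Up to rounding, the radix for a label is `κ` times the corresponding factor of
-- `one_add_psi_succ`, with the additive constant absorbed by passing to `κ + 1`. The product over
-- at most `m` labels loses only `(κ + 1) ^ m`. No induction is needed because radices are defined
-- from weights and not from the cells of the children.
variable {S} in
theorem cells_mul_le {X : Finset τ} {m L : ℕ} (hL : 0 < L) (hX : ∀ t ∈ X, t ∈ S.carrier)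
    (hm : ∀ U ⊆ X, S.CoherentSet U → U.card ≤ m)
    (hlab : ∀ k A, (S.labs k A).card ≤ m) (k : ℕ) (t : τ) :
    S.cells X m L k t * L ^ m ≤ cellFactor m k * (L ^ m + S.weight X m L k t) := by
  cases k with
  | zero => simp [cells, cellFactor]
  | succ k =>
    have hL' : (0 : ℝ) < (L : ℝ) ^ m := by positivity
    set κ := cellFactor m k with hκ
    have h1 : ∀ A, (S.radix X m L k t A : ℝ) ≤
        (κ + 1) * (1 + ∑ b ∈ S.kids X k t A, S.psi X k b (1 / L : ℝ)) := by
      intro A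
      have e : (S.labelWeight X m L k t A : ℝ) =
          (L : ℝ) ^ m * ∑ b ∈ S.kids X k t A, S.psi X k b (1 / L : ℝ) := by
        unfold labelWeight
        rw [Finset.mul_sum]
        push_cast
        exact Finset.sum_congr rfl fun b _ => weight_eq hL hm
      have e2 : 0 ≤ ∑ b ∈ S.kids X k t A, S.psi X k b (1 / L : ℝ) :=
        Finset.sum_nonneg fun b _ => Finset.sum_nonneg fun U _ => by positivity
      have e3 : ((κ * S.labelWeight X m L k t A / L ^ m : ℕ) : ℝ) ≤
          κ * ∑ b ∈ S.kids X k t A, S.psi X k b (1 / L : ℝ) := by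
        refine Nat.cast_div_le.trans (le_of_eq ?_)
        push_cast
        rw [e]
        field_simp
      unfold radix
      push_cast
      rw [← hκ]
      nlinarith
    have h2 : (S.cells X m L (k + 1) t : ℝ) ≤
        (κ + 1) ^ m * (1 + S.psi X (k + 1) t (1 / L : ℝ)) := by
      rw [one_add_psi_succ hX]
      unfold cells
      push_cast
      calc ∏ A ∈ S.labs k (S.lab (k + 1) t), (S.radix X m L k t A : ℝ)
          ≤ ∏ A ∈ S.labs k (S.lab (k + 1) t),
            (((κ : ℝ) + 1) * (1 + ∑ b ∈ S.kids X k t A, S.psi X k b (1 / L : ℝ))) :=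
            Finset.prod_le_prod (fun A _ => by positivity) (fun A _ => h1 A)
        _ = ((κ : ℝ) + 1) ^ (S.labs k (S.lab (k + 1) t)).card *
            ∏ A ∈ S.labs k (S.lab (k + 1) t),
              (1 + ∑ b ∈ S.kids X k t A, S.psi X k b (1 / L : ℝ)) := by
            rw [Finset.prod_mul_distrib, Finset.prod_const]
        _ ≤ _ := by
            refine mul_le_mul_of_nonneg_right
              (pow_le_pow_right₀ (by linarith [Nat.cast_nonneg (α := ℝ) κ]) (hlab _ _)) ?_
            refine Finset.prod_nonneg fun A _ => add_nonneg zero_le_one ?_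
            exact Finset.sum_nonneg fun b _ => Finset.sum_nonneg fun U _ => by positivity
    have h3 : (S.cells X m L (k + 1) t : ℝ) * (L : ℝ) ^ m ≤
        (κ + 1) ^ m * ((L : ℝ) ^ m + S.weight X m L (k + 1) t) := by
      rw [weight_eq hL hm]
      calc _ ≤ ((κ : ℝ) + 1) ^ m * (1 + S.psi X (k + 1) t (1 / L : ℝ)) * (L : ℝ) ^ m :=
            mul_le_mul_of_nonneg_right h2 hL'.le
        _ = _ := by ring
    unfold cellFactor
    rw [← hκ]
    exact_mod_cast h3

section Order

variable [LinearOrder K]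

open Classical in
/-- The total weight of the alternatives before the group of `t`. -/
def offset (X : Finset τ) (m L k : ℕ) (t : τ) : ℕ :=
  ∑ b ∈ (S.kids X k t (S.lab k t)).filter (fun b => S.key k b < S.key k t), S.weight X m L k b

/-- The first cell of the group of `t`. -/
def start (X : Finset τ) (m L k : ℕ) (t : τ) : ℕ :=
  cellFactor m k * S.offset X m L k t / L ^ m

/-- The tuple `t` is needed in the cell `c` of its group at level `k`. -/
def NeededIn (X : Finset τ) (m L : ℕ) : ℕ → τ → ℕ → Prop
  | 0, _, _ => True
  | k + 1, t, c =>
    let δ := digits (S.labs k (S.lab (k + 1) t)) (S.radix X m L k t) c (S.lab k t)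
    S.start X m L k t ≤ δ ∧ δ < S.start X m L k t + S.cells X m L k t ∧
      NeededIn X m L k t (δ - S.start X m L k t)

theorem start_congr {X : Finset τ} {m L k : ℕ} {t t' : τ} (h : S.key k t = S.key k t') :
    S.start X m L k t = S.start X m L k t' := by
  simp only [start, offset, S.kids_congr (S.key_succ _ _ _ h), h, S.lab_of_key _ _ _ h]

/-- Alternatives occupy consecutive intervals `[offset, offset + weight)`, ordered by key; this one
ends no later than the total weight of its label. -/
theorem offset_add_weight_le {X : Finset τ} {m L k : ℕ} {t b : τ} {A : Λ}
    (hb : b ∈ S.kids X k t A) :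
    S.offset X m L k b + S.weight X m L k b ≤ S.labelWeight X m L k t A := by
  classical
  have hb' := S.mem_kids.1 hb
  unfold offset labelWeight
  rw [hb'.2.2, S.kids_congr hb'.2.1, add_comm, ← Finset.sum_insert (by simp)]
  exact Finset.sum_le_sum_of_subset (Finset.insert_subset hb (Finset.filter_subset _ _))

theorem offset_add_weight_le_offset {X : Finset τ} {m L k : ℕ} {t b b' : τ} {A : Λ}
    (hb : b ∈ S.kids X k t A) (hb' : b' ∈ S.kids X k t A) (hlt : S.key k b < S.key k b') :
    S.offset X m L k b + S.weight X m L k b ≤ S.offset X m L k b' := by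
  classical
  have h := S.mem_kids.1 hb
  have h' := S.mem_kids.1 hb'
  unfold offset
  rw [h.2.2, h'.2.2, S.kids_congr h.2.1, S.kids_congr h'.2.1, add_comm,
    ← Finset.sum_insert (by simp)]
  refine Finset.sum_le_sum_of_subset (Finset.insert_subset ?_ ?_)
  · exact Finset.mem_filter.2 ⟨hb, hlt⟩
  · intro x hx
    rw [Finset.mem_filter] at hx ⊢
    exact ⟨hx.1, hx.2.trans hlt⟩

variable {S} {X : Finset τ} {m L : ℕ}

/-- By `cells_mul_le` a group needs at most `κ * (1 + weight / L ^ m)` digits. Its interval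
therefore overshoots the scaled weight interval by at most `κ`, which the summand `κ + 1` in `radix`
accommodates. Digit intervals of neighbouring groups may overlap. -/
theorem start_add_cells_lt (hL : 0 < L) (hX : ∀ t ∈ X, t ∈ S.carrier)
    (hm : ∀ U ⊆ X, S.CoherentSet U → U.card ≤ m) (hlab : ∀ k A, (S.labs k A).card ≤ m)
    {k : ℕ} {t u : τ} (hu : u ∈ X) (h : S.key (k + 1) u = S.key (k + 1) t) :
    S.start X m L k u + S.cells X m L k u < S.radix X m L k t (S.lab k u) := by
  obtain ⟨b, hb, hbu⟩ := S.exists_leader k hu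
  have hkid : b ∈ S.kids X k t (S.lab k u) :=
    S.mem_kids.2 ⟨hb, (S.key_succ _ _ _ hbu).trans h, S.lab_of_key _ _ _ hbu⟩
  rw [← S.start_congr hbu, ← S.cells_congr hbu]
  have h1 := S.offset_add_weight_le (m := m) (L := L) hkid
  have h2 := cells_mul_le hL hX hm hlab k b
  unfold radix start
  have hΛ : 0 < L ^ m := by positivity
  set κ := cellFactor m k
  set Λ' := L ^ m
  have h3 : (κ * S.offset X m L k b / Λ' + S.cells X m L k b - κ) * Λ' ≤
      κ * S.labelWeight X m L k t (S.lab k u) := by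
    rw [Nat.sub_mul, Nat.add_mul]
    have := Nat.div_mul_le_self (κ * S.offset X m L k b) Λ'
    have := Nat.mul_le_mul_left κ h1
    rw [mul_add] at h2 this
    omega
  have := (Nat.le_div_iff_mul_le hΛ).2 h3
  omega

/-- Recursively, all tuples of a coherent set with one label lie in the same child, so the digit for
that label can be the start of this child plus the common cell found inside it. -/
theorem exists_cell (hL : 0 < L) (hX : ∀ t ∈ X, t ∈ S.carrier)
    (hm : ∀ U ⊆ X, S.CoherentSet U → U.card ≤ m) (hlab : ∀ k A, (S.labs k A).card ≤ m)
    {U : Finset τ} (hU : U ⊆ X) (hcoh : S.CoherentSet U) (k : ℕ) (t : τ) :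
    ∃ c < S.cells X m L k t, ∀ u ∈ U, S.key k u = S.key k t → S.NeededIn X m L k u c := by
  classical
  induction k generalizing t with
  | zero => exact ⟨0, by simp [cells], fun _ _ _ => trivial⟩
  | succ k ih =>
    choose cell hcell hneed using ih
    -- A label not represented in `U` constrains nothing and gets the digit `0`.
    let δ : Λ → ℕ := fun A =>
      if h : ∃ u ∈ U, S.key (k + 1) u = S.key (k + 1) t ∧ S.lab k u = A then
        S.start X m L k h.choose + cell h.choose else 0
    have hδ : ∀ A ∈ S.labs k (S.lab (k + 1) t), δ A < S.radix X m L k t A := by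
      intro A _
      by_cases h : ∃ u ∈ U, S.key (k + 1) u = S.key (k + 1) t ∧ S.lab k u = A
      · simp only [δ, dif_pos h]
        obtain ⟨h1, h2, h3⟩ := h.choose_spec
        have := start_add_cells_lt (L := L) hL hX hm hlab (hU h1) h2
        rw [h3] at this
        have := hcell h.choose
        omega
      · simp only [δ, dif_neg h]
        simp [radix]
    obtain ⟨c, hc, hcd⟩ := digits_spec _ _ hδ
    refine ⟨c, hc, fun u hu hut => ?_⟩
    have hlu := S.lab_of_key _ _ _ hut
    have hmem : S.lab k u ∈ S.labs k (S.lab (k + 1) t) := hlu ▸ S.lab_mem k u (hX u (hU hu))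
    have hex : ∃ v ∈ U, S.key (k + 1) v = S.key (k + 1) t ∧ S.lab k v = S.lab k u :=
      ⟨u, hu, hut, rfl⟩
    obtain ⟨h1, h2, h3⟩ := hex.choose_spec
    have hkey : S.key k u = S.key k hex.choose :=
      hcoh u hu _ h1 k (hut.trans h2.symm) h3.symm
    have hd : digits (S.labs k (S.lab (k + 1) u)) (S.radix X m L k u) c (S.lab k u) =
        S.start X m L k u + cell hex.choose := by
      rw [hlu, S.radix_congr hut, hcd _ hmem, S.start_congr hkey]
      simp only [δ, dif_pos hex]
    unfold NeededIn
    simp only [hd]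
    refine ⟨Nat.le_add_right _ _, ?_, ?_⟩
    · rw [S.cells_congr hkey]
      exact Nat.add_lt_add_left (hcell _) _
    · rw [Nat.add_sub_cancel_left]
      exact hneed _ u hu hkey

/-- Constants that depend only on the level and the number of labels. -/
def loadFactor (m : ℕ) : ℕ → ℕ
  | 0 => 1
  | k + 1 => m * (5 * loadFactor m k)

-- For each label the cell fixes one digit, and only children whose digit interval contains it
-- contribute. A child of weight at least `L ^ m` contributes `O(L)` tuples by induction; a lighter
-- one contributes at most `L * weight / L ^ m` because it has no more tuples. Since weight
-- intervals are disjoint and the relevant ones come close to one point, the contributions add up to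
-- `O(L)`.
open Classical in
theorem card_neededIn_le (hm0 : 0 < m) (hL : 0 < L) (hX : ∀ t ∈ X, t ∈ S.carrier)
    (hm : ∀ U ⊆ X, S.CoherentSet U → U.card ≤ m) (hlab : ∀ k A, (S.labs k A).card ≤ m)
    (k : ℕ) (t : τ) (c : ℕ) :
    ((S.grp X k t).filter fun u => S.NeededIn X m L k u c).card ≤ loadFactor m k * L := by
  have hΛ : 0 < L ^ m := by positivity
  have hpos : ∀ k, 0 < loadFactor m k := by
    intro k
    induction k with
    | zero => simp [loadFactor]
    | succ k ih => simp only [loadFactor]; positivity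
  induction k generalizing t c with
  | zero =>
    refine (Finset.card_le_one.2 ?_).trans (by simp only [loadFactor]; omega)
    intro a ha b hb
    have ha := S.mem_grp.1 (Finset.mem_filter.1 ha).1
    have hb := S.mem_grp.1 (Finset.mem_filter.1 hb).1
    exact S.key_zero_inj _ (hX _ ha.1) _ (hX _ hb.1) (ha.2.trans hb.2.symm)
  | succ k ih =>
    let δ := digits (S.labs k (S.lab (k + 1) t)) (S.radix X m L k t) c
    let B : Λ → Finset τ := fun A => (S.kids X k t A).filter fun b =>
      S.start X m L k b ≤ δ A ∧ δ A < S.start X m L k b + S.cells X m L k b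
    let G : Λ → τ → Finset τ := fun A b =>
      (S.grp X k b).filter fun u => S.NeededIn X m L k u (δ A - S.start X m L k b)
    have hsub : ((S.grp X (k + 1) t).filter fun u => S.NeededIn X m L (k + 1) u c) ⊆
        (S.labs k (S.lab (k + 1) t)).biUnion fun A => (B A).biUnion fun b => G A b := by
      intro u hu
      obtain ⟨hu1, hu2⟩ := Finset.mem_filter.1 hu
      obtain ⟨huX, hut⟩ := S.mem_grp.1 hu1
      have hlu := S.lab_of_key _ _ _ hut
      obtain ⟨b, hb, hbu⟩ := S.exists_leader k huX
      unfold NeededIn at hu2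
      simp only [hlu, S.radix_congr hut] at hu2
      refine Finset.mem_biUnion.2 ⟨S.lab k u, hlu ▸ S.lab_mem k u (hX u huX),
        Finset.mem_biUnion.2 ⟨b, Finset.mem_filter.2 ⟨?_, ?_⟩, Finset.mem_filter.2 ⟨?_, ?_⟩⟩⟩
      · exact S.mem_kids.2 ⟨hb, (S.key_succ _ _ _ hbu).trans hut, S.lab_of_key _ _ _ hbu⟩
      · rw [S.start_congr hbu, S.cells_congr hbu]
        exact ⟨hu2.1, hu2.2.1⟩
      · exact S.mem_grp.2 ⟨huX, hbu.symm⟩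
      · rw [S.start_congr hbu]
        exact hu2.2.2
    have hA : ∀ A, ∑ b ∈ B A, (G A b).card ≤ 5 * loadFactor m k * L := by
      intro A
      have hBk : ∀ b ∈ B A, b ∈ S.kids X k t A := fun b hb => (Finset.mem_filter.1 hb).1
      have e1 : ∀ b ∈ B A, (G A b).card * L ^ m ≤
          loadFactor m k * L * min (L ^ m) (S.weight X m L k b) := by
        intro b hb
        rcases le_total (L ^ m) (S.weight X m L k b) with h | h
        · rw [min_eq_left h]
          exact Nat.mul_le_mul_right _ (ih b _)
        · rw [min_eq_right h]
          calc (G A b).card * L ^ m ≤ (S.grp X k b).card * L ^ m :=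
                Nat.mul_le_mul_right _ (Finset.card_le_card (Finset.filter_subset _ _))
            _ ≤ L * S.weight X m L k b := S.card_grp_mul_le hm0
            _ ≤ loadFactor m k * L * S.weight X m L k b :=
                Nat.mul_le_mul_right _ (Nat.le_mul_of_pos_left _ (hpos k))
      have hκ := cellFactor_pos m k
      have hdiv : cellFactor m k * (δ A * L ^ m / cellFactor m k) ≤ δ A * L ^ m :=
        Nat.mul_div_le _ _
      have hdiv' : δ A * L ^ m < cellFactor m k * (δ A * L ^ m / cellFactor m k + 1) := by
        exact Nat.lt_mul_div_succ _ hκ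
      -- `lo` is the position on the weight scale that corresponds to the digit `δ A`. Containing
      -- this digit means, up to an error `L ^ m`, that the weight interval of the child contains
      -- `lo`.
      have e2 : ∑ b ∈ B A, min (L ^ m) (S.weight X m L k b) ≤ 5 * L ^ m := by
        refine sum_min_le_of_disjoint (B A) (S.offset X m L k) _
          (lo := δ A * L ^ m / cellFactor m k) hΛ ?_ ?_ ?_
        · intro b hb b' hb' hne
          rcases lt_trichotomy (S.key k b) (S.key k b') with h | h | h
          · exact Or.inl (S.offset_add_weight_le_offset (hBk b hb) (hBk b' hb') h)
          · exact absurd (S.leader_unique (S.mem_kids.1 (hBk b hb)).1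
              (S.mem_kids.1 (hBk b' hb')).1 h) hne
          · exact Or.inr (S.offset_add_weight_le_offset (hBk b' hb') (hBk b hb) h)
        · intro b hb
          have h1 := (Finset.mem_filter.1 hb).2.1
          unfold start at h1
          have h2 : cellFactor m k * S.offset X m L k b < (δ A + 1) * L ^ m :=
            Nat.lt_mul_of_div_lt (Nat.lt_succ_of_le h1) hΛ
          rw [Nat.add_mul, one_mul] at h2
          have h3 : cellFactor m k * S.offset X m L k b <
              cellFactor m k * (δ A * L ^ m / cellFactor m k + 1 + L ^ m) := by
            have := Nat.le_mul_of_pos_left (L ^ m) hκ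
            rw [mul_add]
            omega
          have := Nat.lt_of_mul_lt_mul_left h3
          omega
        · intro b hb
          have h1 := (Finset.mem_filter.1 hb).2.2
          have h2 := cells_mul_le hL hX hm hlab k b
          have h4 := Nat.div_mul_le_self (cellFactor m k * S.offset X m L k b) (L ^ m)
          unfold start at h1
          have h3 := Nat.mul_lt_mul_of_pos_right h1 hΛ
          rw [Nat.add_mul] at h3
          refine Nat.lt_of_mul_lt_mul_left (a := cellFactor m k) ?_
          simp only [mul_add] at h2 ⊢
          omega
      have e3 : (∑ b ∈ B A, (G A b).card) * L ^ m ≤ 5 * loadFactor m k * L * L ^ m := by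
        rw [Finset.sum_mul]
        calc _ ≤ ∑ b ∈ B A, loadFactor m k * L * min (L ^ m) (S.weight X m L k b) :=
              Finset.sum_le_sum e1
          _ = loadFactor m k * L * ∑ b ∈ B A, min (L ^ m) (S.weight X m L k b) := by
              rw [Finset.mul_sum]
          _ ≤ loadFactor m k * L * (5 * L ^ m) := Nat.mul_le_mul_left _ e2
          _ = _ := by ring
      exact Nat.le_of_mul_le_mul_right e3 hΛ
    calc _ ≤ _ := Finset.card_le_card hsub
      _ ≤ ∑ A ∈ S.labs k (S.lab (k + 1) t), ((B A).biUnion fun b => G A b).card :=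
          Finset.card_biUnion_le
      _ ≤ ∑ A ∈ S.labs k (S.lab (k + 1) t), 5 * loadFactor m k * L :=
          Finset.sum_le_sum fun A _ => Finset.card_biUnion_le.trans (hA A)
      _ ≤ m * (5 * loadFactor m k * L) := by
          rw [Finset.sum_const, smul_eq_mul]
          exact Nat.mul_le_mul_right _ (hlab _ _)
      _ = loadFactor m (k + 1) * L := by simp only [loadFactor]; ring

end Order

end

end LevelSystem

end MPCJoin

end

noncomputable section
namespace MPCJoin

/-! ### Sets of tuples that extend to full results -/

namespace LevelSystem

variable {τ K Λ : Type*} (S : LevelSystem τ K Λ)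

open Classical in
/-- The tuples that remain after removing, level by level, those which have no partner with some
label. -/
def alive (X : Finset τ) : ℕ → Finset τ
  | 0 => X
  | k + 1 => (alive X k).filter fun t => ∀ A ∈ S.labs k (S.lab (k + 1) t),
      ∃ t' ∈ alive X k, S.key (k + 1) t' = S.key (k + 1) t ∧ S.lab k t' = A

theorem mem_alive_succ {X : Finset τ} {k : ℕ} {t : τ} : t ∈ S.alive X (k + 1) ↔
    t ∈ S.alive X k ∧ ∀ A ∈ S.labs k (S.lab (k + 1) t),
      ∃ t' ∈ S.alive X k, S.key (k + 1) t' = S.key (k + 1) t ∧ S.lab k t' = A := by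
  simp [alive]

theorem alive_subset (X : Finset τ) (k : ℕ) : S.alive X k ⊆ X := by
  induction k with
  | zero => exact subset_rfl
  | succ k ih => exact fun t ht => ih (S.mem_alive_succ.1 ht).1

/-- Below level `k` every tuple of the set has partners with all labels. -/
def Saturated (W : Finset τ) (k : ℕ) : Prop :=
  ∀ j < k, ∀ w ∈ W, ∀ A ∈ S.labs j (S.lab (j + 1) w),
    ∃ w' ∈ W, S.key (j + 1) w' = S.key (j + 1) w ∧ S.lab j w' = A

-- The partners that a saturated set provides survive each removal step together with the set
-- itself, so no tuple of it is ever removed.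
variable {S} in
theorem Saturated.subset_alive {X W : Finset τ} {k : ℕ} (h : S.Saturated W k) (hW : W ⊆ X) :
    W ⊆ S.alive X k := by
  induction k with
  | zero => exact hW
  | succ k ih =>
    have ih := ih fun j hj => h j (by omega)
    intro w hw
    refine S.mem_alive_succ.2 ⟨ih hw, fun A hA => ?_⟩
    obtain ⟨w', hw', h1, h2⟩ := h k (by omega) w hw A hA
    exact ⟨w', ih hw', h1, h2⟩

/-- Build the set from the top: for each label continue in the child that contains the tuples of `U`
with this label, or, if there are none, in the child of a surviving partner. The union is coherent
since different labels never conflict, and it is saturated since each part is nonempty. -/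
theorem exists_saturated {X : Finset τ} (hX : ∀ t ∈ X, t ∈ S.carrier) (k : ℕ) {t : τ}
    (ht : t ∈ S.alive X k) {U : Finset τ} (hU : U ⊆ S.alive X k) (hcoh : S.CoherentSet U)
    (hkey : ∀ u ∈ U, S.key k u = S.key k t) :
    ∃ W, U ⊆ W ∧ W ⊆ X ∧ W.Nonempty ∧ S.CoherentSet W ∧ (∀ w ∈ W, S.key k w = S.key k t) ∧
      S.Saturated W k := by
  classical
  induction k generalizing t U with
  | zero =>
    refine ⟨{t}, fun u hu => ?_, Finset.singleton_subset_iff.2 ht, Finset.singleton_nonempty _, ?_,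
      ?_, by intro j hj; omega⟩
    · exact Finset.mem_singleton.2 (S.key_zero_inj _ (hX _ (hU hu)) _ (hX _ ht) (hkey u hu))
    · intro a ha b hb
      rw [Finset.mem_singleton.1 ha, Finset.mem_singleton.1 hb]
      exact Coherent.refl S t
    · intro w hw
      rw [Finset.mem_singleton.1 hw]
  | succ k ih =>
    have hsub : U ⊆ S.alive X k := fun u hu => (S.mem_alive_succ.1 (hU hu)).1
    have hstep : ∀ A ∈ S.labs k (S.lab (k + 1) t), ∃ W, (U.filter fun u => S.lab k u = A) ⊆ W ∧
        W ⊆ X ∧ W.Nonempty ∧ S.CoherentSet W ∧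
        (∀ w ∈ W, S.key (k + 1) w = S.key (k + 1) t ∧ S.lab k w = A) ∧ S.Saturated W k := by
      intro A hA
      have : ∃ a ∈ S.alive X k, S.key (k + 1) a = S.key (k + 1) t ∧ S.lab k a = A ∧
          ∀ u ∈ U, S.lab k u = A → S.key k u = S.key k a := by
        by_cases h : ∃ u ∈ U, S.lab k u = A
        · obtain ⟨a, ha, haA⟩ := h
          refine ⟨a, hsub ha, hkey a ha, haA, fun u hu huA => ?_⟩
          exact hcoh u hu a ha k ((hkey u hu).trans (hkey a ha).symm) (huA.trans haA.symm)
        · obtain ⟨a, ha, h1, h2⟩ := (S.mem_alive_succ.1 ht).2 A hA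
          exact ⟨a, ha, h1, h2, fun u hu huA => absurd ⟨u, hu, huA⟩ h⟩
      obtain ⟨a, ha, h1, h2, h3⟩ := this
      obtain ⟨W, g1, g2, g3, g4, g5, g6⟩ := ih ha (U := U.filter fun u => S.lab k u = A)
        ((Finset.filter_subset _ _).trans hsub) (hcoh.mono (Finset.filter_subset _ _))
        (fun u hu => h3 u (Finset.mem_filter.1 hu).1 (Finset.mem_filter.1 hu).2)
      refine ⟨W, g1, g2, g3, g4, fun w hw => ⟨?_, ?_⟩, g6⟩
      · rw [S.key_succ _ _ _ (g5 w hw), h1]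
      · rw [S.lab_of_key _ _ _ (g5 w hw), h2]
    choose! W g1 g2 g3 g4 g5 g6 using hstep
    have hmem : ∀ w, w ∈ (S.labs k (S.lab (k + 1) t)).biUnion W ↔
        ∃ A ∈ S.labs k (S.lab (k + 1) t), w ∈ W A := fun w => Finset.mem_biUnion
    refine ⟨(S.labs k (S.lab (k + 1) t)).biUnion W, ?_, ?_, ?_, ?_, ?_, ?_⟩
    · intro u hu
      have hA : S.lab k u ∈ S.labs k (S.lab (k + 1) t) := by
        rw [← S.lab_of_key _ _ _ (hkey u hu)]
        exact S.lab_mem k u (hX u (S.alive_subset X _ (hU hu)))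
      exact (hmem u).2 ⟨_, hA, g1 _ hA (Finset.mem_filter.2 ⟨hu, rfl⟩)⟩
    · exact Finset.biUnion_subset.2 g2
    · have hA := S.lab_mem k t (hX t (S.alive_subset X _ ht))
      obtain ⟨w, hw⟩ := g3 _ hA
      exact ⟨w, (hmem w).2 ⟨_, hA, hw⟩⟩
    · intro w hw w' hw'
      obtain ⟨A, hA, hw⟩ := (hmem w).1 hw
      obtain ⟨A', hA', hw'⟩ := (hmem w').1 hw'
      by_cases h : A = A'
      · subst h
        exact g4 A hA w hw w' hw'
      · have e1 := g5 A hA w hw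
        have e2 := g5 A' hA' w' hw'
        refine S.coherent_of_lab_ne (e1.1.trans e2.1.symm) ?_
        rwa [e1.2, e2.2]
    · intro w hw
      obtain ⟨A, hA, hw⟩ := (hmem w).1 hw
      exact (g5 A hA w hw).1
    · intro j hj w hw B hB
      obtain ⟨A, hA, hwA⟩ := (hmem w).1 hw
      rcases Nat.lt_succ_iff_lt_or_eq.1 hj with hj | rfl
      · obtain ⟨w', hw', h1, h2⟩ := g6 A hA j hj w hwA B hB
        exact ⟨w', (hmem w').2 ⟨A, hA, hw'⟩, h1, h2⟩
      · rw [S.lab_of_key _ _ _ (g5 A hA w hwA).1] at hB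
        obtain ⟨w', hw'⟩ := g3 B hB
        have := g5 B hB w' hw'
        exact ⟨w', (hmem w').2 ⟨B, hB, hw'⟩, this.1.trans (g5 A hA w hwA).1.symm, this.2⟩

end LevelSystem

/-! ### Reduced hypergraphs -/

section Reduction

variable {V : Type*} {E F : Finset (Finset V)}

theorem IsReductionOf.subset (h : IsReductionOf F E) : F ⊆ E := by
  classical
  have := h.1
  clear h
  induction this with
  | refl => exact subset_rfl
  | tail _ hs ih =>
    obtain ⟨e, -, e', -, -, -, rfl⟩ := hs
    intro x hx
    refine ih ?_
    simp only [Finset.mem_erase] at hx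
    exact hx.2

theorem IsReductionOf.exists_superset (h : IsReductionOf F E) {e : Finset V} (he : e ∈ E) :
    ∃ f ∈ F, e ⊆ f := by
  classical
  have := h.1
  clear h
  induction this with
  | refl => exact ⟨e, he, subset_rfl⟩
  | tail _ hs ih =>
    obtain ⟨a, -, a', ha', hne, hsub, rfl⟩ := hs
    obtain ⟨f, hf, hef⟩ := ih
    by_cases hfa : f = a
    · subst hfa
      exact ⟨a', by simp [Finset.mem_erase, ha', hne.symm], hef.trans hsub⟩
    · exact ⟨f, by simp [Finset.mem_erase, hf, hfa], hef⟩

theorem IsReductionOf.eq_of_subset (h : IsReductionOf F E) {f f' : Finset V} (hf : f ∈ F)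
    (hf' : f' ∈ F) (hs : f ⊆ f') : f = f' := by
  by_contra hne
  exact h.2 _ ⟨f, hf, f', hf', hne, hs, rfl⟩

end Reduction

/-! ### The level system of a hierarchical hypergraph -/

section Hypergraph

variable {V : Type*} {dom : V → Type*} {E : Finset (Finset V)}

open Classical in
/-- The attributes of an edge that belong to at least `k` edges of `F`. -/
def core (F : Finset (Finset V)) (k : ℕ) (e : Finset V) : Finset V :=
  e.filter fun x => k ≤ (edgesAt F x).card

theorem mem_core {F : Finset (Finset V)} {k : ℕ} {e : Finset V} {x : V} :
    x ∈ core F k e ↔ x ∈ e ∧ k ≤ (edgesAt F x).card := by simp [core]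

theorem core_zero (F : Finset (Finset V)) (e : Finset V) : core F 0 e = e := by
  ext x; simp [mem_core]

theorem card_edgesAt_le (F : Finset (Finset V)) (x : V) : (edgesAt F x).card ≤ F.card := by
  classical
  exact Finset.card_le_card (Finset.filter_subset _ _)

theorem core_eq_empty {F : Finset (Finset V)} {k : ℕ} (hk : F.card < k) (e : Finset V) :
    core F k e = ∅ := by
  refine Finset.eq_empty_of_forall_notMem fun x hx => ?_
  have h1 := (mem_core.1 hx).2
  have h2 := card_edgesAt_le F x
  omega

open Classical in
/-- The restriction of a tuple to a set of attributes. -/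
def values (A : Set V) (t : RelTuple dom E) (x : V) : Option (dom x) :=
  if h : x ∈ t.1.1 ∧ x ∈ A then some (t.2 ⟨x, h.1⟩) else none

theorem values_of_mem {A : Set V} {t : RelTuple dom E} {x : V} (h : x ∈ t.1.1) (hA : x ∈ A) :
    values A t x = some (t.2 ⟨x, h⟩) := dif_pos ⟨h, hA⟩

theorem values_of_notMem {A : Set V} {t : RelTuple dom E} {x : V} (h : ¬ (x ∈ t.1.1 ∧ x ∈ A)) :
    values A t x = none := dif_neg h

theorem mem_of_values_eq {A : Set V} {t t' : RelTuple dom E} {x : V}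
    (h : values A t x = values A t' x) (hx : x ∈ t.1.1 ∧ x ∈ A) : x ∈ t'.1.1 := by
  by_contra hn
  rw [values_of_mem hx.1 hx.2, values_of_notMem fun hh => hn hh.1] at h
  simp at h

theorem values_eq_iff {A : Set V} {t t' : RelTuple dom E} : values A t = values A t' ↔
    ∀ x ∈ A, (x ∈ t.1.1 ↔ x ∈ t'.1.1) ∧
      ∀ (h : x ∈ t.1.1) (h' : x ∈ t'.1.1), t.2 ⟨x, h⟩ = t'.2 ⟨x, h'⟩ := by
  constructor
  · intro h x hA
    have hx := congrFun h x
    refine ⟨⟨fun hh => mem_of_values_eq hx ⟨hh, hA⟩, fun hh => mem_of_values_eq hx.symm ⟨hh, hA⟩⟩,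
      fun h1 h2 => ?_⟩
    rw [values_of_mem h1 hA, values_of_mem h2 hA] at hx
    exact Option.some.inj hx
  · intro h
    funext x
    by_cases hx : x ∈ t.1.1 ∧ x ∈ A
    · have := h x hx.2
      rw [values_of_mem hx.1 hx.2, values_of_mem (this.1.1 hx.1) hx.2, this.2]
    · rw [values_of_notMem hx, values_of_notMem]
      rintro ⟨h1, h2⟩
      exact hx ⟨(h x h2).1.2 h1, h2⟩

theorem values_univ_injective : Function.Injective (values (dom := dom) (E := E) Set.univ) := by
  rintro ⟨⟨e, he⟩, t⟩ ⟨⟨e', he'⟩, t'⟩ h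
  rw [values_eq_iff] at h
  obtain rfl : e = e' := Finset.ext fun x => (h x trivial).1
  congr 1
  funext x
  exact (h x.1 trivial).2 x.2 x.2

/-- Two tuples agree on their common attributes. -/
def Agree (t t' : RelTuple dom E) : Prop :=
  ∀ (x : V) (h : x ∈ t.1.1) (h' : x ∈ t'.1.1), t.2 ⟨x, h⟩ = t'.2 ⟨x, h'⟩

theorem Agree.eq_of_fst {t t' : RelTuple dom E} (h : Agree t t') (he : t.1 = t'.1) : t = t' := by
  apply values_univ_injective
  rw [values_eq_iff]
  exact fun x _ => ⟨by rw [he], h x⟩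

open Classical in
/-- The level system of the tuples in the edges of `F`: at level `k` tuples are grouped by their
values for the attributes that belong to at least `k` edges. -/
def levels (dom : V → Type*) (E F : Finset (Finset V)) :
    LevelSystem (RelTuple dom E) ((x : V) → Option (dom x)) (Finset V) where
  key k t := values {x | k ≤ (edgesAt F x).card} t
  lab k t := core F k t.1.1
  labs k A := (F.filter fun f => core F (k + 1) f = A).image (core F k)
  carrier := {t | t.1.1 ∈ F}
  key_succ k t t' h := by
    rw [values_eq_iff] at h ⊢
    exact fun x hx => h x (Nat.le_of_succ_le hx)
  lab_of_key k t t' h := by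
    rw [values_eq_iff] at h
    ext x
    rw [mem_core, mem_core]
    exact ⟨fun hx => ⟨(h x hx.2).1.1 hx.1, hx.2⟩, fun hx => ⟨(h x hx.2).1.2 hx.1, hx.2⟩⟩
  lab_mem k t ht := Finset.mem_image.2 ⟨t.1.1, Finset.mem_filter.2 ⟨ht, rfl⟩, rfl⟩
  key_zero_inj t _ t' _ h := values_univ_injective (by simpa using h)

theorem levels_key (F : Finset (Finset V)) (k : ℕ) (t : RelTuple dom E) :
    (levels dom E F).key k t = values {x | k ≤ (edgesAt F x).card} t := rfl

theorem levels_lab (F : Finset (Finset V)) (k : ℕ) (t : RelTuple dom E) :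
    (levels dom E F).lab k t = core F k t.1.1 := rfl

theorem mem_levels_labs {F : Finset (Finset V)} {k : ℕ} {A B : Finset V} :
    B ∈ (levels dom E F).labs k A ↔ ∃ f ∈ F, core F (k + 1) f = A ∧ core F k f = B := by
  simp [levels, and_assoc]

theorem card_levels_labs_le (F : Finset (Finset V)) (k : ℕ) (A : Finset V) :
    ((levels dom E F).labs k A).card ≤ F.card := by
  classical
  exact Finset.card_image_le.trans (Finset.card_le_card (Finset.filter_subset _ _))

theorem levels_key_top {F : Finset (Finset V)} {k : ℕ} (hk : F.card < k) (t t' : RelTuple dom E) :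
    (levels dom E F).key k t = (levels dom E F).key k t' := by
  rw [levels_key, levels_key, values_eq_iff]
  intro x hx
  have h2 := card_edgesAt_le F x
  have : k ≤ (edgesAt F x).card := hx
  omega

/-- Equal labels at level `k` mean that the two tuples have the same attributes there, and agreement
gives them the same values. -/
theorem Agree.coherent {F : Finset (Finset V)} {t t' : RelTuple dom E} (h : Agree t t') :
    (levels dom E F).Coherent t t' := by
  intro k _ hl
  rw [levels_lab, levels_lab] at hl
  rw [levels_key, levels_key, values_eq_iff]
  refine fun x hx => ⟨⟨fun hh => ?_, fun hh => ?_⟩, h x⟩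
  · exact (mem_core.1 (hl ▸ mem_core.2 ⟨hh, hx⟩)).1
  · exact (mem_core.1 (hl ▸ mem_core.2 ⟨hh, hx⟩ : x ∈ core F k t.1.1)).1

theorem mem_edgesAt {F : Finset (Finset V)} {x : V} {e : Finset V} :
    e ∈ edgesAt F x ↔ e ∈ F ∧ x ∈ e := by simp [edgesAt]

/-- In a hierarchical hypergraph, edges with different cores share only attributes of higher
levels. -/
theorem IsHierarchical.lt_card_edgesAt {F : Finset (Finset V)} (hF : IsHierarchical F) {k : ℕ}
    {e e' : Finset V} (he : e ∈ F) (he' : e' ∈ F) (hne : core F k e ≠ core F k e') {x : V}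
    (hx : x ∈ e) (hx' : x ∈ e') : k < (edgesAt F x).card := by
  have key : ∀ e ∈ F, ∀ e' ∈ F, x ∈ e → x ∈ e' → ∀ y ∈ core F k e, y ∉ core F k e' →
      k < (edgesAt F x).card := by
    intro e he e' he' hx hx' y hy hy'
    rw [mem_core] at hy hy'
    have hye' : y ∉ e' := fun h => hy' ⟨h, hy.2⟩
    -- The edges of `x` and `y` meet in `e`, hence are nested; `e'` contains `x` but not `y`, so
    -- those of `y` are strictly fewer.
    have hss : edgesAt F y ⊂ edgesAt F x := by
      rw [Finset.ssubset_iff_subset_ne]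
      refine ⟨?_, fun h => hye' (mem_edgesAt.1 (h ▸ mem_edgesAt.2 ⟨he', hx'⟩)).2⟩
      rcases hF x y with h | h | h
      · exact absurd (mem_edgesAt.1 (h (mem_edgesAt.2 ⟨he', hx'⟩))).2 hye'
      · exact h
      · exact absurd (mem_edgesAt.2 ⟨he, hy.1⟩)
          (Finset.disjoint_left.1 h (mem_edgesAt.2 ⟨he, hx⟩))
    exact hy.2.trans_lt (Finset.card_lt_card hss)
  by_contra hlt
  refine hne (Finset.ext fun y => ⟨fun hy => ?_, fun hy => ?_⟩)
  · by_contra hy'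
    exact hlt (key e he e' he' hx hx' y hy hy')
  · by_contra hy'
    exact hlt (key e' he' e he hx' hx y hy hy')

/-- Take the least level at which the two tuples share a group; it exists as keys above `F.card` are
trivial. At level `0` they coincide. At level `j + 1` coherence makes their labels at `j` differ, so
by `IsHierarchical.lt_card_edgesAt` every common attribute lies in more than `j` edges and is part
of the shared key. -/
theorem IsHierarchical.agree_of_coherent {F : Finset (Finset V)} (hF : IsHierarchical F)
    {t t' : RelTuple dom E} (ht : t.1.1 ∈ F) (ht' : t'.1.1 ∈ F)
    (h : (levels dom E F).Coherent t t') : Agree t t' := by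
  classical
  have hex : ∃ k, (levels dom E F).key k t = (levels dom E F).key k t' :=
    ⟨_, levels_key_top (Nat.lt_succ_self _) t t'⟩
  have hk := Nat.find_spec hex
  rcases h0 : Nat.find hex with _ | j
  · rw [h0] at hk
    have := (levels dom E F).key_zero_inj t ht t' ht' hk
    subst this
    exact fun _ _ _ => rfl
  · rw [h0] at hk
    have hj : (levels dom E F).key j t ≠ (levels dom E F).key j t' :=
      Nat.find_min hex (by omega)
    have hl := fun hl => hj (h j hk hl)
    rw [levels_lab, levels_lab] at hl
    intro x hx hx'
    rw [levels_key, levels_key, values_eq_iff] at hk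
    exact (hk x (hF.lt_card_edgesAt ht ht' hl hx hx')).2 hx hx'

/-- Coherent tuples agree, so at most one of them belongs to each edge of `F`. -/
theorem IsHierarchical.card_le_of_coherent {F : Finset (Finset V)} (hF : IsHierarchical F)
    {X : Finset (RelTuple dom E)} (hX : ∀ t ∈ X, t.1.1 ∈ F) :
    ∀ U ⊆ X, (levels dom E F).CoherentSet U → U.card ≤ F.card := by
  intro U hU hc
  refine Finset.card_le_card_of_injOn (fun t => t.1.1) (fun t ht => hX t (hU ht)) ?_
  intro a ha b hb hab
  exact (hF.agree_of_coherent (hX a (hU ha)) (hX b (hU hb)) (hc a ha b hb)).eq_of_fst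
    (Subtype.ext hab)

open Classical in
/-- The part of a tuple over a smaller edge. -/
def RelTuple.part (t : RelTuple dom E) (e : {e // e ∈ E}) : RelTuple dom E :=
  if h : e.1 ⊆ t.1.1 then ⟨e, fun x => t.2 ⟨x.1, h x.2⟩⟩ else t

theorem RelTuple.part_of_subset {t : RelTuple dom E} {e : {e // e ∈ E}} (h : e.1 ⊆ t.1.1) :
    t.part e = ⟨e, fun x => t.2 ⟨x.1, h x.2⟩⟩ := dif_pos h

theorem RelTuple.eq_part_iff {t a : RelTuple dom E} {e : {e // e ∈ E}} (h : e.1 ⊆ t.1.1)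
    (ha : a.1 = e) : a = t.part e ↔ values (e.1 : Set V) a = values (e.1 : Set V) t := by
  obtain ⟨e', a⟩ := a
  obtain rfl : e' = e := ha
  rw [RelTuple.part_of_subset h, values_eq_iff]
  constructor
  · intro he x hx
    obtain rfl : a = _ := eq_of_heq (Sigma.mk.inj he).2
    exact ⟨⟨fun hh => h hh, fun _ => hx⟩, fun h1 h2 => rfl⟩
  · intro he
    have ha : a = fun x : {x // x ∈ e'.1} => t.2 ⟨x.1, h x.2⟩ := funext fun x => (he x.1 x.2).2 x.2 (h x.2)
    rw [ha]

open Classical in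
/-- The tuples over the edges in `F` of which all parts are input tuples. -/
def fullTuples (F : Finset (Finset V)) (X : Finset (RelTuple dom E)) : Finset (RelTuple dom E) :=
  X.filter fun t => t.1.1 ∈ F ∧ ∀ e : {e // e ∈ E}, e.1 ⊆ t.1.1 → t.part e ∈ X

theorem mem_fullTuples {F : Finset (Finset V)} {X : Finset (RelTuple dom E)}
    {t : RelTuple dom E} : t ∈ fullTuples F X ↔
      t ∈ X ∧ t.1.1 ∈ F ∧ ∀ e : {e // e ∈ E}, e.1 ⊆ t.1.1 → t.part e ∈ X := by simp [fullTuples]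

theorem Database.mem_tuples {R : Database dom E} {t : RelTuple dom E} :
    t ∈ R.tuples ↔ t.2 ∈ R t.1 := by simp [Database.tuples]

theorem Database.card_tuples (R : Database dom E) : R.tuples.card = R.inSize := by
  simp [Database.tuples, Database.inSize]

theorem Database.mem_joinResults {R : Database dom E} {s : (e : {e // e ∈ E}) → Tup dom e.1} :
    s ∈ R.joinResults ↔ (∀ e, s e ∈ R e) ∧
      ∀ (e e' : {e // e ∈ E}) (x : V) (hx : x ∈ e.1) (hx' : x ∈ e'.1),
        s e ⟨x, hx⟩ = s e' ⟨x, hx'⟩ := by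
  simp [Database.joinResults]

open Classical in
/-- The tuples of a combination in the relations in `S`. -/
def subResult (s : (e : {e // e ∈ E}) → Tup dom e.1) (S : Finset {e // e ∈ E}) :
    Finset (RelTuple dom E) := S.image fun e => ⟨e, s e⟩

theorem mem_subResult {s : (e : {e // e ∈ E}) → Tup dom e.1} {S : Finset {e // e ∈ E}}
    {t : RelTuple dom E} : t ∈ subResult s S ↔ t.1 ∈ S ∧ s t.1 = t.2 := by
  simp only [subResult, Finset.mem_image]
  constructor
  · rintro ⟨e, he, rfl⟩
    exact ⟨he, rfl⟩
  · rintro ⟨h1, h2⟩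
    exact ⟨t.1, h1, by rw [h2]⟩

open Classical in
/-- The projections of the join results to the relations in `S`. -/
def Database.subResults (R : Database dom E) (S : Finset {e // e ∈ E}) :
    Finset (Finset (RelTuple dom E)) := R.joinResults.image fun s => subResult s S

open Classical in
/-- The edges of `F` as edges of `E`. -/
def subEdges (F : Finset (Finset V)) : Finset {e // e ∈ E} := Finset.univ.filter fun e => e.1 ∈ F

theorem mem_subEdges {F : Finset (Finset V)} {e : {e // e ∈ E}} :
    e ∈ subEdges F ↔ e.1 ∈ F := by simp [subEdges]

/-- The tuples of a join result remain alive and are coherent. -/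
theorem Database.subResult_alive {R : Database dom E} {F : Finset (Finset V)} (hFE : F ⊆ E)
    {s : (e : {e // e ∈ E}) → Tup dom e.1} (hs : s ∈ R.joinResults) (k : ℕ) :
    subResult s (subEdges F) ⊆ (levels dom E F).alive (fullTuples F R.tuples) k ∧
      (levels dom E F).CoherentSet (subResult s (subEdges F)) := by
  rw [Database.mem_joinResults] at hs
  have hag : ∀ t ∈ subResult s (subEdges F), ∀ t' ∈ subResult s (subEdges F), Agree t t' := by
    intro t ht t' ht' x hx hx'
    rw [← (mem_subResult.1 ht).2, ← (mem_subResult.1 ht').2]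
    exact hs.2 _ _ x hx hx'
  refine ⟨LevelSystem.Saturated.subset_alive ?_ ?_, fun t ht t' ht' => (hag t ht t' ht').coherent⟩
  · intro j _ w hw A hA
    obtain ⟨f, hf, h1, h2⟩ := mem_levels_labs.1 hA
    have hmem : (⟨⟨f, hFE hf⟩, s ⟨f, hFE hf⟩⟩ : RelTuple dom E) ∈ subResult s (subEdges F) :=
      mem_subResult.2 ⟨mem_subEdges.2 hf, rfl⟩
    refine ⟨_, hmem, ?_, h2⟩
    rw [levels_key, levels_key, values_eq_iff]
    rw [levels_lab] at h1
    intro x hx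
    refine ⟨⟨fun hh => ?_, fun hh => ?_⟩, hag _ hmem w hw x⟩
    · exact (mem_core.1 (h1 ▸ mem_core.2 ⟨hh, hx⟩ : x ∈ core F (j + 1) w.1.1)).1
    · exact (mem_core.1 (h1.symm ▸ mem_core.2 ⟨hh, hx⟩ : x ∈ core F (j + 1) f)).1
  · intro t ht
    rw [mem_subResult, mem_subEdges] at ht
    refine mem_fullTuples.2 ⟨?_, ht.1, fun e he => ?_⟩
    · rw [Database.mem_tuples, ← ht.2]
      exact hs.1 _
    · rw [RelTuple.part_of_subset he, Database.mem_tuples]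
      convert hs.1 e using 1
      funext x
      simp only [← ht.2]
      exact hs.2 _ _ x.1 (he x.2) x.2

/-- Coherent sets of alive tuples extend to join results. -/
theorem Database.mem_subResults_of_coherent {R : Database dom E} {F : Finset (Finset V)}
    (hred : IsReductionOf F E) (hF : IsHierarchical F) {k : ℕ} (hk : F.card < k)
    {U : Finset (RelTuple dom E)}
    (hU : U ⊆ (levels dom E F).alive (fullTuples F R.tuples) k) (hne : U.Nonempty)
    (hcoh : (levels dom E F).CoherentSet U) :
    ∃ S ⊆ subEdges F, S.card = U.card ∧ U ∈ R.subResults S := by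
  classical
  have hX : ∀ t ∈ fullTuples F R.tuples, t.1.1 ∈ F := fun t ht => (mem_fullTuples.1 ht).2.1
  obtain ⟨t, ht⟩ := hne
  obtain ⟨W, h1, h2, h3, h4, -, h5⟩ := (levels dom E F).exists_saturated hX k (hU ht) hU hcoh
    (fun u _ => levels_key_top hk u t)
  -- Descending from the trivial top level, saturation produces a tuple whose core matches that of
  -- `f` one level lower. At level `0` the core is the whole edge, so the saturated set contains a
  -- tuple over every edge of `F`.
  have hcover : ∀ f ∈ F, ∀ i ≤ k, ∃ w ∈ W, core F (k - i) w.1.1 = core F (k - i) f := by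
    intro f hf i
    induction i with
    | zero =>
      intro _
      obtain ⟨w, hw⟩ := h3
      exact ⟨w, hw, by rw [Nat.sub_zero, core_eq_empty hk, core_eq_empty hk]⟩
    | succ i ih =>
      intro hi
      obtain ⟨w, hw, he⟩ := ih (by omega)
      have hki : k - i = (k - (i + 1)) + 1 := by omega
      obtain ⟨w', hw', -, he'⟩ := h5 (k - (i + 1)) (by omega) w hw (core F (k - (i + 1)) f)
        (mem_levels_labs.2 ⟨f, hf, by rw [levels_lab, ← hki, he], rfl⟩)
      exact ⟨w', hw', he'⟩
  have hw : ∀ f ∈ F, ∃ w ∈ W, w.1.1 = f := by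
    intro f hf
    obtain ⟨w, hw, he⟩ := hcover f hf k le_rfl
    rw [Nat.sub_self, core_zero, core_zero] at he
    exact ⟨w, hw, he⟩
  have hsup : ∀ e : {e // e ∈ E}, ∃ w ∈ W, e.1 ⊆ w.1.1 := by
    intro e
    obtain ⟨f, hf, hef⟩ := hred.exists_superset e.2
    obtain ⟨w, hwW, rfl⟩ := hw f hf
    exact ⟨w, hwW, hef⟩
  choose w hwW hwe using hsup
  have hag : ∀ a ∈ W, ∀ b ∈ W, Agree a b := fun a ha b hb =>
    hF.agree_of_coherent (hX a (h2 ha)) (hX b (h2 hb)) (h4 a ha b hb)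
  -- Edges removed by the reduction are filled with parts of tuples over larger edges; these parts
  -- are input tuples by the definition of `fullTuples`.
  let s : (e : {e // e ∈ E}) → Tup dom e.1 := fun e x => (w e).2 ⟨x.1, hwe e x.2⟩
  have hs : s ∈ R.joinResults := by
    rw [Database.mem_joinResults]
    refine ⟨fun e => ?_, fun e e' x hx hx' => hag _ (hwW e) _ (hwW e') x _ _⟩
    have := (mem_fullTuples.1 (h2 (hwW e))).2.2 e (hwe e)
    rwa [RelTuple.part_of_subset (hwe e), Database.mem_tuples] at this
  have hUW : ∀ u ∈ U, s u.1 = u.2 := by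
    intro u hu
    funext x
    exact hag _ (hwW u.1) _ (h1 hu) x.1 _ x.2
  refine ⟨U.image Sigma.fst, fun e he => ?_, Finset.card_image_of_injOn ?_, ?_⟩
  · obtain ⟨u, hu, rfl⟩ := Finset.mem_image.1 he
    exact mem_subEdges.2 (hX u (h2 (h1 hu)))
  · intro a ha b hb hab
    exact (hag a (h1 ha) b (h1 hb)).eq_of_fst hab
  · refine Finset.mem_image.2 ⟨s, hs, Finset.ext fun a => ?_⟩
    rw [mem_subResult]
    constructor
    · rintro ⟨ha, hsa⟩
      obtain ⟨u, hu, hua⟩ := Finset.mem_image.1 ha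
      have hu2 := hUW u hu
      obtain ⟨e, a⟩ := a
      obtain ⟨e', u'⟩ := u
      simp only at hua
      subst hua
      simp only at hsa hu2
      rw [← hsa, hu2]
      exact hu
    · exact fun ha => ⟨Finset.mem_image_of_mem _ ha, hUW a ha⟩

open Classical in
/-- The number of coherent sets of alive tuples is bounded by the numbers of projections of join
results. -/
theorem Database.card_coherent_le {R : Database dom E} {F : Finset (Finset V)}
    (hred : IsReductionOf F E) (hF : IsHierarchical F) {k : ℕ} (hk : F.card < k) (j : ℕ)
    (t : RelTuple dom E) :
    (((levels dom E F).cohSets ((levels dom E F).alive (fullTuples F R.tuples) k) k t).filter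
      fun U => U.card = j).card ≤
      ∑ S ∈ (subEdges F : Finset {e // e ∈ E}).powersetCard j, (R.subResults S).card := by
  refine (Finset.card_le_card ?_).trans Finset.card_biUnion_le
  intro U hU
  rw [Finset.mem_filter, LevelSystem.mem_cohSets] at hU
  obtain ⟨⟨h1, h2, h3⟩, h4⟩ := hU
  obtain ⟨S, hS, hc, hU⟩ := Database.mem_subResults_of_coherent hred hF hk
    (fun u hu => ((levels dom E F).mem_grp.1 (h1 hu)).1) h2 h3
  exact Finset.mem_biUnion.2 ⟨S, Finset.mem_powersetCard.2 ⟨hS, hc.trans h4⟩, hU⟩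

end Hypergraph

end MPCJoin

end

noncomputable section
namespace MPCJoin

/-! ### Statistics of subsets and delivery of copies -/

section Computation

variable {τ : Type*} {p : ℕ} {I : Set (Fin p → Finset τ)} {cap K : (Fin p → Finset τ) → ℕ}
  {ℓ g d β : ℕ}

theorem Regime.card_allTuples_le (h : Regime I cap ℓ g d β) {D : Fin p → Finset τ} (hD : D ∈ I) :
    (allTuples D).card ≤ p * ℓ := by
  classical
  refine Finset.card_biUnion_le.trans ((Finset.sum_le_sum fun i _ => h.card_le D hD i).trans ?_)
  simp

namespace Protocol

/-- Every server can compute `f` for the tuples in `X D` that it holds initially. -/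
def HomeKnowsOn {α : Type*} (P : Protocol I cap K) (X : (Fin p → Finset τ) → Finset τ)
    (f : (Fin p → Finset τ) → τ → α) : Prop :=
  ∀ i, ∀ D ∈ I, ∀ D' ∈ I, SameView P.msg P.rounds i D D' →
    ∀ t ∈ D i, t ∈ X D → t ∈ X D' → f D t = f D' t

theorem Ext.homeKnowsOn {α : Type*} {P Q : Protocol I cap K} {m : ℕ} (h : Ext P Q m)
    {X : (Fin p → Finset τ) → Finset τ} {f : (Fin p → Finset τ) → τ → α}
    (hf : P.HomeKnowsOn X f) : Q.HomeKnowsOn X f :=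
  fun i D hD D' hD' hv => hf i D hD D' hD' (h.sameView hv)

-- Extension by zero outside `X` turns partial knowledge into a weight on the whole input, as the
-- prefix primitives require.
open Classical in
theorem HomeKnowsOn.ite {P : Protocol I cap K} {X : (Fin p → Finset τ) → Finset τ}
    {f : (Fin p → Finset τ) → τ → ℕ} (hX : P.HomeKnows fun D t => t ∈ X D)
    (hf : P.HomeKnowsOn X f) : P.HomeKnows fun D t => if t ∈ X D then f D t else 0 := by
  intro i D hD D' hD' hv t ht
  have h1 : (t ∈ X D) = (t ∈ X D') := hX i D hD D' hD' hv t ht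
  beta_reduce
  by_cases h : t ∈ X D
  · rw [if_pos h, if_pos (h1 ▸ h), hf i D hD D' hD' hv t ht h (h1 ▸ h)]
  · rw [if_neg h, if_neg (h1 ▸ h)]

open Classical in
theorem HomeKnows.mem_filter {P : Protocol I cap K} {X : (Fin p → Finset τ) → Finset τ}
    (hX : P.HomeKnows fun D t => t ∈ X D) (q : τ → Prop) :
    P.HomeKnows fun D t => t ∈ (X D).filter q := by
  intro i D hD D' hD' hv t ht
  have h1 : (t ∈ X D) = (t ∈ X D') := hX i D hD D' hD' hv t ht
  simp only [Finset.mem_filter, h1]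

theorem HomeKnows.knows_filter {P : Protocol I cap K} {q : (Fin p → Finset τ) → τ → Prop}
    [∀ D, DecidablePred (q D)] (hq : P.HomeKnows q) (j : Fin p) : P.Knows j fun D => (D j).filter (q D) := by
  intro D hD D' hD' hv
  have h := hv.1
  ext t
  simp only [Finset.mem_filter, ← h]
  refine and_congr_right fun ht => ?_
  rw [hq j D hD D' hD' hv t ht]

variable [NeZero p] {X : (Fin p → Finset τ) → Finset τ} {B : ℕ}

open Classical in
theorem sumOn (P : Protocol I cap K) (h : Regime I cap ℓ g d β) {κ : Type*} (key : τ → κ)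
    (hXsub : ∀ D ∈ I, X D ⊆ allTuples D) (hX : P.HomeKnows fun D t => t ∈ X D)
    {f : (Fin p → Finset τ) → τ → ℕ} (hf : P.HomeKnowsOn X f)
    (hB : ∀ D ∈ I, ∑ t ∈ X D, f D t ≤ B) (hK : ∀ D ∈ I, (B + p * ℓ + 1) ^ 2 ≤ K D) :
    ∃ P' : Protocol I cap K, Ext P P' (2 * prefixRounds d) ∧
      P'.HomeKnows (fun D t => ∑ t' ∈ (X D).filter (fun t' => key t' = key t), f D t') := by
  have hsum : ∀ D ∈ I, ∀ q : τ → Prop, ∑ t' ∈ (allTuples D).filter q,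
      (if t' ∈ X D then f D t' else 0) = ∑ t' ∈ (X D).filter q, f D t' := by
    intro D hD q
    rw [← Finset.sum_filter, Finset.filter_filter]
    refine Finset.sum_congr (Finset.ext fun t => ?_) fun _ _ => rfl
    simp only [Finset.mem_filter]
    exact ⟨fun hh => ⟨hh.2.2, hh.2.1⟩, fun hh => ⟨hXsub D hD hh.1, hh.2, hh.1⟩⟩
  obtain ⟨P', h1, h2⟩ := P.groupSum h key (HomeKnowsOn.ite hX hf) (fun D hD => by
    have := hsum D hD fun _ => True
    simp only [Finset.filter_true] at this
    rw [this]
    exact (Nat.pow_le_pow_left (by have := hB D hD; omega) 2).trans (hK D hD))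
  exact ⟨P', h1, h2.congr fun D hD _ t _ => hsum D hD _⟩

open Classical in
theorem prefixOn (P : Protocol I cap K) (h : Regime I cap ℓ g d β) {κ₁ κ₂ : Type*}
    [LinearOrder κ₂] (key₁ : τ → κ₁) (key₂ : τ → κ₂)
    (hXsub : ∀ D ∈ I, X D ⊆ allTuples D) (hX : P.HomeKnows fun D t => t ∈ X D)
    {f : (Fin p → Finset τ) → τ → ℕ} (hf : P.HomeKnowsOn X f)
    (hB : ∀ D ∈ I, ∑ t ∈ X D, f D t ≤ B) (hK : ∀ D ∈ I, (B + p * ℓ + 1) ^ 2 ≤ K D) :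
    ∃ P' : Protocol I cap K, Ext P P' (2 * prefixRounds d) ∧
      P'.HomeKnows (fun D t => ∑ t' ∈ (X D).filter
        (fun t' => key₁ t' = key₁ t ∧ key₂ t' < key₂ t), f D t') := by
  have hsum : ∀ D ∈ I, ∀ q : τ → Prop, ∑ t' ∈ (allTuples D).filter q,
      (if t' ∈ X D then f D t' else 0) = ∑ t' ∈ (X D).filter q, f D t' := by
    intro D hD q
    rw [← Finset.sum_filter, Finset.filter_filter]
    refine Finset.sum_congr (Finset.ext fun t => ?_) fun _ _ => rfl
    simp only [Finset.mem_filter]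
    exact ⟨fun hh => ⟨hh.2.2, hh.2.1⟩, fun hh => ⟨hXsub D hD hh.1, hh.2, hh.1⟩⟩
  obtain ⟨P', h1, h2⟩ := P.groupPrefix h key₁ key₂ (HomeKnowsOn.ite hX hf) (fun D hD => by
    have := hsum D hD fun _ => True
    simp only [Finset.filter_true] at this
    rw [this]
    exact (Nat.pow_le_pow_left (by have := hB D hD; omega) 2).trans (hK D hD))
  exact ⟨P', h1, h2.congr fun D hD _ t _ => by convert hsum D hD _⟩

/-- Every server can learn for its tuples in `X` whether there is a tuple in `Y` with the same
key. -/
theorem existsOn (P : Protocol I cap K) (h : Regime I cap ℓ g d β) {κ : Type*} (key : τ → κ)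
    (hXsub : ∀ D ∈ I, X D ⊆ allTuples D) (hX : P.HomeKnows fun D t => t ∈ X D)
    (hK : ∀ D ∈ I, (p * ℓ + p * ℓ + 1) ^ 2 ≤ K D) :
    ∃ P' : Protocol I cap K, Ext P P' (2 * prefixRounds d) ∧
      P'.HomeKnows (fun D t => ∃ t' ∈ X D, key t' = key t) := by
  classical
  obtain ⟨P', h1, h2⟩ := P.sumOn h key hXsub hX (f := fun _ _ => 1) (fun _ _ _ _ _ _ _ _ _ _ => rfl)
    (fun D hD => by
      simpa using (Finset.card_le_card (hXsub D hD)).trans (h.card_allTuples_le hD)) hK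
  refine ⟨P', h1, (h2.comp fun _ n => n ≠ 0).congr fun D hD _ t _ => ?_⟩
  simp [Finset.filter_eq_empty_iff]

/-- Copies of tuples are sent to where they are requested: every server receives `part t` for the
tuples `t` in `X` that it holds initially. -/
theorem copy (P : Protocol I cap K) (h : Regime I cap ℓ g d β) {κ : Type*} (key : τ → κ)
    (part : τ → τ) {Y : (Fin p → Finset τ) → Finset τ}
    (hXsub : ∀ D ∈ I, X D ⊆ allTuples D) (hX : P.HomeKnows fun D t => t ∈ X D)
    (hYsub : ∀ D ∈ I, Y D ⊆ allTuples D) (hY : P.HomeKnows fun D t => t ∈ Y D)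
    (hpart : ∀ D ∈ I, ∀ t ∈ X D, part t ∈ Y D ∧ key (part t) = key t)
    (hinj : ∀ D ∈ I, ∀ y ∈ Y D, ∀ y' ∈ Y D, key y = key y' → y = y')
    (hK : ∀ D ∈ I, (p * ℓ + p * ℓ + 1) ^ 2 ≤ K D) :
    ∃ P' : Protocol I cap K, Ext P P' (6 * prefixRounds d + 3) ∧
      ∀ D ∈ I, ∀ i, ∀ t ∈ D i, t ∈ X D → P'.Holds D i (part t) := by
  classical
  let _ : LinearOrder κ := IsWellOrder.linearOrder WellOrderingRel
  let _ : LinearOrder τ := IsWellOrder.linearOrder WellOrderingRel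
  have hℓ := h.pos
  have hB : ∀ D ∈ I, ∑ t ∈ X D, 1 ≤ p * ℓ := fun D hD => by
    simpa using (Finset.card_le_card (hXsub D hD)).trans (h.card_allTuples_le hD)
  have hone : ∀ P : Protocol I cap K, P.HomeKnowsOn X fun _ _ => 1 :=
    fun _ _ _ _ _ _ _ _ _ _ _ => rfl
  -- Requests are ranked by key, ties broken by an arbitrary order on tuples. The request `t` has
  -- rank `rk`, and all requests with the key of `y` occupy the ranks from `lo` to `lo + mult`.
  let lo : (Fin p → Finset τ) → τ → ℕ := fun D t => ((X D).filter fun t' => key t' < key t).card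
  let mult : (Fin p → Finset τ) → τ → ℕ := fun D t => ((X D).filter fun t' => key t' = key t).card
  let rk : (Fin p → Finset τ) → τ → ℕ := fun D t =>
    ((X D).filter fun t' => toLex (key t', t') < toLex (key t, t)).card
  obtain ⟨P₁, h₁, k₁⟩ := P.sumOn h key hXsub hX (hone _) hB hK
  obtain ⟨P₂, h₂, k₂⟩ := P₁.prefixOn h (fun _ => ()) key hXsub (h₁.homeKnows hX) (hone _) hB hK
  obtain ⟨P₃, h₃, k₃⟩ := P₂.prefixOn h (fun _ => ()) (fun t => toLex (key t, t)) hXsub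
    ((h₁.trans h₂).homeKnows hX) (hone _) hB hK
  have hmult : P₃.HomeKnows mult :=
    ((h₂.trans h₃).homeKnows k₁).congr fun D _ _ t _ => by
      simp only [mult, Finset.sum_const, smul_eq_mul, mul_one]; congr
  have hlo : P₃.HomeKnows lo := (h₃.homeKnows k₂).congr fun D _ _ t _ => by simp [lo]
  have hrk : P₃.HomeKnows rk := k₃.congr fun D _ _ t _ => by simp [rk]
  have hY₃ := ((h₁.trans h₂).trans h₃).homeKnows hY
  have hX₃ := ((h₁.trans h₂).trans h₃).homeKnows hX
  have hlo_le : ∀ D, ∀ t ∈ X D, lo D t ≤ rk D t := by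
    intro D t _
    refine Finset.card_le_card fun t' ht' => ?_
    rw [Finset.mem_filter] at ht' ⊢
    exact ⟨ht'.1, Prod.Lex.toLex_lt_toLex.2 (Or.inl ht'.2)⟩
  have hrk_lt : ∀ D, ∀ t ∈ X D, rk D t < lo D t + mult D t := by
    intro D t ht
    rw [← Finset.card_union_of_disjoint]
    · refine Finset.card_lt_card ((Finset.ssubset_iff_of_subset fun t' ht' => ?_).2 ⟨t, ?_, ?_⟩)
      · rw [Finset.mem_filter, Prod.Lex.toLex_lt_toLex] at ht'
        rw [Finset.mem_union, Finset.mem_filter, Finset.mem_filter]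
        exact ht'.2.imp (fun hh => ⟨ht'.1, hh⟩) fun hh => ⟨ht'.1, hh.1⟩
      · simp [ht]
      · simp
    · rw [Finset.disjoint_filter]
      exact fun _ _ h1 h2 => h1.ne h2
  have hrange : ∀ D, ∀ y y', key y < key y' → lo D y + mult D y ≤ lo D y' := by
    intro D y y' hlt
    rw [← Finset.card_union_of_disjoint]
    · refine Finset.card_le_card fun t' ht' => ?_
      rw [Finset.mem_union, Finset.mem_filter, Finset.mem_filter] at ht'
      rw [Finset.mem_filter]
      rcases ht' with ht' | ht'
      · exact ⟨ht'.1, ht'.2.trans hlt⟩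
      · exact ⟨ht'.1, ht'.2.trans_lt hlt⟩
    · rw [Finset.disjoint_filter]
      exact fun _ _ h1 h2 => h1.ne h2
  have hrk_inj : ∀ D, ∀ t ∈ X D, ∀ t' ∈ X D, rk D t = rk D t' → t = t' := by
    have hmono : ∀ D, ∀ t ∈ X D, ∀ t', toLex (key t, t) < toLex (key t', t') → rk D t < rk D t' := by
      intro D t ht t' hlt
      refine Finset.card_lt_card ((Finset.ssubset_iff_of_subset fun a ha => ?_).2 ⟨t, ?_, ?_⟩)
      · rw [Finset.mem_filter] at ha ⊢
        exact ⟨ha.1, ha.2.trans hlt⟩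
      · exact Finset.mem_filter.2 ⟨ht, hlt⟩
      · simp
    intro D t ht t' ht' he
    rcases lt_trichotomy (toLex (key t, t)) (toLex (key t', t')) with hlt | heq | hgt
    · exact absurd he (hmono D t ht t' hlt).ne
    · exact congrArg Prod.snd (toLex.injective heq)
    · exact absurd he (hmono D t' ht' t hgt).ne'
  have hpart' : ∀ D ∈ I, ∀ t ∈ X D, lo D (part t) ≤ rk D t ∧
      rk D t < lo D (part t) + mult D (part t) := by
    intro D hD t ht
    have e1 : lo D (part t) = lo D t := by simp only [lo, (hpart D hD t ht).2]
    have e2 : mult D (part t) = mult D t := by simp only [mult, (hpart D hD t ht).2]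
    rw [e1, e2]
    exact ⟨hlo_le D t ht, hrk_lt D t ht⟩
  have hcap : ∀ D ∈ I, ℓ ≤ cap D := fun D hD => by have := h.le_cap hD; omega
  -- Server `i` handles the ranks in the `i`-th interval of length `ℓ`. The tuple `y` goes to every
  -- server whose interval meets its range of requests. The ranges of different tuples are disjoint,
  -- so a server receives at most `ℓ` tuples however popular `y` is.
  let qA : Fin p → (Fin p → Finset τ) → τ → Prop := fun i D y =>
    y ∈ Y D ∧ ∃ r, lo D y ≤ r ∧ r < lo D y + mult D y ∧ r / ℓ = i.val
  have hqA : ∀ i, P₃.HomeKnows (qA i) := fun i =>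
    (hY₃.comp₂ (hlo.comp₂ hmult fun _ a b => (a, b)) fun _ a b =>
      a ∧ ∃ r, b.1 ≤ r ∧ r < b.1 + b.2 ∧ r / ℓ = i.val)
  obtain ⟨P₄, h₄, k₄, g₄⟩ := P₃.send (fun D j i => ((D j).filter (qA i D)).image Sum.inl)
    (fun j i => ((hqA i).knows_filter j).comp fun s => s.image Sum.inl)
    (by
      intro D hD j i x hx
      obtain ⟨y, hy, he⟩ := Finset.mem_image.1 hx
      rw [← Sum.inl.inj he]
      exact Or.inl (Finset.mem_filter.1 hy).1)
    (by
      intro D hD i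
      refine le_trans ?_ (hcap D hD)
      calc ∑ j, (((D j).filter (qA i D)).image (Sum.inl : τ → τ ⊕ ℕ)).card
          ≤ ∑ j, ((D j).filter (qA i D)).card := Finset.sum_le_sum fun j _ => Finset.card_image_le
        _ = (Finset.univ.biUnion fun j => (D j).filter (qA i D)).card := by
            rw [Finset.card_biUnion]
            intro j _ j' _ hne
            exact Finset.disjoint_filter_filter (h.disjoint D hD j j' hne)
        _ ≤ (Finset.Ico (i.val * ℓ) ((i.val + 1) * ℓ)).card := by
            have hch : ∀ y ∈ (Finset.univ.biUnion fun j => (D j).filter (qA i D)),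
                y ∈ Y D ∧ ∃ r, lo D y ≤ r ∧ r < lo D y + mult D y ∧ r / ℓ = i.val := by
              intro y hy
              obtain ⟨j, -, hy⟩ := Finset.mem_biUnion.1 hy
              exact (Finset.mem_filter.1 hy).2
            choose! hyY r hr1 hr2 hr3 using hch
            refine Finset.card_le_card_of_injOn r (fun y hy => ?_) ?_
            · rw [Finset.mem_coe, Finset.mem_Ico, ← hr3 y hy]
              exact ⟨Nat.div_mul_le_self _ _, by rw [Nat.succ_mul]; exact Nat.lt_div_mul_add hℓ⟩
            · intro y hy y' hy' he
              have e1 := hr1 y hy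
              have e2 := hr2 y hy
              have e3 := hr1 y' hy'
              have e4 := hr2 y' hy'
              rcases lt_trichotomy (key y) (key y') with hlt | heq | hgt
              · have := hrange D _ _ hlt
                omega
              · exact hinj D hD y (hyY y hy) y' (hyY y' hy') heq
              · have := hrange D _ _ hgt
                omega
        _ = ℓ := by rw [Nat.card_Ico, Nat.succ_mul]; omega)
    (by
      intro D hD j i n hn
      obtain ⟨y, -, he⟩ := Finset.mem_image.1 hn
      exact absurd he (by simp))
  -- The request `t` itself goes to the server that handles its rank; ranks are distinct, so at most
  -- `ℓ` requests arrive there.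
  let qB : Fin p → (Fin p → Finset τ) → τ → Prop := fun i D t => t ∈ X D ∧ rk D t / ℓ = i.val
  have hqB : ∀ i, P₄.HomeKnows (qB i) := fun i =>
    h₄.homeKnows (hX₃.comp₂ hrk fun _ a b => a ∧ b / ℓ = i.val)
  obtain ⟨P₅, h₅, k₅, -⟩ := P₄.send (fun D j i => ((D j).filter (qB i D)).image Sum.inl)
    (fun j i => ((hqB i).knows_filter j).comp fun s => s.image Sum.inl)
    (by
      intro D hD j i x hx
      obtain ⟨y, hy, he⟩ := Finset.mem_image.1 hx
      rw [← Sum.inl.inj he]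
      exact Or.inl (Finset.mem_filter.1 hy).1)
    (by
      intro D hD i
      refine le_trans ?_ (hcap D hD)
      calc ∑ j, (((D j).filter (qB i D)).image (Sum.inl : τ → τ ⊕ ℕ)).card
          ≤ ∑ j, ((D j).filter (qB i D)).card := Finset.sum_le_sum fun j _ => Finset.card_image_le
        _ = (Finset.univ.biUnion fun j => (D j).filter (qB i D)).card := by
            rw [Finset.card_biUnion]
            intro j _ j' _ hne
            exact Finset.disjoint_filter_filter (h.disjoint D hD j j' hne)
        _ ≤ (Finset.Ico (i.val * ℓ) ((i.val + 1) * ℓ)).card := by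
            have hch : ∀ y ∈ (Finset.univ.biUnion fun j => (D j).filter (qB i D)),
                y ∈ X D ∧ rk D y / ℓ = i.val := by
              intro y hy
              obtain ⟨j, -, hy⟩ := Finset.mem_biUnion.1 hy
              exact (Finset.mem_filter.1 hy).2
            refine Finset.card_le_card_of_injOn (rk D) (fun y hy => ?_) ?_
            · rw [Finset.mem_coe, Finset.mem_Ico, ← (hch y hy).2]
              exact ⟨Nat.div_mul_le_self _ _, by rw [Nat.succ_mul]; exact Nat.lt_div_mul_add hℓ⟩
            · intro y hy y' hy' he
              exact hrk_inj D y (hch y hy).1 y' (hch y' hy').1 he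
        _ = ℓ := by rw [Nat.card_Ico, Nat.succ_mul]; omega)
    (by
      intro D hD j i n hn
      obtain ⟨y, -, he⟩ := Finset.mem_image.1 hn
      exact absurd he (by simp))
  have hserver : ∀ D ∈ I, ∀ t ∈ X D, ∃ i : Fin p, rk D t / ℓ = i.val := by
    intro D hD t ht
    have h1 : rk D t < p * ℓ := by
      have := hB D hD
      rw [Finset.sum_const, smul_eq_mul, mul_one] at this
      refine lt_of_lt_of_le (Finset.card_lt_card ?_) this
      exact (Finset.ssubset_iff_of_subset (Finset.filter_subset _ _)).2 ⟨t, ht, by simp⟩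
    exact ⟨⟨rk D t / ℓ, Nat.div_lt_of_lt_mul (by rwa [mul_comm] at h1)⟩, rfl⟩
  -- The handling server now holds both the request and the requested tuple and returns a copy to
  -- the sender; a server receives no more replies than it has tuples.
  obtain ⟨P₆, h₆, -, g₆⟩ := P₅.send
    (fun D i j => (((D j).filter (qB i D)).image Sum.inl).image (Sum.map part (id : ℕ → ℕ)))
    (fun i j => (k₅ i j).comp fun s => s.image (Sum.map part id))
    (by
      intro D hD i j x hx
      obtain ⟨a, ha, he⟩ := Finset.mem_image.1 hx
      obtain ⟨t, ht, rfl⟩ := Finset.mem_image.1 ha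
      rw [Sum.map_inl, Sum.inl.injEq] at he
      subst he
      obtain ⟨-, htX, hti⟩ := Finset.mem_filter.1 ht
      have hpY := (hpart D hD t htX).1
      obtain ⟨j', hj'⟩ := mem_allTuples.1 (hYsub D hD hpY)
      refine h₅.holds (g₄ D hD j' i _ (Finset.mem_image_of_mem _ (Finset.mem_filter.2
        ⟨hj', hpY, rk D t, (hpart' D hD t htX).1, (hpart' D hD t htX).2, hti⟩))))
    (by
      intro D hD j
      refine le_trans ?_ ((h.card_le D hD j).trans (hcap D hD))
      calc _ ≤ ∑ i, ((D j).filter (qB i D)).card :=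
            Finset.sum_le_sum fun i _ => Finset.card_image_le.trans Finset.card_image_le
        _ = (Finset.univ.biUnion fun i => (D j).filter (qB i D)).card := by
            rw [Finset.card_biUnion]
            intro i _ i' _ hne
            rw [Function.onFun, Finset.disjoint_filter]
            intro t _ h1 h2
            exact hne (Fin.ext (h1.2.symm.trans h2.2))
        _ ≤ (D j).card := Finset.card_le_card
            (Finset.biUnion_subset.2 fun i _ => Finset.filter_subset _ _))
    (by
      intro D hD i j n hn
      obtain ⟨a, ha, he⟩ := Finset.mem_image.1 hn
      obtain ⟨t, ht, rfl⟩ := Finset.mem_image.1 ha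
      exact absurd he (by simp))
  refine ⟨P₆, (((((h₁.trans h₂).trans h₃).trans h₄).trans h₅).trans h₆).weaken (by omega), ?_⟩
  intro D hD j t ht htX
  obtain ⟨i, hi⟩ := hserver D hD t htX
  exact g₆ D hD i j _ (Finset.mem_image.2 ⟨Sum.inl t, Finset.mem_image_of_mem _
    (Finset.mem_filter.2 ⟨ht, htX, hi⟩), rfl⟩)

end Protocol

end Computation

end MPCJoin

end

noncomputable section
namespace MPCJoin

/-! ### Distributed computation of the allocation -/

open Polynomial in
/-- The generating polynomial of the coherent sets in a group. -/
def LevelSystem.poly {τ K Λ : Type*} (S : LevelSystem τ K Λ) (X : Finset τ) (k : ℕ) (t : τ) :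
    ℕ[X] := S.psi X k t Polynomial.X

namespace LevelSystem

variable {τ K Λ : Type*} (S : LevelSystem τ K Λ) {X : Finset τ} {m L k : ℕ}

theorem coeff_poly (t : τ) (j : ℕ) :
    (S.poly X k t).coeff j = ((S.cohSets X k t).filter fun U => U.card = j).card := by
  rw [poly, psi, Polynomial.finsetSum_coeff, Finset.card_filter]
  simp only [Polynomial.coeff_X_pow, eq_comm (a := j)]

theorem coeff_poly_le (t : τ) (j : ℕ) : (S.poly X k t).coeff j ≤ X.card ^ j := by
  classical
  rw [coeff_poly]
  calc _ ≤ (X.powersetCard j).card := by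
        refine Finset.card_le_card fun U hU => ?_
        rw [Finset.mem_filter, mem_cohSets] at hU
        exact Finset.mem_powersetCard.2
          ⟨fun x hx => (S.mem_grp.1 (hU.1.1 hx)).1, hU.2⟩
    _ ≤ X.card ^ j := by rw [Finset.card_powersetCard]; exact Nat.choose_le_pow _ _

variable {S} in
theorem coeff_poly_eq_zero (hm : ∀ U ⊆ X, S.CoherentSet U → U.card ≤ m) (t : τ) {j : ℕ}
    (hj : m < j) : (S.poly X k t).coeff j = 0 := by
  rw [coeff_poly, Finset.card_eq_zero, Finset.filter_eq_empty_iff]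
  intro U hU hc
  rw [mem_cohSets] at hU
  have := hm U (fun x hx => (S.mem_grp.1 (hU.1 hx)).1) hU.2.2
  omega

variable {S} in
theorem weight_eq_sum_coeff (hm : ∀ U ⊆ X, S.CoherentSet U → U.card ≤ m) (t : τ) :
    S.weight X m L k t = ∑ j ∈ Finset.range (m + 1), (S.poly X k t).coeff j * L ^ (m - j) := by
  unfold weight
  rw [← Finset.sum_fiberwise_of_maps_to (s := S.cohSets X k t) (t := Finset.range (m + 1))
    (g := Finset.card)]
  · refine Finset.sum_congr rfl fun j _ => ?_
    rw [coeff_poly, ← smul_eq_mul, ← Finset.sum_const]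
    refine Finset.sum_congr rfl fun U hU => ?_
    rw [(Finset.mem_filter.1 hU).2]
  · intro U hU
    rw [mem_cohSets] at hU
    have := hm U (fun x hx => (S.mem_grp.1 (hU.1 hx)).1) hU.2.2
    simpa [Nat.lt_succ_iff] using this

theorem grp_eq_self (htop : ∀ t t', S.key k t = S.key k t') (t : τ) : S.grp X k t = X := by
  ext a
  rw [mem_grp]
  exact ⟨fun h => h.1, fun h => ⟨h, htop _ _⟩⟩

end LevelSystem

open Polynomial in
/-- The least load that is at least `ℓ` and suffices for results as counted by `ψ`. -/
def levelLoad (p ℓ m : ℕ) (ψ : ℕ[X]) : ℕ :=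
  sInf {L | ℓ ≤ L ∧ ∀ j ∈ Finset.Icc 1 m, ψ.coeff j ≤ 2 ^ m * p * L ^ j}

open Polynomial in
theorem levelLoad_spec {p ℓ m : ℕ} (hp : 0 < p) (ψ : ℕ[X]) : ℓ ≤ levelLoad p ℓ m ψ ∧
    ∀ j ∈ Finset.Icc 1 m, ψ.coeff j ≤ 2 ^ m * p * levelLoad p ℓ m ψ ^ j := by
  refine Nat.sInf_mem (s := {L | ℓ ≤ L ∧ ∀ j ∈ Finset.Icc 1 m, ψ.coeff j ≤ 2 ^ m * p * L ^ j})
    ⟨ℓ + 1 + ∑ j ∈ Finset.Icc 1 m, ψ.coeff j, by omega, fun j hj => ?_⟩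
  have h1 := Finset.single_le_sum (f := fun j => ψ.coeff j) (fun _ _ => Nat.zero_le _) hj
  calc ψ.coeff j ≤ ℓ + 1 + ∑ j ∈ Finset.Icc 1 m, ψ.coeff j := by
        omega
    _ ≤ (ℓ + 1 + ∑ j ∈ Finset.Icc 1 m, ψ.coeff j) ^ j :=
        Nat.le_self_pow (by have := (Finset.mem_Icc.1 hj).1; omega) _
    _ ≤ _ := Nat.le_mul_of_pos_left _ (by positivity)

open Polynomial in
theorem levelLoad_le {p ℓ m L : ℕ} {ψ : ℕ[X]} (h1 : ℓ ≤ L)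
    (h2 : ∀ j ∈ Finset.Icc 1 m, ψ.coeff j ≤ 2 ^ m * p * L ^ j) : levelLoad p ℓ m ψ ≤ L :=
  Nat.sInf_le ⟨h1, h2⟩

section Computation

variable {τ Key Λ : Type*} {p : ℕ} {I : Set (Fin p → Finset τ)}
  {cap K : (Fin p → Finset τ) → ℕ} {ℓ g d β : ℕ}

namespace Protocol

theorem sum_leaders_le [LinearOrder τ] {X : (Fin p → Finset τ) → Finset τ} (h : Regime I cap ℓ g d β) (S : LevelSystem τ Key Λ)
    (hXsub : ∀ D ∈ I, X D ⊆ allTuples D) {D : Fin p → Finset τ} (hD : D ∈ I) (k : ℕ)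
    (q : τ → Prop) [DecidablePred q] {f : τ → ℕ} {B : ℕ} (hf : ∀ t, f t ≤ B) :
    ∑ t ∈ (S.leaders (X D) k).filter q, f t ≤ p * ℓ * B := by
  classical
  calc _ ≤ ∑ t ∈ (S.leaders (X D) k).filter q, B := Finset.sum_le_sum fun t _ => hf t
    _ = ((S.leaders (X D) k).filter q).card * B := by simp
    _ ≤ p * ℓ * B := by
      refine Nat.mul_le_mul_right _ ((Finset.card_le_card ?_).trans (h.card_allTuples_le hD))
      intro t ht
      exact hXsub D hD (S.mem_leaders.1 (Finset.mem_filter.1 ht).1).1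

variable [NeZero p] {X : (Fin p → Finset τ) → Finset τ}

/-- Whether a tuple survives the next removal depends, for each label, on the existence of a
surviving partner, which one call of `existsOn` per label decides. -/
theorem knows_alive (P : Protocol I cap K) (h : Regime I cap ℓ g d β) (S : LevelSystem τ Key Λ)
    {labels : Finset Λ} (hlabels : ∀ k A, S.labs k A ⊆ labels)
    (hXsub : ∀ D ∈ I, X D ⊆ allTuples D) (hX : P.HomeKnows fun D t => t ∈ X D)
    (hK : ∀ D ∈ I, (p * ℓ + p * ℓ + 1) ^ 2 ≤ K D) (k : ℕ) :
    ∃ P' : Protocol I cap K, Ext P P' (k * (labels.card * (2 * prefixRounds d))) ∧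
      P'.HomeKnows fun D t => t ∈ S.alive (X D) k := by
  classical
  induction k with
  | zero => exact ⟨P, Ext.refl P _, hX⟩
  | succ k ih =>
    obtain ⟨P₁, h₁, k₁⟩ := ih
    obtain ⟨P₂, h₂, k₂⟩ := Ext.family P₁ labels (2 * prefixRounds d)
      (fun A P => P.HomeKnows fun D t => ∃ t' ∈ (S.alive (X D) k).filter (fun t' => S.lab k t' = A),
        S.key (k + 1) t' = S.key (k + 1) t)
      (fun A P P' m hP hQ => hP.homeKnows hQ)
      (fun A _ P' m hP => P'.existsOn h (S.key (k + 1))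
        (fun D hD => (Finset.filter_subset _ _).trans ((S.alive_subset _ _).trans (hXsub D hD)))
        (by convert HomeKnows.mem_filter (hP.homeKnows k₁) fun t' => S.lab k t' = A) hK)
    refine ⟨P₂, (h₁.trans h₂).weaken (le_of_eq (by ring)), ?_⟩
    intro i D hD D' hD' hv t ht
    have e1 := h₂.homeKnows k₁ i D hD D' hD' hv t ht
    beta_reduce at e1 ⊢
    rw [LevelSystem.mem_alive_succ, LevelSystem.mem_alive_succ, e1]
    refine propext (and_congr_right fun _ => forall₂_congr fun A hA => ?_)
    have e2 := k₂ A (hlabels _ _ hA) i D hD D' hD' hv t ht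
    simp only [Finset.mem_filter, eq_iff_iff] at e2
    constructor
    · rintro ⟨t', h1, h2, h3⟩
      obtain ⟨a, ⟨ha1, ha2⟩, ha3⟩ := e2.1 ⟨t', ⟨h1, h3⟩, h2⟩
      exact ⟨a, ha1, ha3, ha2⟩
    · rintro ⟨t', h1, h2, h3⟩
      obtain ⟨a, ⟨ha1, ha2⟩, ha3⟩ := e2.2 ⟨t', ⟨h1, h3⟩, h2⟩
      exact ⟨a, ha1, ha3, ha2⟩

variable [LinearOrder τ]

/-- A tuple of `X` is a leader exactly when the number of smaller tuples of `X` in its group, a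
prefix sum inside the group, is zero. -/
theorem knows_leaders (P : Protocol I cap K) (h : Regime I cap ℓ g d β)
    (S : LevelSystem τ Key Λ)
    (hXsub : ∀ D ∈ I, X D ⊆ allTuples D) (hX : P.HomeKnows fun D t => t ∈ X D)
    (hK : ∀ D ∈ I, (p * ℓ + p * ℓ + 1) ^ 2 ≤ K D) (n : ℕ) :
    ∃ P' : Protocol I cap K, Ext P P' (n * (2 * prefixRounds d)) ∧
      ∀ k < n, P'.HomeKnows fun D t => t ∈ S.leaders (X D) k := by
  classical
  obtain ⟨P', h', k'⟩ := Ext.family P (Finset.range n) (2 * prefixRounds d)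
    (fun k P => P.HomeKnows fun D t => t ∈ S.leaders (X D) k)
    (fun A P P' m hP hQ => hP.homeKnows hQ)
    (fun k _ P' m hP => by
      obtain ⟨P₁, h₁, k₁⟩ := P'.prefixOn h (S.key k) (id : τ → τ) hXsub (hP.homeKnows hX)
        (f := fun _ _ => 1) (fun _ _ _ _ _ _ _ _ _ _ => rfl)
        (fun D hD => by
          simpa using (Finset.card_le_card (hXsub D hD)).trans (h.card_allTuples_le hD)) hK
      refine ⟨P₁, h₁, ?_⟩
      intro i D hD D' hD' hv t ht
      have e1 := h₁.homeKnows (hP.homeKnows hX) i D hD D' hD' hv t ht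
      have e2 := k₁ i D hD D' hD' hv t ht
      have e3 : ∀ D : Fin p → Finset τ, t ∈ S.leaders (X D) k ↔ t ∈ X D ∧
          ∑ t' ∈ (X D).filter (fun t' => S.key k t' = S.key k t ∧ id t' < id t), 1 = 0 := by
        intro D
        rw [LevelSystem.mem_leaders]
        simp only [Finset.sum_const, smul_eq_mul, mul_one, Finset.card_eq_zero,
          Finset.filter_eq_empty_iff, id, not_and, not_lt]
      beta_reduce at e1 e2 ⊢
      rw [e3, e3, e1]
      refine propext (and_congr_right fun _ => ?_)
      constructor
      · intro hh; rw [← hh]; convert e2.symm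
      · intro hh; rw [← hh]; convert e2)
  refine ⟨P', by simpa using h', fun k hk => k' k (Finset.mem_range.2 hk)⟩

/-- Every server learns the generating polynomials for its tuples. -/
theorem knows_poly (P : Protocol I cap K) (h : Regime I cap ℓ g d β) (S : LevelSystem τ Key Λ)
    {labels : Finset Λ} (hlabels : ∀ k A, S.labs k A ⊆ labels) {m : ℕ}
    (hXsub : ∀ D ∈ I, X D ⊆ allTuples D) (hXc : ∀ D ∈ I, ∀ t ∈ X D, t ∈ S.carrier)
    (hm : ∀ D ∈ I, ∀ U ⊆ X D, S.CoherentSet U → U.card ≤ m) {n : ℕ}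
    (hlead : ∀ k < n, P.HomeKnows fun D t => t ∈ S.leaders (X D) k)
    (hK : ∀ D ∈ I, ((p * ℓ) * (p * ℓ) ^ m + p * ℓ + 1) ^ 2 ≤ K D) :
    ∃ P' : Protocol I cap K,
      Ext P P' (n * ((labels.card * (m + 1)) * (2 * prefixRounds d))) ∧
      ∀ k ≤ n, P'.HomeKnowsOn X fun D t => S.poly (X D) k t := by
  classical
  induction n with
  | zero =>
    refine ⟨P, Ext.refl P _, fun k hk => ?_⟩
    obtain rfl : k = 0 := by omega
    intro i D hD D' hD' hv t ht h1 h2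
    simp only [LevelSystem.poly]
    rw [LevelSystem.psi_zero (hXc D hD) h1, LevelSystem.psi_zero (hXc D' hD') h2]
  | succ n ih =>
    obtain ⟨P₁, h₁, k₁⟩ := ih fun k hk => hlead k (by omega)
    let Y : Λ → (Fin p → Finset τ) → Finset τ := fun A D =>
      (S.leaders (X D) n).filter fun t => S.lab n t = A
    have hYX : ∀ A D, Y A D ⊆ X D := fun A D t ht =>
      (S.mem_leaders.1 (Finset.mem_filter.1 ht).1).1
    have hY : ∀ A, P₁.HomeKnows fun D t => t ∈ Y A D := fun A => by
      convert HomeKnows.mem_filter (h₁.homeKnows (hlead n (by omega))) fun t => S.lab n t = A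
    obtain ⟨P₂, h₂, k₂⟩ := Ext.family P₁ (labels ×ˢ Finset.range (m + 1)) (2 * prefixRounds d)
      (fun A P => P.HomeKnows fun D t => ∑ t' ∈ (Y A.1 D).filter
        (fun t' => S.key (n + 1) t' = S.key (n + 1) t), (S.poly (X D) n t').coeff A.2)
      (fun A P P' m hP hQ => hP.homeKnows hQ)
      (fun A hA P' _ hP => by
        have hA2 : A.2 ≤ m := by
          have := Finset.mem_range.1 (Finset.mem_product.1 hA).2
          omega
        obtain ⟨P₃, h₃, k₃⟩ := P'.sumOn h (S.key (n + 1)) (X := Y A.1)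
          (B := p * ℓ * (p * ℓ) ^ m) (fun D hD => (hYX _ D).trans (hXsub D hD))
          (hP.homeKnows (hY A.1)) (f := fun D t => (S.poly (X D) n t).coeff A.2)
          (fun i D hD D' hD' hv t ht h1 h2 => by
            have e := hP.homeKnowsOn (k₁ n le_rfl) i D hD D' hD' hv t ht (hYX _ _ h1) (hYX _ _ h2)
            beta_reduce at e ⊢
            rw [e])
          (fun D hD => sum_leaders_le h S hXsub hD n _ fun t =>
            (S.coeff_poly_le t A.2).trans (by
              have hc := (Finset.card_le_card (hXsub D hD)).trans (h.card_allTuples_le hD)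
              have hpos : 0 < p * ℓ := Nat.mul_pos (Nat.pos_of_ne_zero (NeZero.ne p)) h.pos
              exact (Nat.pow_le_pow_left hc _).trans (Nat.pow_le_pow_right hpos hA2))) hK
        exact ⟨P₃, h₃, by convert k₃⟩)
    refine ⟨P₂, (h₁.trans h₂).weaken (le_of_eq ?_), fun k hk => ?_⟩
    · rw [Finset.card_product, Finset.card_range]; ring
    rcases Nat.le_succ_iff.1 hk with hk | rfl
    · exact h₂.homeKnowsOn (k₁ k hk)
    intro i D hD D' hD' hv t ht h1 h2
    have hkids : ∀ D A, S.kids (X D) n t A =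
        (Y A D).filter (fun t' => S.key (n + 1) t' = S.key (n + 1) t) := by
      intro D A
      ext b
      simp only [Y, LevelSystem.mem_kids, Finset.mem_filter]
      tauto
    have hco : ∀ D ∈ I, ∀ A, ∀ j, m < j →
        (∑ b ∈ S.kids (X D) n t A, S.poly (X D) n b).coeff j = 0 := by
      intro D hD A j hj
      rw [Polynomial.finsetSum_coeff]
      exact Finset.sum_eq_zero fun b _ => LevelSystem.coeff_poly_eq_zero (hm D hD) b hj
    have e1 : ∀ A ∈ labels, ∑ b ∈ S.kids (X D) n t A, S.poly (X D) n b =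
        ∑ b ∈ S.kids (X D') n t A, S.poly (X D') n b := by
      intro A hA
      ext j
      by_cases hj : m < j
      · rw [hco D hD A j hj, hco D' hD' A j hj]
      · have := k₂ (A, j) (Finset.mem_product.2 ⟨hA, Finset.mem_range.2 (by omega)⟩)
          i D hD D' hD' hv t ht
        rw [Polynomial.finsetSum_coeff, Polynomial.finsetSum_coeff, hkids, hkids]
        exact this
    have e2 := LevelSystem.one_add_psi_succ (hXc D hD) n t (Polynomial.X : Polynomial ℕ)
    have e3 := LevelSystem.one_add_psi_succ (hXc D' hD') n t (Polynomial.X : Polynomial ℕ)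
    simp only [LevelSystem.poly] at e1 ⊢
    -- Each factor is determined by finitely many coefficient sums, since coefficients above `m`
    -- vanish. So the product formula fixes the polynomial one level up.
    have e4 : (1 : Polynomial ℕ) + S.psi (X D) (n + 1) t Polynomial.X =
        1 + S.psi (X D') (n + 1) t Polynomial.X := by
      rw [e2, e3]
      exact Finset.prod_congr rfl fun A hA => by rw [e1 A (hlabels _ _ hA)]
    ext j
    have := congrArg (fun q => Polynomial.coeff q j) e4
    simpa [Polynomial.coeff_add] using this

variable [LinearOrder Key]

/-- Every server learns the weights and offsets for its tuples. -/
theorem knows_offset (P : Protocol I cap K) (h : Regime I cap ℓ g d β) (S : LevelSystem τ Key Λ)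
    {labels : Finset Λ} (hlabels : ∀ k A, S.labs k A ⊆ labels) {m : ℕ}
    (hXsub : ∀ D ∈ I, X D ⊆ allTuples D) (hXc : ∀ D ∈ I, ∀ t ∈ X D, t ∈ S.carrier)
    (hm : ∀ D ∈ I, ∀ U ⊆ X D, S.CoherentSet U → U.card ≤ m) {n : ℕ}
    (hlead : ∀ k < n, P.HomeKnows fun D t => t ∈ S.leaders (X D) k)
    (hpoly : ∀ k ≤ n, P.HomeKnowsOn X fun D t => S.poly (X D) k t)
    {L : (Fin p → Finset τ) → ℕ} (hL : P.HomeKnowsOn X fun D _ => L D)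
    (hLle : ∀ D ∈ I, L D ≤ p * ℓ)
    (hK : ∀ D ∈ I, (p * ℓ * ((m + 1) * (p * ℓ) ^ m) + p * ℓ + 1) ^ 2 ≤ K D) :
    ∃ P' : Protocol I cap K,
      Ext P P' ((n * labels.card + n) * (2 * prefixRounds d)) ∧
      (∀ k < n, P'.HomeKnowsOn X fun D t => S.labelWeight (X D) m (L D) k t) ∧
      (∀ k < n, P'.HomeKnowsOn X fun D t => S.offset (X D) m (L D) k t) := by
  classical
  have hpos : 0 < p * ℓ := Nat.mul_pos (Nat.pos_of_ne_zero (NeZero.ne p)) h.pos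
  have hwt : ∀ k < n, P.HomeKnowsOn X fun D t => S.weight (X D) m (L D) k t := by
    intro k hk i D hD D' hD' hv t ht h1 h2
    have e1 := hpoly k hk.le i D hD D' hD' hv t ht h1 h2
    have e2 := hL i D hD D' hD' hv t ht h1 h2
    beta_reduce at e1 e2 ⊢
    rw [LevelSystem.weight_eq_sum_coeff (hm D hD), LevelSystem.weight_eq_sum_coeff (hm D' hD'),
      e1, e2]
  have hwle : ∀ D ∈ I, ∀ k t, S.weight (X D) m (L D) k t ≤ (m + 1) * (p * ℓ) ^ m := by
    intro D hD k t
    rw [LevelSystem.weight_eq_sum_coeff (hm D hD)]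
    calc _ ≤ ∑ j ∈ Finset.range (m + 1), (p * ℓ) ^ m := by
          refine Finset.sum_le_sum fun j hj => ?_
          have hj : j ≤ m := by have := Finset.mem_range.1 hj; omega
          have hc := (Finset.card_le_card (hXsub D hD)).trans (h.card_allTuples_le hD)
          calc _ ≤ (p * ℓ) ^ j * (p * ℓ) ^ (m - j) :=
                Nat.mul_le_mul ((S.coeff_poly_le t j).trans (Nat.pow_le_pow_left hc _))
                  (Nat.pow_le_pow_left (hLle D hD) _)
            _ = (p * ℓ) ^ m := by rw [← pow_add, Nat.add_sub_cancel' hj]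
      _ = _ := by simp
  obtain ⟨P₁, h₁, k₁⟩ := Ext.family P (Finset.range n ×ˢ labels) (2 * prefixRounds d)
    (fun A P => P.HomeKnows fun D t => ∑ t' ∈ ((S.leaders (X D) A.1).filter
      fun t => S.lab A.1 t = A.2).filter
      (fun t' => S.key (A.1 + 1) t' = S.key (A.1 + 1) t), S.weight (X D) m (L D) A.1 t')
    (fun A P P' m hP hQ => hP.homeKnows hQ)
    (fun A hA P' _ hP => by
      have hA1 := Finset.mem_range.1 (Finset.mem_product.1 hA).1
      obtain ⟨P₃, h₃, k₃⟩ := P'.sumOn h (S.key (A.1 + 1))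
        (X := fun D => (S.leaders (X D) A.1).filter fun t => S.lab A.1 t = A.2)
        (B := p * ℓ * ((m + 1) * (p * ℓ) ^ m))
        (fun D hD t ht => hXsub D hD (S.mem_leaders.1 (Finset.mem_filter.1 ht).1).1)
        (by convert HomeKnows.mem_filter (hP.homeKnows (hlead A.1 hA1)) fun t => S.lab A.1 t = A.2)
        (f := fun D t => S.weight (X D) m (L D) A.1 t)
        (fun i D hD D' hD' hv t ht h1 h2 =>
          hP.homeKnowsOn (hwt A.1 hA1) i D hD D' hD' hv t ht
            (S.mem_leaders.1 (Finset.mem_filter.1 h1).1).1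
            (S.mem_leaders.1 (Finset.mem_filter.1 h2).1).1)
        (fun D hD => sum_leaders_le h S hXsub hD _ _ (hwle D hD _)) hK
      exact ⟨P₃, h₃, by convert k₃⟩)
  obtain ⟨P₂, h₂, k₂⟩ := Ext.family P₁ (Finset.range n) (2 * prefixRounds d)
    (fun k P => P.HomeKnows fun D t => ∑ t' ∈ (S.leaders (X D) k).filter
      (fun t' => (S.key (k + 1) t', S.lab k t') = (S.key (k + 1) t, S.lab k t) ∧
        S.key k t' < S.key k t), S.weight (X D) m (L D) k t')
    (fun A P P' m hP hQ => hP.homeKnows hQ)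
    (fun k hk P' _ hP => by
      have hk := Finset.mem_range.1 hk
      obtain ⟨P₃, h₃, k₃⟩ := P'.prefixOn h (fun t => (S.key (k + 1) t, S.lab k t)) (S.key k)
        (X := fun D => S.leaders (X D) k)
        (B := p * ℓ * ((m + 1) * (p * ℓ) ^ m))
        (fun D hD t ht => hXsub D hD (S.mem_leaders.1 ht).1)
        ((h₁.trans hP).homeKnows (hlead k hk))
        (f := fun D t => S.weight (X D) m (L D) k t)
        (fun i D hD D' hD' hv t ht h1 h2 =>
          (h₁.trans hP).homeKnowsOn (hwt k hk) i D hD D' hD' hv t ht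
            (S.mem_leaders.1 h1).1 (S.mem_leaders.1 h2).1)
        (fun D hD => by
          have := sum_leaders_le h S hXsub hD k (fun _ => True) (hwle D hD k)
          rwa [Finset.filter_true] at this) hK
      exact ⟨P₃, h₃, by convert k₃⟩)
  refine ⟨P₂, (h₁.trans h₂).weaken (le_of_eq ?_), fun k hk => ?_, fun k hk => ?_⟩
  · rw [Finset.card_product, Finset.card_range]; ring
  · intro i D hD D' hD' hv t ht h1 h2
    funext A
    by_cases hA : A ∈ labels
    · have e := h₂.homeKnows (k₁ (k, A) (Finset.mem_product.2 ⟨Finset.mem_range.2 hk, hA⟩))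
        i D hD D' hD' hv t ht
      have hkids : ∀ D, S.kids (X D) k t A = ((S.leaders (X D) k).filter
          fun t => S.lab k t = A).filter (fun t' => S.key (k + 1) t' = S.key (k + 1) t) := by
        intro D
        ext b
        simp only [LevelSystem.mem_kids, Finset.mem_filter]
        tauto
      simp only [LevelSystem.labelWeight, hkids]
      exact e
    -- Labels outside the finite set `labels` have no groups, so nothing has to be communicated
    -- about them.
    · have hkids : ∀ D ∈ I, S.kids (X D) k t A = ∅ := by
        intro D hD
        refine Finset.eq_empty_of_forall_notMem fun b hb => hA ?_
        rw [LevelSystem.mem_kids] at hb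
        rw [← hb.2.2]
        exact hlabels _ _ (S.lab_mem k b (hXc D hD b (S.mem_leaders.1 hb.1).1))
      simp only [LevelSystem.labelWeight, hkids D hD, hkids D' hD', Finset.sum_empty]
  · intro i D hD D' hD' hv t ht h1 h2
    have e := k₂ k (Finset.mem_range.2 hk) i D hD D' hD' hv t ht
    have hkids : ∀ D, (S.kids (X D) k t (S.lab k t)).filter (fun b => S.key k b < S.key k t) =
        (S.leaders (X D) k).filter (fun t' => (S.key (k + 1) t', S.lab k t') =
          (S.key (k + 1) t, S.lab k t) ∧ S.key k t' < S.key k t) := by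
      intro D
      ext b
      simp only [LevelSystem.mem_kids, Finset.mem_filter, Prod.mk.injEq]
      tauto
    simp only [LevelSystem.offset]
    convert e using 2 <;> convert hkids _

end Protocol

theorem LevelSystem.cells_eq_of_eq [LinearOrder τ] (S : LevelSystem τ Key Λ) {X X' : Finset τ}
    {m L k : ℕ} {t : τ} (h1 : ∀ j < k, S.labelWeight X m L j t = S.labelWeight X' m L j t) :
    S.cells X m L k t = S.cells X' m L k t := by
  cases k with
  | zero => rfl
  | succ k => simp only [cells, radix, h1 k (Nat.lt_succ_self k)]

/-- The cells of a tuple depend on the instance only through the label weights and offsets of its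
own groups, so its home can decide locally where it must be sent. -/
theorem LevelSystem.neededIn_eq_of_eq [LinearOrder τ] [LinearOrder Key] (S : LevelSystem τ Key Λ)
    {X X' : Finset τ} {m L k : ℕ} {t : τ}
    (h1 : ∀ j < k, S.labelWeight X m L j t = S.labelWeight X' m L j t)
    (h2 : ∀ j < k, S.offset X m L j t = S.offset X' m L j t) :
    S.NeededIn X m L k t = S.NeededIn X' m L k t := by
  induction k with
  | zero => rfl
  | succ k ih =>
    have e1 := S.cells_eq_of_eq fun j hj => h1 j (Nat.lt_succ_of_lt hj)
    have e2 := ih (fun j hj => h1 j (Nat.lt_succ_of_lt hj)) fun j hj => h2 j (Nat.lt_succ_of_lt hj)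
    have e3 : S.radix X m L k t = S.radix X' m L k t := by
      funext A
      simp only [radix, h1 k (Nat.lt_succ_self k)]
    have e4 : S.start X m L k t = S.start X' m L k t := by
      simp only [start, h2 k (Nat.lt_succ_self k)]
    funext c
    simp only [NeededIn, e1, e2, e3, e4]

end Computation

end MPCJoin

end

noncomputable section
namespace MPCJoin

/-! ### The join protocol -/

section Join

variable {V : Type*} {dom : V → Type*} {E F : Finset (Finset V)}

theorem RelTuple.part_fst {t : RelTuple dom E} {e : {e // e ∈ E}} (h : e.1 ⊆ t.1.1) :
    (t.part e).1 = e := by rw [RelTuple.part_of_subset h]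

theorem RelTuple.eq_of_values_eq {t t' : RelTuple dom E} {e : {e // e ∈ E}} (h : t.1 = e)
    (h' : t'.1 = e) (he : values (e.1 : Set V) t = values (e.1 : Set V) t') : t = t' := by
  have hs : e.1 ⊆ t'.1.1 := by rw [h']
  rw [(RelTuple.eq_part_iff hs h).2 he, ← (RelTuple.eq_part_iff hs h').2 rfl]

theorem part_mem_iff {X : Finset (RelTuple dom E)} {t : RelTuple dom E} {e : {e // e ∈ E}}
    (h : e.1 ⊆ t.1.1) : t.part e ∈ X ↔
      ∃ a ∈ X, a.1 = e ∧ values (e.1 : Set V) a = values (e.1 : Set V) t := by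
  constructor
  · intro hm
    exact ⟨_, hm, RelTuple.part_fst h, (RelTuple.eq_part_iff h (RelTuple.part_fst h)).1 rfl⟩
  · rintro ⟨a, ha, h1, h2⟩
    rwa [← (RelTuple.eq_part_iff h h1).2 h2]

/-- The tuples that are parts of results that are full on `F`. -/
def liveTuples (F : Finset (Finset V)) (X : Finset (RelTuple dom E)) : Finset (RelTuple dom E) :=
  (levels dom E F).alive (fullTuples F X) (F.card + 1)

open Classical Polynomial in
/-- The generating polynomial of the coherent sets of live tuples. -/
def livePoly (F : Finset (Finset V)) (X : Finset (RelTuple dom E)) : ℕ[X] :=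
  ∑ U ∈ (liveTuples F X).powerset.filter fun U => U.Nonempty ∧ (levels dom E F).CoherentSet U,
    Polynomial.X ^ U.card

theorem liveTuples_subset (X : Finset (RelTuple dom E)) : liveTuples F X ⊆ X :=
  ((levels dom E F).alive_subset _ _).trans fun _ ht => (mem_fullTuples.1 ht).1

theorem mem_of_mem_liveTuples {X : Finset (RelTuple dom E)} {t : RelTuple dom E}
    (ht : t ∈ liveTuples F X) : t.1.1 ∈ F :=
  (mem_fullTuples.1 ((levels dom E F).alive_subset _ _ ht)).2.1

theorem part_mem_of_mem_liveTuples {X : Finset (RelTuple dom E)} {t : RelTuple dom E}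
    (ht : t ∈ liveTuples F X) {e : {e // e ∈ E}} (he : e.1 ⊆ t.1.1) : t.part e ∈ X :=
  (mem_fullTuples.1 ((levels dom E F).alive_subset _ _ ht)).2.2 e he

/-- Above level `F.card` all tuples form one group, so every server with a live tuple knows the same
global polynomial. -/
theorem poly_eq_livePoly (X : Finset (RelTuple dom E)) (t : RelTuple dom E) :
    (levels dom E F).poly (liveTuples F X) (F.card + 1) t = livePoly F X := by
  simp only [LevelSystem.poly, LevelSystem.psi, LevelSystem.cohSets, livePoly,
    (levels dom E F).grp_eq_self (levels_key_top (Nat.lt_succ_self _))]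

/-- The load of the join algorithm up to a constant factor. -/
def joinLoad (F : Finset (Finset V)) (p ℓ : ℕ) (X : Finset (RelTuple dom E)) : ℕ :=
  levelLoad p ℓ F.card (livePoly F X)

/-- The constant factor in the load of the join algorithm. -/
def joinFactor (E F : Finset (Finset V)) : ℕ :=
  (LevelSystem.cellFactor F.card (F.card + 1) * (1 + F.card * 2 ^ F.card) + 1) *
    (E.card * LevelSystem.loadFactor F.card (F.card + 1))

open Classical in
/-- The number of rounds of the join algorithm. -/
def joinRounds (E F : Finset (Finset V)) (d : ℕ) : ℕ :=
  let R := 2 * prefixRounds d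
  let l := (F.biUnion Finset.powerset).card
  let n := F.card + 1
  E.card * R + n * (l * R) + n * R + n * ((l * (F.card + 1)) * R) + (n * l + n) * R +
    E.card * (6 * prefixRounds d + 3) + 1

/-- The load is chosen so that the `j`-th coefficient is at most `2 ^ m * p * L ^ j`. Hence each of
the degrees `1, …, m` contributes at most `2 ^ m * p * L ^ m` to the total weight; there is no
constant term because coherent sets are taken nonempty. -/
theorem cells_le {p ℓ : ℕ} (hp : 0 < p) (hℓ : 0 < ℓ) (hF : IsHierarchical F)
    [LinearOrder (RelTuple dom E)]
    (X : Finset (RelTuple dom E)) (t : RelTuple dom E) :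
    (levels dom E F).cells (liveTuples F X) F.card (joinLoad F p ℓ X) (F.card + 1) t ≤
      LevelSystem.cellFactor F.card (F.card + 1) * (1 + F.card * 2 ^ F.card) * p := by
  set m := F.card with hmdef
  set L := joinLoad F p ℓ X with hL
  have hspec := levelLoad_spec (p := p) (ℓ := ℓ) (m := m) hp (livePoly F X)
  have hLpos : 0 < L := hℓ.trans_le hspec.1
  have hm := hF.card_le_of_coherent (E := E) (dom := dom) (X := liveTuples F X)
    fun t ht => mem_of_mem_liveTuples ht
  have h1 := LevelSystem.cells_mul_le (S := levels dom E F) hLpos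
    (fun t ht => mem_of_mem_liveTuples ht) hm (card_levels_labs_le F) (m + 1) t
  have h2 : (levels dom E F).weight (liveTuples F X) m L (m + 1) t ≤ m * 2 ^ m * p * L ^ m := by
    rw [LevelSystem.weight_eq_sum_coeff hm, Finset.sum_range_succ']
    have h0 : ((levels dom E F).poly (liveTuples F X) (m + 1) t).coeff 0 = 0 := by
      rw [LevelSystem.coeff_poly, Finset.card_eq_zero, Finset.filter_eq_empty_iff]
      intro U hU
      exact (Finset.card_pos.2 (LevelSystem.mem_cohSets _ |>.1 hU).2.1).ne'
    rw [h0, zero_mul, add_zero]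
    calc _ ≤ ∑ j ∈ Finset.range m, 2 ^ m * p * L ^ m := by
          refine Finset.sum_le_sum fun j hj => ?_
          have hj := Finset.mem_range.1 hj
          rw [hmdef, poly_eq_livePoly]
          calc _ ≤ 2 ^ m * p * L ^ (j + 1) * L ^ (m - (j + 1)) :=
                Nat.mul_le_mul_right _ (hspec.2 _ (Finset.mem_Icc.2 ⟨by omega, by omega⟩))
            _ = 2 ^ m * p * L ^ m := by
                rw [mul_assoc, ← pow_add, Nat.add_sub_cancel' (by omega)]
      _ = _ := by simp only [Finset.sum_const, Finset.card_range, smul_eq_mul]; ring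
  have hΛ : 0 < L ^ m := by positivity
  refine Nat.le_of_mul_le_mul_right (h1.trans ?_) hΛ
  calc _ ≤ LevelSystem.cellFactor m (m + 1) * (L ^ m * p + m * 2 ^ m * p * L ^ m) :=
        Nat.mul_le_mul_left _ (Nat.add_le_add (Nat.le_mul_of_pos_right _ hp) h2)
    _ = _ := by ring

variable {p : ℕ} {I : Set (Fin p → Finset (RelTuple dom E))}
  {cap K : (Fin p → Finset (RelTuple dom E)) → ℕ} {ℓ g d β : ℕ}

/-- The value `p * ℓ` is always sufficient, since at most `(p * ℓ) ^ j` sets have `j` elements. This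
keeps the weights, and with them all integers sent, polynomially bounded. -/
theorem joinLoad_le_card (h : Regime I cap ℓ g d β) [NeZero p]
    {D : Fin p → Finset (RelTuple dom E)} (hD : D ∈ I) :
    joinLoad F p ℓ (allTuples D) ≤ p * ℓ := by
  have hp : 0 < p := Nat.pos_of_ne_zero (NeZero.ne p)
  by_cases he : liveTuples F (allTuples D) = ∅
  · refine levelLoad_le (Nat.le_mul_of_pos_left _ hp) fun j hj => ?_
    have : livePoly F (allTuples D) = 0 := by
      unfold livePoly
      refine Finset.sum_eq_zero fun U hU => ?_
      simp only [he, Finset.powerset_empty, Finset.mem_filter, Finset.mem_singleton] at hU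
      simp [hU.1] at hU
    simp [this]
  · obtain ⟨t, -⟩ := Finset.nonempty_iff_ne_empty.2 he
    refine levelLoad_le (Nat.le_mul_of_pos_left _ hp) fun j hj => ?_
    rw [← poly_eq_livePoly _ t]
    calc _ ≤ (liveTuples F (allTuples D)).card ^ j := LevelSystem.coeff_poly_le _ _ _
      _ ≤ (p * ℓ) ^ j := Nat.pow_le_pow_left
          ((Finset.card_le_card (liveTuples_subset _)).trans (h.card_allTuples_le hD)) _
      _ ≤ _ := Nat.le_mul_of_pos_left _ (by positivity)

open Classical in
/-- The cells to which a server has to send a live tuple. -/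
def NeededAt [LinearOrder (RelTuple dom E)] [LinearOrder ((x : V) → Option (dom x))]
    (F : Finset (Finset V)) (ℓ : ℕ) (i : Fin p) (A : Finset (RelTuple dom E))
    (t : RelTuple dom E) : Prop :=
  t ∈ liveTuples F A ∧
    ∃ c < (levels dom E F).cells (liveTuples F A) F.card (joinLoad F p ℓ A) (F.card + 1) t,
      c % p = i.val ∧
      (levels dom E F).NeededIn (liveTuples F A) F.card (joinLoad F p ℓ A) (F.card + 1) t c

namespace Protocol

open Classical in
/-- Every server learns where its live tuples are needed, and receives their parts. -/
theorem exists_joinPlan [LinearOrder (RelTuple dom E)] [LinearOrder ((x : V) → Option (dom x))]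
    [NeZero p] (hF : IsHierarchical F)
    (hne : F.Nonempty) (h : Regime I cap ℓ g d β)
    (hK : ∀ D ∈ I,
      (p * ℓ * ((F.card + 1) * (p * ℓ) ^ F.card) + p * ℓ + 1) ^ 2 ≤ K D) :
    ∃ P : Protocol I cap K, P.rounds + 1 ≤ joinRounds E F d ∧
      (∀ i : Fin p, P.HomeKnows fun D t => NeededAt F ℓ i (allTuples D) t) ∧
      ∀ e : {e // e ∈ E}, ∀ D ∈ I, ∀ i, ∀ t ∈ D i, t ∈ liveTuples F (allTuples D) → e.1 ⊆ t.1.1 →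
        P.Holds D i (t.part e) := by
  have hp : 0 < p := Nat.pos_of_ne_zero (NeZero.ne p)
  have hℓ := h.pos
  set m := F.card with hmdef
  have hm0 : 0 < m := hne.card_pos
  have hY : 0 < p * ℓ := Nat.mul_pos hp hℓ
  have hYm : p * ℓ ≤ p * ℓ * (p * ℓ) ^ m := Nat.le_mul_of_pos_right _ (by positivity)
  have hYm' : p * ℓ * (p * ℓ) ^ m ≤ p * ℓ * ((m + 1) * (p * ℓ) ^ m) :=
    Nat.mul_le_mul_left _ (Nat.le_mul_of_pos_left _ (by omega))
  have hK1 : ∀ D ∈ I, (p * ℓ + p * ℓ + 1) ^ 2 ≤ K D := fun D hD =>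
    (Nat.pow_le_pow_left (by omega) 2).trans (hK D hD)
  have hK2 : ∀ D ∈ I, (p * ℓ * (p * ℓ) ^ m + p * ℓ + 1) ^ 2 ≤ K D := fun D hD =>
    (Nat.pow_le_pow_left (by omega) 2).trans (hK D hD)
  let S := levels dom E F
  let X : (Fin p → Finset (RelTuple dom E)) → Finset (RelTuple dom E) :=
    fun D => liveTuples F (allTuples D)
  let L : (Fin p → Finset (RelTuple dom E)) → ℕ := fun D => joinLoad F p ℓ (allTuples D)
  let labels := F.biUnion Finset.powerset
  have hlabels : ∀ k A, S.labs k A ⊆ labels := by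
    intro k A B hB
    obtain ⟨f, hf, -, rfl⟩ := mem_levels_labs.1 hB
    exact Finset.mem_biUnion.2 ⟨f, hf, Finset.mem_powerset.2 fun x hx => (mem_core.1 hx).1⟩
  have hXall : ∀ D ∈ I, X D ⊆ allTuples D := fun D _ => liveTuples_subset _
  have hXc : ∀ D ∈ I, ∀ t ∈ X D, t ∈ S.carrier := fun D _ t ht => mem_of_mem_liveTuples ht
  have hm : ∀ D ∈ I, ∀ U ⊆ X D, S.CoherentSet U → U.card ≤ m := fun D hD =>
    hF.card_le_of_coherent fun t ht => hXc D hD t ht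
  have hall : ∀ P : Protocol I cap K, P.HomeKnows fun D t => t ∈ allTuples D := by
    intro P i D _ D' _ hv t ht
    exact propext ⟨fun _ => mem_allTuples.2 ⟨i, hv.1 ▸ ht⟩, fun _ => mem_allTuples.2 ⟨i, ht⟩⟩
  let Y : {e // e ∈ E} → (Fin p → Finset (RelTuple dom E)) → Finset (RelTuple dom E) :=
    fun e D => (allTuples D).filter fun t => t.1 = e
  have hof : ∀ (P : Protocol I cap K) (e : {e // e ∈ E}),
      P.HomeKnows fun D t => t ∈ Y e D := fun P e => by
    convert HomeKnows.mem_filter (hall P) fun t => t.1 = e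
  -- the tuples all of whose parts are present
  obtain ⟨P₁, h₁, k₁⟩ := Ext.family (Protocol.nil I cap K) (Finset.univ : Finset {e // e ∈ E})
    (2 * prefixRounds d)
    (fun e P => P.HomeKnows fun D t => ∃ t' ∈ Y e D,
      values (e.1 : Set V) t' = values (e.1 : Set V) t)
    (fun A P P' m hP hQ => hP.homeKnows hQ)
    (fun e _ P' _ _ => P'.existsOn h (values (e.1 : Set V))
      (fun D hD => Finset.filter_subset _ _) (hof P' e) hK1)
  have hfull : P₁.HomeKnows fun D t => t ∈ fullTuples F (allTuples D) := by
    intro i D hD D' hD' hv t ht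
    beta_reduce
    rw [mem_fullTuples, mem_fullTuples]
    have e1 := hall P₁ i D hD D' hD' hv t ht
    beta_reduce at e1
    rw [e1]
    refine propext (and_congr_right fun _ => and_congr_right fun _ =>
      forall₂_congr fun e he => ?_)
    have e2 := k₁ e (Finset.mem_univ _) i D hD D' hD' hv t ht
    simp only [Y, Finset.mem_filter, and_assoc] at e2
    rw [part_mem_iff he, part_mem_iff he, e2]
  obtain ⟨P₂, h₂, k₂⟩ := P₁.knows_alive h S hlabels
    (fun D hD t ht => (mem_fullTuples.1 ht).1) hfull hK1 (m + 1)
  have hX : P₂.HomeKnows fun D t => t ∈ X D := k₂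
  obtain ⟨P₃, h₃, k₃⟩ := P₂.knows_leaders h S hXall hX hK1 (m + 1)
  obtain ⟨P₄, h₄, k₄⟩ := P₃.knows_poly h S hlabels hXall hXc hm k₃ hK2
  -- The load parameter is a function of the top-level polynomial, so every home of a live tuple can
  -- compute it.
  have hL : P₄.HomeKnowsOn X fun D _ => L D := by
    intro i D hD D' hD' hv t ht h1 h2
    have e := k₄ (m + 1) le_rfl i D hD D' hD' hv t ht h1 h2
    simp only [X] at e
    rw [hmdef, poly_eq_livePoly, poly_eq_livePoly] at e
    simp only [L, joinLoad, e]
  obtain ⟨P₅, h₅, k₅, k₅'⟩ := P₄.knows_offset h S hlabels hXall hXc hm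
    (fun k hk => h₄.homeKnows (k₃ k hk)) k₄ hL (fun D hD => joinLoad_le_card h hD) hK
  have hL₅ := h₅.homeKnowsOn hL
  have hX₅ : P₅.HomeKnows fun D t => t ∈ X D := ((h₃.trans h₄).trans h₅).homeKnows hX
  -- copies of the parts
  let Z : {e // e ∈ E} → (Fin p → Finset (RelTuple dom E)) → Finset (RelTuple dom E) :=
    fun e D => (X D).filter fun t => e.1 ⊆ t.1.1
  have hZ : ∀ e, P₅.HomeKnows fun D t => t ∈ Z e D := fun e => by
    convert HomeKnows.mem_filter hX₅ fun t => e.1 ⊆ t.1.1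
  have hcopy : ∀ e : {e // e ∈ E}, ∀ P' : Protocol I cap K, ∀ n, Ext P₅ P' n →
      ∃ P'' : Protocol I cap K, Ext P' P'' (6 * prefixRounds d + 3) ∧
        ∀ D ∈ I, ∀ i, ∀ t ∈ D i, t ∈ Z e D → P''.Holds D i (t.part e) := by
    intro e P' n hP
    refine P'.copy h (values (e.1 : Set V)) (fun t => t.part e) (X := Z e) (Y := Y e)
      (fun D hD => (Finset.filter_subset _ _).trans (hXall D hD)) (hP.homeKnows (hZ e))
      (fun D hD => Finset.filter_subset _ _) (hof P' e) ?_ ?_ hK1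
    · intro D hD t ht
      obtain ⟨h1, h2⟩ := Finset.mem_filter.1 ht
      exact ⟨Finset.mem_filter.2 ⟨part_mem_of_mem_liveTuples h1 h2, RelTuple.part_fst h2⟩,
        (RelTuple.eq_part_iff h2 (RelTuple.part_fst h2)).1 rfl⟩
    · intro D hD y hy y' hy' he
      exact RelTuple.eq_of_values_eq (Finset.mem_filter.1 hy).2 (Finset.mem_filter.1 hy').2 he
  obtain ⟨P₆, h₆, k₆⟩ := Ext.family P₅ (Finset.univ : Finset {e // e ∈ E})
    (6 * prefixRounds d + 3)
    (fun e P => ∀ D ∈ I, ∀ i, ∀ t ∈ D i, t ∈ Z e D → P.Holds D i (t.part e))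
    (fun A P P' m hP hQ D hD i t ht htX => hP.holds (hQ D hD i t ht htX))
    (fun e _ P' n hP => hcopy e P' n hP)
  refine ⟨P₆, ?_, ?_, fun e D hD i t ht htX he => k₆ e (Finset.mem_univ _) D hD i t ht
    (Finset.mem_filter.2 ⟨htX, he⟩)⟩
  · have := (((((h₁.trans h₂).trans h₃).trans h₄).trans h₅).trans h₆).le_add
    simp only [Protocol.nil, zero_add, Finset.card_univ, Fintype.card_coe] at this
    exact Nat.succ_le_succ this
  · intro i j D hD D' hD' hv t ht
    have hv := h₆.sameView hv
    have e1 := hX₅ j D hD D' hD' hv t ht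
    beta_reduce at e1
    simp only [NeededAt]
    by_cases htX : t ∈ X D
    · have htX' := e1.mp htX
      have e2 := hL₅ j D hD D' hD' hv t ht htX htX'
      beta_reduce at e2
      have e3 : ∀ k < m + 1, S.labelWeight (X D) m (L D) k t =
          S.labelWeight (X D') m (L D) k t := fun k hk =>
        (k₅ k hk j D hD D' hD' hv t ht htX htX').trans (by rw [e2])
      have e4 : ∀ k < m + 1, S.offset (X D) m (L D) k t =
          S.offset (X D') m (L D) k t := fun k hk =>
        (k₅' k hk j D hD D' hD' hv t ht htX htX').trans (by rw [e2])
      rw [e1, S.cells_eq_of_eq e3, S.neededIn_eq_of_eq e3 e4, e2]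
    · have htX' : t ∉ X D' := fun hh => htX (e1.mpr hh)
      exact propext ⟨fun hh => absurd hh.1 htX, fun hh => absurd hh.1 htX'⟩

open Classical in
/-- The join is computed by sending every live tuple and its parts to the servers of the cells in
which it is needed. -/
theorem exists_join [NeZero p] (hred : IsReductionOf F E) (hF : IsHierarchical F)
    (hne : F.Nonempty) (h : Regime I cap ℓ g d β)
    (hcap : ∀ D ∈ I, joinFactor E F * joinLoad F p ℓ (allTuples D) ≤ cap D)
    (hK : ∀ D ∈ I,
      (p * ℓ * ((F.card + 1) * (p * ℓ) ^ F.card) + p * ℓ + 1) ^ 2 ≤ K D) :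
    ∃ P : Protocol I cap K, P.rounds ≤ joinRounds E F d ∧
      ∀ D ∈ I, ∀ R : Database dom E, (∀ t, t ∈ R.tuples ↔ t ∈ allTuples D) →
        ∀ s ∈ R.joinResults, ∃ i, ∀ e, P.Holds D i ⟨e, s e⟩ := by
  let _ : LinearOrder (RelTuple dom E) := IsWellOrder.linearOrder WellOrderingRel
  let _ : LinearOrder ((x : V) → Option (dom x)) := IsWellOrder.linearOrder WellOrderingRel
  have hp : 0 < p := Nat.pos_of_ne_zero (NeZero.ne p)
  have hℓ := h.pos
  set m := F.card with hmdef
  have hm0 : 0 < m := hne.card_pos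
  let S := levels dom E F
  let X : (Fin p → Finset (RelTuple dom E)) → Finset (RelTuple dom E) :=
    fun D => liveTuples F (allTuples D)
  let L : (Fin p → Finset (RelTuple dom E)) → ℕ := fun D => joinLoad F p ℓ (allTuples D)
  have hXall : ∀ D ∈ I, X D ⊆ allTuples D := fun D _ => liveTuples_subset _
  have hXc : ∀ D ∈ I, ∀ t ∈ X D, t ∈ S.carrier := fun D _ t ht => mem_of_mem_liveTuples ht
  have hm : ∀ D ∈ I, ∀ U ⊆ X D, S.CoherentSet U → U.card ≤ m := fun D hD =>
    hF.card_le_of_coherent fun t ht => hXc D hD t ht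
  obtain ⟨P₆, h₆, hneed, k₆⟩ := exists_joinPlan (cap := cap) hF hne h hK
  let need : Fin p → (Fin p → Finset (RelTuple dom E)) → RelTuple dom E → Prop := fun i D t =>
    NeededAt F ℓ i (allTuples D) t
  have hcells : ∀ D t, S.cells (X D) m (L D) (m + 1) t ≤
      LevelSystem.cellFactor m (m + 1) * (1 + m * 2 ^ m) * p := fun D t => cells_le hp hℓ hF _ t
  have hload : ∀ D ∈ I, ∀ i : Fin p, (∑ j, ((D j).filter (need i D)).card) * E.card ≤
      cap D := by
    intro D hD i
    refine le_trans ?_ (hcap D hD)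
    have hLpos : 0 < L D := hℓ.trans_le (levelLoad_spec hp _).1
    set C := LevelSystem.cellFactor m (m + 1) * (1 + m * 2 ^ m)
    have e1 : ∑ j, ((D j).filter (need i D)).card ≤ ((X D).filter (need i D)).card := by
      rw [← Finset.card_biUnion]
      · refine Finset.card_le_card (Finset.biUnion_subset.2 fun j _ t ht => ?_)
        have := (Finset.mem_filter.1 ht).2
        exact Finset.mem_filter.2 ⟨this.1, this⟩
      · intro j _ j' _ hne
        exact Finset.disjoint_filter_filter (h.disjoint D hD j j' hne)
    -- Cells are assigned cyclically, so server `i` has the cells `i + p * a`, and the bound on the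
    -- number of cells leaves at most `C + 1` values of `a`.
    have e2 : (X D).filter (need i D) ⊆ (Finset.range (C + 1)).biUnion fun a =>
        (X D).filter fun t => S.NeededIn (X D) m (L D) (m + 1) t (i.val + p * a) := by
      intro t ht
      obtain ⟨htX, -, c, hc, hci, hcn⟩ := Finset.mem_filter.1 ht
      have hc' := hc.trans_le (hcells D t)
      refine Finset.mem_biUnion.2 ⟨c / p, ?_, Finset.mem_filter.2 ⟨htX, ?_⟩⟩
      · rw [Finset.mem_range, Nat.lt_succ_iff]
        exact (Nat.div_lt_of_lt_mul (by rwa [mul_comm] at hc')).le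
      · rw [← hci, Nat.mod_add_div]
        exact hcn
    have e3 : ∀ c, ((X D).filter fun t => S.NeededIn (X D) m (L D) (m + 1) t c).card ≤
        LevelSystem.loadFactor m (m + 1) * L D := by
      intro c
      rcases (X D).eq_empty_or_nonempty with he | ⟨t, ht⟩
      · rw [he]; simp
      · have := LevelSystem.card_neededIn_le (S := S) hm0 hLpos (hXc D hD) (hm D hD)
          (card_levels_labs_le F) (m + 1) t c
        rw [S.grp_eq_self (levels_key_top (Nat.lt_succ_self _))] at this
        convert this
    calc _ ≤ ((C + 1) * (LevelSystem.loadFactor m (m + 1) * L D)) * E.card := by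
          refine Nat.mul_le_mul_right _ (e1.trans ((Finset.card_le_card e2).trans
            (Finset.card_biUnion_le.trans ((Finset.sum_le_sum fun a _ => e3 _).trans ?_))))
          simp
      _ = _ := by
          simp only [joinFactor, ← hmdef, L, C]
          ring
  obtain ⟨P₇, h₇, -, k₇⟩ := P₆.send
    (fun D j i => ((D j).filter (need i D)).biUnion fun t =>
      (Finset.univ.filter fun e : {e // e ∈ E} => e.1 ⊆ t.1.1).image
        fun e => (Sum.inl (t.part e) : RelTuple dom E ⊕ ℕ))
    (fun j i => ((hneed i).knows_filter j).comp fun s => s.biUnion _)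
    (by
      intro D hD j i x hx
      obtain ⟨t, ht, hx⟩ := Finset.mem_biUnion.1 hx
      obtain ⟨e, he, hx⟩ := Finset.mem_image.1 hx
      obtain ⟨htD, htX, -⟩ := Finset.mem_filter.1 ht
      rw [← Sum.inl.inj hx]
      exact k₆ e D hD j t htD htX (Finset.mem_filter.1 he).2)
    (by
      intro D hD i
      refine le_trans ?_ (hload D hD i)
      rw [Finset.sum_mul]
      refine Finset.sum_le_sum fun j _ => Finset.card_biUnion_le_card_mul _ _ _ fun t _ => ?_
      refine Finset.card_image_le.trans ((Finset.card_le_card (Finset.filter_subset _ _)).trans ?_)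
      simp)
    (by
      intro D hD j i n hn
      obtain ⟨t, -, hx⟩ := Finset.mem_biUnion.1 hn
      obtain ⟨e, -, hx⟩ := Finset.mem_image.1 hx
      exact absurd hx (by simp))
  refine ⟨P₇, ?_, ?_⟩
  · exact h₇.le_add.trans h₆
  · intro D hD R hR s hs
    have hRt : R.tuples = allTuples D := Finset.ext hR
    obtain ⟨h1, h2⟩ := Database.subResult_alive hred.subset hs (m + 1)
    rw [hRt] at h1
    have h1 : subResult s (subEdges F) ⊆ X D := h1
    obtain ⟨f₀, hf₀⟩ := hne
    have hLpos : 0 < L D := hℓ.trans_le (levelLoad_spec hp _).1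
    let t₀ : RelTuple dom E := ⟨⟨f₀, hred.subset hf₀⟩, s ⟨f₀, hred.subset hf₀⟩⟩
    -- The tuples of the result over `F` are live and coherent, so they are all needed in one cell
    -- `c`; its server also receives their parts over the smaller edges.
    obtain ⟨c, hc, hcn⟩ := LevelSystem.exists_cell hLpos (hXc D hD) (hm D hD)
      (card_levels_labs_le F) h1 h2 (m + 1) t₀
    refine ⟨⟨c % p, Nat.mod_lt _ hp⟩, fun e => ?_⟩
    obtain ⟨f, hf, hef⟩ := hred.exists_superset e.2
    let t : RelTuple dom E := ⟨⟨f, hred.subset hf⟩, s ⟨f, hred.subset hf⟩⟩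
    have htm : t ∈ subResult s (subEdges F) := mem_subResult.2 ⟨mem_subEdges.2 hf, rfl⟩
    have htX := h1 htm
    obtain ⟨j, hj⟩ := mem_allTuples.1 (hXall D hD htX)
    have hpe : t.part e = ⟨e, s e⟩ := by
      rw [RelTuple.part_of_subset (show e.1 ⊆ t.1.1 from hef)]
      congr 1
      funext x
      exact (Database.mem_joinResults.1 hs).2 _ _ x.1 (hef x.2) x.2
    rw [← hpe]
    refine k₇ D hD j _ _ (Finset.mem_biUnion.2 ⟨t, Finset.mem_filter.2 ⟨hj, htX, c, ?_, rfl, ?_⟩,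
      Finset.mem_image.2 ⟨e, Finset.mem_filter.2 ⟨Finset.mem_univ _, hef⟩, rfl⟩⟩)
    · rw [S.cells_congr (levels_key_top (Nat.lt_succ_self _) t t₀)]
      exact hc
    · exact hcn t htm (levels_key_top (Nat.lt_succ_self _) t t₀)

end Protocol

end Join

end MPCJoin

end

noncomputable section
namespace MPCJoin

/-! ### From protocols to algorithms with instance-dependent load -/

section Algorithms

variable {V : Type*} {dom : V → Type*} {E F : Finset (Finset V)}

theorem Database.IsEvenDistribution.allTuples_eq {R : Database dom E} {p : ℕ}
    {D : Fin p → Finset (RelTuple dom E)} (h : R.IsEvenDistribution D) :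
    allTuples D = R.tuples := by
  ext t; rw [mem_allTuples, h.covers]

theorem Database.IsEvenDistribution.card_allTuples {R : Database dom E} {p : ℕ}
    {D : Fin p → Finset (RelTuple dom E)} (h : R.IsEvenDistribution D) :
    (allTuples D).card = R.inSize := by rw [h.allTuples_eq, R.card_tuples]

theorem Database.IsEvenDistribution.sum_card {R : Database dom E} {p : ℕ}
    {D : Fin p → Finset (RelTuple dom E)} (h : R.IsEvenDistribution D) :
    ∑ i, (D i).card = R.inSize := by
  rw [← h.card_allTuples, allTuples]
  symm
  convert Finset.card_biUnion fun i _ j _ hij => h.disjoint i j hij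

/-- With few servers, all data can be sent to all servers. -/
theorem exists_broadcastAlgorithm {p : ℕ} (hp : 0 < p) :
    ∃ A : Algorithm (RelTuple dom E) ℕ p, A.rounds ≤ 1 ∧ ∀ R : Database dom E, ∀ D,
      R.IsEvenDistribution D → A.Computes R D ∧ (∀ K, A.IntegersAtMost D K) ∧
        A.load D ≤ R.inSize := by
  classical
  let I : Set (Fin p → Finset (RelTuple dom E)) := {D | ∃ R : Database dom E, R.IsEvenDistribution D}
  obtain ⟨P, hP, -, k⟩ := (Protocol.nil I (fun D => ∑ i, (D i).card) fun _ => 0).send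
    (fun D j _ => (D j).image Sum.inl) (fun j _ => (Protocol.Knows.initial _ j).comp _)
    (by
      intro D _ j i x hx
      obtain ⟨y, hy, he⟩ := Finset.mem_image.1 hx
      rw [← Sum.inl.inj he]
      exact Or.inl hy)
    (fun D _ i => Finset.sum_le_sum fun j _ => Finset.card_image_le)
    (by
      intro D _ j i n hn
      obtain ⟨y, hy, he⟩ := Finset.mem_image.1 hn
      exact absurd he (by simp))
  refine ⟨P.toAlgorithm, hP.le_add, fun R D hR => ?_⟩
  have hD : D ∈ I := ⟨R, hR⟩
  refine ⟨fun s hs => ⟨⟨0, hp⟩, fun e => ?_⟩, fun K t ht i j n hn =>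
    (P.toAlgorithm_integersAtMost hD t ht i j n hn).trans (Nat.zero_le _), ?_⟩
  · rw [P.toAlgorithm_holds hD]
    obtain ⟨j, hj⟩ := (hR.covers ⟨e, s e⟩).1
      (Database.mem_tuples.2 ((Database.mem_joinResults.1 hs).1 e))
    exact k D hD j _ _ (Finset.mem_image_of_mem _ hj)
  · rw [← hR.sum_card]
    exact P.toAlgorithm_load_le hD fun i =>
      Finset.single_le_sum (f := fun i => (D i).card) (fun _ _ => Nat.zero_le _) (Finset.mem_univ i)

theorem coeff_livePoly_le (hred : IsReductionOf F E) (hF : IsHierarchical F) (R : Database dom E)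
    (j : ℕ) : (livePoly F R.tuples).coeff j ≤
      ∑ S ∈ (subEdges F : Finset {e // e ∈ E}).powersetCard j, (R.subResults S).card := by
  classical
  rcases (liveTuples F R.tuples).eq_empty_or_nonempty with he | ⟨t, -⟩
  · have : livePoly F R.tuples = 0 := by
      unfold livePoly
      refine Finset.sum_eq_zero fun U hU => ?_
      simp only [he, Finset.powerset_empty, Finset.mem_filter, Finset.mem_singleton] at hU
      simp [hU.1] at hU
    simp [this]
  · rw [← poly_eq_livePoly _ t, LevelSystem.coeff_poly]
    convert Database.card_coherent_le hred hF (Nat.lt_succ_self _) j t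
    rfl

theorem card_subEdges (h : F ⊆ E) : (subEdges F : Finset {e // e ∈ E}).card = F.card := by
  classical
  rw [← Finset.card_map (Function.Embedding.subtype _)]
  congr 1
  ext f
  simp only [Finset.mem_map, mem_subEdges, Function.Embedding.subtype_apply, Subtype.exists,
    exists_and_left, exists_prop]
  constructor
  · rintro ⟨a, ha, -, rfl⟩; exact ha
  · exact fun hf => ⟨f, hf, h hf, rfl⟩

/-- The `j`-th coefficient is at most the sum of the projection counts over the `j`-element sets of
edges, of which there are at most `2 ^ F.card`. This is the factor allowed for in `levelLoad`. -/
theorem joinLoad_le (hred : IsReductionOf F E) (hF : IsHierarchical F) (R : Database dom E)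
    {p ℓ L : ℕ} {X : ℝ} (hX0 : 0 ≤ X) (hℓ : ℓ ≤ L) (hX : X ≤ L)
    (hq : ∀ S ⊆ (subEdges F : Finset {e // e ∈ E}), S.Nonempty →
      ((R.subResults S).card : ℝ) ≤ p * X ^ S.card) : joinLoad F p ℓ R.tuples ≤ L := by
  refine levelLoad_le hℓ fun j hj => ?_
  have hj1 := (Finset.mem_Icc.1 hj).1
  refine (coeff_livePoly_le hred hF R j).trans ?_
  have h1 : ∀ S ∈ (subEdges F : Finset {e // e ∈ E}).powersetCard j,
      (R.subResults S).card ≤ p * L ^ j := by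
    intro S hS
    obtain ⟨h1, h2⟩ := Finset.mem_powersetCard.1 hS
    have h3 := hq S h1 (Finset.card_pos.1 (by omega))
    rw [h2] at h3
    have h4 : (p : ℝ) * X ^ j ≤ p * (L : ℝ) ^ j := by gcongr
    exact_mod_cast h3.trans h4
  calc _ ≤ ∑ S ∈ (subEdges F : Finset {e // e ∈ E}).powersetCard j, p * L ^ j :=
        Finset.sum_le_sum h1
    _ = (F.card.choose j) * (p * L ^ j) := by
        rw [Finset.sum_const, Finset.card_powersetCard, card_subEdges hred.subset, smul_eq_mul]
    _ ≤ 2 ^ F.card * (p * L ^ j) := Nat.mul_le_mul_right _ (Nat.choose_le_two_pow _ _)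
    _ = _ := by ring

/-- The two bounds of an even distribution differ by at most one. So one more than the number of
tuples on any fixed server bounds the local input everywhere, and the input size need not be known
in advance. -/
theorem Database.IsEvenDistribution.card_le {R : Database dom E} {p : ℕ} (hp : 0 < p)
    {D : Fin p → Finset (RelTuple dom E)} (h : R.IsEvenDistribution D) (i j : Fin p) :
    (D i).card ≤ (D j).card + 1 := by
  have h1 := (h.even i).2
  have h2 := (h.even j).1
  rw [Nat.ceilDiv_eq_add_pred_div] at h1
  have h3 : (R.inSize + p - 1) / p ≤ R.inSize / p + 1 := by
    rw [← Nat.add_div_right _ hp]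
    exact Nat.div_le_div_right (by omega)
  omega

theorem Database.IsEvenDistribution.mul_card_le {R : Database dom E} {p : ℕ} (hp : 0 < p)
    {D : Fin p → Finset (RelTuple dom E)} (h : R.IsEvenDistribution D) (hpN : p ≤ R.inSize)
    (i : Fin p) : p * ((D i).card + 1) ≤ 3 * R.inSize ∧ R.inSize ≤ p * ((D i).card + 1) := by
  have h1 := (h.even i).2
  have h2 := (h.even i).1
  rw [Nat.ceilDiv_eq_add_pred_div] at h1
  have h3 := Nat.div_mul_le_self (R.inSize + p - 1) p
  have h4 := Nat.lt_mul_div_succ R.inSize hp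
  have h5 := Nat.mul_le_mul_left p h1
  have h6 := Nat.mul_le_mul_left p h2
  rw [mul_comm] at h3
  rw [mul_add, mul_one] at h4 ⊢
  omega

/-- The algorithm for many servers, with the parameters of the communication primitives. -/
theorem exists_regularAlgorithm (dom : V → Type*) (hred : IsReductionOf F E)
    (hF : IsHierarchical F) (hne : F.Nonempty)
    {p g d β : ℕ} (hp : 0 < p) (hg : 0 < g) (h1 : p ≤ g ^ d) (h2 : (g + 1) ^ d ≤ β * p)
    (hp3 : F.card + 3 ≤ p) :
    ∃ A : Algorithm (RelTuple dom E) ℕ p, A.rounds ≤ joinRounds E F d + 1 ∧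
      ∀ R : Database dom E, p ≤ R.inSize → p * (2 * g ^ 2) ≤ R.inSize → ∀ D,
        R.IsEvenDistribution D → A.Computes R D ∧
          A.IntegersAtMost D (R.inSize ^ (4 * F.card + 6)) ∧
          ∀ X : ℝ, (R.inSize : ℝ) ≤ p * X →
            (∀ S ⊆ (subEdges F : Finset {e // e ∈ E}), S.Nonempty →
              ((R.subResults S).card : ℝ) ≤ p * X ^ S.card) →
            (A.load D : ℝ) ≤ 3 * (4 * (β + 1) + joinFactor E F : ℕ) * X := by
  classical
  have : NeZero p := ⟨hp.ne'⟩
  let i₀ : Fin p := ⟨0, hp⟩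
  let I : Set (Fin p → Finset (RelTuple dom E)) := {D | ∃ R : Database dom E,
    R.IsEvenDistribution D ∧ p ≤ R.inSize ∧ p * (2 * g ^ 2) ≤ R.inSize}
  -- Server `i₀` can see this value, which serves as `ℓ`; a separate protocol is built for each
  -- value and `exists_glue` combines them.
  let size : Finset (RelTuple dom E) → ℕ := fun A => A.card + 1
  let load : (Fin p → Finset (RelTuple dom E)) → ℕ := fun D =>
    joinLoad F p (size (D i₀)) (allTuples D)
  let cap : (Fin p → Finset (RelTuple dom E)) → ℕ := fun D =>
    (4 * (β + 1) + joinFactor E F) * load D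
  let K : (Fin p → Finset (RelTuple dom E)) → ℕ := fun D =>
    (allTuples D).card ^ (4 * F.card + 6)
  have hsize : ∀ D, size (D i₀) ≤ load D := fun D => (levelLoad_spec hp _).1
  have hcap1 : ∀ D, 4 * (β + 1) * size (D i₀) ≤ cap D := fun D =>
    Nat.mul_le_mul (Nat.le_add_right _ _) (hsize D)
  have hK : ∀ D ∈ I, (p * size (D i₀) * ((F.card + 1) * (p * size (D i₀)) ^ F.card) +
      p * size (D i₀) + 1) ^ 2 ≤ K D := by
    rintro D ⟨R, hR, hpN, -⟩
    have hY := (hR.mul_card_le hp hpN i₀).1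
    set Y := p * size (D i₀) with hYdef
    have hY : Y ≤ 3 * R.inSize := hY
    have hYpos : 0 < Y := Nat.mul_pos hp (Nat.succ_pos _)
    set N := R.inSize
    set m := F.card
    -- Uses `3 ≤ N`. The assumption `F.card + 3 ≤ p ≤ N` serves only to absorb constants into powers
    -- of `N` and so bound the integers by a pure power of the input size.
    have hYN : Y ≤ N ^ 2 := hY.trans (by rw [pow_two]; exact Nat.mul_le_mul_right _ (by omega))
    simp only [K, hR.card_allTuples]
    have hb : Y * ((m + 1) * Y ^ m) + Y + 1 ≤ (m + 3) * Y ^ (m + 1) := by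
      have e1 : Y ≤ Y ^ (m + 1) := Nat.le_self_pow (by omega) _
      have e2 : 1 ≤ Y ^ (m + 1) := Nat.one_le_pow _ _ hYpos
      calc _ = (m + 1) * Y ^ (m + 1) + Y + 1 := by ring
        _ ≤ (m + 1) * Y ^ (m + 1) + Y ^ (m + 1) + Y ^ (m + 1) := by omega
        _ = _ := by ring
    calc _ ≤ ((m + 3) * Y ^ (m + 1)) ^ 2 := Nat.pow_le_pow_left hb 2
      _ ≤ (N * (N ^ 2) ^ (m + 1)) ^ 2 := Nat.pow_le_pow_left
          (Nat.mul_le_mul (by omega) (Nat.pow_le_pow_left hYN _)) 2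
      _ = N ^ (4 * m + 6) := by
          rw [← pow_mul, ← pow_succ', ← pow_mul]
          congr 1
          ring
  have hprot : ∀ ℓ, ∃ P : Protocol {D ∈ I | size (D i₀) = ℓ} cap K, P.rounds ≤ joinRounds E F d ∧
      ∀ D ∈ {D ∈ I | size (D i₀) = ℓ}, ∀ R : Database dom E,
        (∀ t, t ∈ R.tuples ↔ t ∈ allTuples D) →
        ∀ s ∈ R.joinResults, ∃ i, ∀ e, P.Holds D i ⟨e, s e⟩ := by
    intro ℓ
    -- If some input has this value of `ℓ`, then `2 * g ^ 2 ≤ ℓ` follows from that one input;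
    -- otherwise the empty protocol suffices.
    rcases {D ∈ I | size (D i₀) = ℓ}.eq_empty_or_nonempty with hemp | ⟨D₀, ⟨R₀, hR₀, hpN, hgN⟩, hD₀⟩
    · exact ⟨Protocol.nil _ _ _, Nat.zero_le _, fun D hD => by rw [hemp] at hD; exact absurd hD id⟩
    · have hreg : Regime {D ∈ I | size (D i₀) = ℓ} cap ℓ g d β := by
        refine ⟨hg, ?_, h1, h2, ?_, ?_, ?_⟩
        · have := (hR₀.mul_card_le hp hpN i₀).2
          refine Nat.le_of_mul_le_mul_left (hgN.trans (this.trans_eq ?_)) hp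
          rw [← hD₀]
        · rintro D ⟨⟨R, hR, -⟩, -⟩ i j hij
          exact hR.disjoint i j hij
        · rintro D ⟨⟨R, hR, -⟩, hD⟩ i
          rw [← hD]
          exact hR.card_le hp i i₀
        · rintro D ⟨-, hD⟩
          have := hcap1 D
          rwa [hD] at this
      refine Protocol.exists_join hred hF hne hreg ?_ ?_
      · rintro D ⟨-, hD⟩
        rw [← hD]
        exact Nat.mul_le_mul_right _ (Nat.le_add_left _ _)
      · rintro D ⟨hDI, hD⟩
        have := hK D hDI
        rwa [hD] at this
  choose P hPr hPc using hprot
  obtain ⟨Q, hQr, hQ⟩ := Protocol.exists_glue (I := I) (cap := cap) (K := K) i₀ P hPr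
    (fun D _ => le_trans (by simp [size]; nlinarith) (hcap1 D))
    (fun D hD => by
      refine le_trans ?_ (hK D hD)
      have e1 : size (D i₀) ≤ p * size (D i₀) := Nat.le_mul_of_pos_left _ hp
      refine le_trans ?_ (Nat.le_self_pow two_ne_zero _)
      omega)
  refine ⟨Q.toAlgorithm, hQr, fun R hpN hgN D hR => ?_⟩
  have hD : D ∈ I := ⟨R, hR, hpN, hgN⟩
  refine ⟨fun s hs => ?_, ?_, fun X hX hq => ?_⟩
  · obtain ⟨i, hi⟩ := hPc (size (D i₀)) D ⟨hD, rfl⟩ R (fun t => by rw [hR.allTuples_eq]) s hs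
    exact ⟨i, fun e => (Q.toAlgorithm_holds hD i _).2 (hQ D hD i _ (hi e))⟩
  · have := Q.toAlgorithm_integersAtMost hD
    simp only [K, hR.card_allTuples] at this
    exact this
  · have hpR : (0 : ℝ) < p := by exact_mod_cast hp
    have hX1 : 1 ≤ X := by
      have : (p : ℝ) * 1 ≤ p * X := by rw [mul_one]; exact le_trans (by exact_mod_cast hpN) hX
      exact le_of_mul_le_mul_left this hpR
    have hload : load D ≤ max (size (D i₀)) ⌈X⌉₊ := by
      simp only [load, hR.allTuples_eq]
      exact joinLoad_le hred hF R (by linarith) (le_max_left _ _)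
        ((Nat.le_ceil X).trans (by exact_mod_cast le_max_right _ _)) hq
    have hload' : (load D : ℝ) ≤ 3 * X := by
      have e1 : (size (D i₀) : ℝ) ≤ 3 * X := by
        have := (hR.mul_card_le hp hpN i₀).1
        have : (p : ℝ) * size (D i₀) ≤ 3 * R.inSize := by exact_mod_cast this
        refine le_of_mul_le_mul_left ?_ hpR
        linarith
      have e2 : (⌈X⌉₊ : ℝ) ≤ 3 * X := by
        have := Nat.ceil_lt_add_one (show 0 ≤ X by linarith)
        linarith
      calc (load D : ℝ) ≤ ((max (size (D i₀)) ⌈X⌉₊ : ℕ) : ℝ) := by exact_mod_cast hload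
        _ ≤ 3 * X := by rw [Nat.cast_max]; exact max_le e1 e2
    have h0 : Q.toAlgorithm.load D ≤ cap D := Q.toAlgorithm_load_le hD fun i =>
      (hR.card_le hp i i₀).trans (le_trans (Nat.le_mul_of_pos_left _ (by omega)) (hcap1 D))
    calc (Q.toAlgorithm.load D : ℝ) ≤ (cap D : ℝ) := by exact_mod_cast h0
      _ = ((4 * (β + 1) + joinFactor E F : ℕ) : ℝ) * load D := by
          simp only [cap]; push_cast; ring
      _ ≤ ((4 * (β + 1) + joinFactor E F : ℕ) : ℝ) * (3 * X) := by gcongr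
      _ = _ := by ring

end Algorithms

end MPCJoin

end

noncomputable section
namespace MPCJoin

/-! ### Admissible loads: the algorithm and the counting bound -/

section Bounds

variable {V : Type*} {E F : Finset (Finset V)}

theorem Database.card_subResults_le_outSize {dom : V → Type*} (R : Database dom E)
    (S : Finset {e // e ∈ E}) : (R.subResults S).card ≤ R.outSize := by
  classical
  exact Finset.card_image_le

theorem card_subResult {dom : V → Type*} (s : (e : {e // e ∈ E}) → Tup dom e.1)
    (S : Finset {e // e ∈ E}) : (subResult s S).card = S.card := by
  classical
  exact Finset.card_image_of_injective _ fun a b h => congrArg Sigma.fst h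

theorem Database.card_subResults_le_pow {dom : V → Type*} (R : Database dom E)
    (S : Finset {e // e ∈ E}) : (R.subResults S).card ≤ R.inSize ^ S.card := by
  classical
  calc _ ≤ (R.tuples.powersetCard S.card).card := by
        refine Finset.card_le_card fun U hU => ?_
        obtain ⟨s, hs, rfl⟩ := Finset.mem_image.1 hU
        refine Finset.mem_powersetCard.2 ⟨fun t ht => ?_, card_subResult s S⟩
        rw [mem_subResult] at ht
        rw [Database.mem_tuples, ← ht.2]
        exact (Database.mem_joinResults.1 hs).1 _
    _ ≤ R.inSize ^ S.card := by
        rw [Finset.card_powersetCard, R.card_tuples]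
        exact Nat.choose_le_pow _ _

/-- The parameters of the communication primitives for many servers. -/
theorem exists_degree {ε : ℝ} (hε : 0 < ε) : ∃ d p₀ : ℕ, ∀ p : ℕ, p₀ ≤ p → 0 < p →
    ∃ g, 0 < g ∧ p ≤ g ^ d ∧ (g + 1) ^ d ≤ 3 ^ d * p ∧
      ((p * (2 * g ^ 2) : ℕ) : ℝ) ≤ (p : ℝ) ^ (1 + ε) := by
  -- With `g` the rounded-up `d`-th root of `p`, the choice of `d` makes the square of this root at
  -- most `p ^ (ε / 2)`, and `p ≥ p₀` absorbs the factor `8` from rounding into another `p ^ (ε /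
  -- 2)`.
  refine ⟨⌈4 / ε⌉₊, ⌈(8 : ℝ) ^ (2 / ε)⌉₊, fun p hp₀ hp => ?_⟩
  set d := ⌈4 / ε⌉₊ with hd
  have hd0 : 0 < d := Nat.ceil_pos.2 (by positivity)
  have hdR : (0 : ℝ) < d := by exact_mod_cast hd0
  have hd4 : 4 / ε ≤ d := Nat.le_ceil _
  have hp1 : (1 : ℝ) ≤ p := by exact_mod_cast hp
  have hp0 : (0 : ℝ) ≤ p := by linarith
  set x : ℝ := (p : ℝ) ^ (1 / d : ℝ) with hx
  have hx1 : 1 ≤ x := Real.one_le_rpow hp1 (by positivity)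
  have hxd : x ^ d = p := by
    rw [hx, ← Real.rpow_natCast, ← Real.rpow_mul hp0, one_div_mul_cancel hdR.ne', Real.rpow_one]
  have hg1 : x ≤ (⌈x⌉₊ : ℝ) := Nat.le_ceil _
  have hg2 : (⌈x⌉₊ : ℝ) < x + 1 := Nat.ceil_lt_add_one (by linarith)
  refine ⟨⌈x⌉₊, Nat.ceil_pos.2 (by linarith), ?_, ?_, ?_⟩
  · have : (p : ℝ) ≤ (⌈x⌉₊ : ℝ) ^ d := by rw [← hxd]; gcongr
    exact_mod_cast this
  · have : ((⌈x⌉₊ : ℝ) + 1) ^ d ≤ 3 ^ d * p := by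
      rw [← hxd, ← mul_pow]
      gcongr
      linarith
    exact_mod_cast this
  · have e1 : 2 * (⌈x⌉₊ : ℝ) ^ 2 ≤ 8 * x ^ 2 := by nlinarith
    have e2 : x ^ 2 ≤ (p : ℝ) ^ (ε / 2) := by
      rw [hx, ← Real.rpow_natCast, ← Real.rpow_mul hp0]
      refine Real.rpow_le_rpow_of_exponent_le hp1 ?_
      rw [div_le_iff₀ hε] at hd4
      push_cast
      rw [one_div, inv_mul_eq_div, div_le_div_iff₀ hdR two_pos]
      linarith
    have e3 : (8 : ℝ) ≤ (p : ℝ) ^ (ε / 2) := by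
      have : (8 : ℝ) ^ (2 / ε) ≤ p := (Nat.le_ceil _).trans (by exact_mod_cast hp₀)
      calc (8 : ℝ) = ((8 : ℝ) ^ (2 / ε)) ^ (ε / 2) := by
            rw [← Real.rpow_mul (by norm_num)]
            rw [div_mul_div_comm, mul_comm, div_self (by positivity), Real.rpow_one]
        _ ≤ _ := Real.rpow_le_rpow (by positivity) this (by positivity)
    have e4 : (p : ℝ) ^ (1 + ε) = p * ((p : ℝ) ^ (ε / 2) * (p : ℝ) ^ (ε / 2)) := by
      have hp' : (0 : ℝ) < p := by linarith
      rw [← Real.rpow_add hp', Real.rpow_add hp', Real.rpow_one]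
      congr 2
      ring
    rw [e4]
    push_cast
    refine mul_le_mul_of_nonneg_left ?_ hp0
    calc 2 * (⌈x⌉₊ : ℝ) ^ 2 ≤ 8 * x ^ 2 := e1
      _ ≤ 8 * (p : ℝ) ^ (ε / 2) := by linarith
      _ ≤ _ := mul_le_mul_of_nonneg_right e3 (by positivity)

/-- The join algorithm: its load is bounded by every `X` that respects the bounds which hold for
all algorithms by counting. -/
theorem exists_joinAlgorithm (hred : IsReductionOf F E) (hF : IsHierarchical F) {ε : ℝ}
    (hε : 0 < ε) : ∃ (T c : ℕ) (C : ℝ), 0 ≤ C ∧ ∀ dom : V → Type*,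
      ∃ A : (p : ℕ) → Algorithm (RelTuple dom E) ℕ p, ∀ p : ℕ, 0 < p → (A p).rounds ≤ T ∧
        ∀ R : Database dom E, (p : ℝ) ^ (1 + ε) ≤ R.inSize → ∀ D, R.IsEvenDistribution D →
          (A p).Computes R D ∧ (A p).IntegersAtMost D (R.inSize ^ c) ∧
          ∀ X : ℝ, (R.inSize : ℝ) ≤ p * X →
            (∀ S ⊆ (subEdges F : Finset {e // e ∈ E}), S.Nonempty →
              ((R.subResults S).card : ℝ) ≤ p * X ^ S.card) →
            ((A p).load D : ℝ) ≤ C * X := by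
  obtain ⟨d, p₁, hd⟩ := exists_degree hε
  -- Below this bound the number of servers counts as a constant: sending everything everywhere
  -- costs `IN ≤ p * X ≤ p₀ * X`.
  let p₀ := max p₁ (F.card + 3)
  refine ⟨joinRounds E F d + 1, 4 * F.card + 6,
    p₀ + 3 * (4 * (3 ^ d + 1) + joinFactor E F : ℕ), by positivity, fun dom => ?_⟩
  have key : ∀ p : ℕ, ∃ A : Algorithm (RelTuple dom E) ℕ p, 0 < p →
      A.rounds ≤ joinRounds E F d + 1 ∧
        ∀ R : Database dom E, (p : ℝ) ^ (1 + ε) ≤ R.inSize → ∀ D, R.IsEvenDistribution D →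
          A.Computes R D ∧ A.IntegersAtMost D (R.inSize ^ (4 * F.card + 6)) ∧
          ∀ X : ℝ, (R.inSize : ℝ) ≤ p * X →
            (∀ S ⊆ (subEdges F : Finset {e // e ∈ E}), S.Nonempty →
              ((R.subResults S).card : ℝ) ≤ p * X ^ S.card) →
            (A.load D : ℝ) ≤ (p₀ + 3 * (4 * (3 ^ d + 1) + joinFactor E F : ℕ)) * X := by
    intro p
    rcases Nat.eq_zero_or_pos p with rfl | hp
    · exact ⟨(Protocol.nil ∅ (fun _ => 0) fun _ => 0).toAlgorithm, fun h => absurd h (lt_irrefl _)⟩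
    have hp1 : (1 : ℝ) ≤ p := by exact_mod_cast hp
    have hpR : (0 : ℝ) < p := by linarith
    have hX0 : ∀ (R : Database dom E) (X : ℝ), (R.inSize : ℝ) ≤ p * X → 0 ≤ X := by
      intro R X hX
      by_contra hneg
      have := mul_neg_of_pos_of_neg hpR (not_le.1 hneg)
      have := Nat.cast_nonneg (α := ℝ) R.inSize
      linarith
    by_cases hlarge : p₀ ≤ p ∧ F.Nonempty
    · obtain ⟨g, hg, h1, h2, h3⟩ := hd p ((le_max_left _ _).trans hlarge.1) hp
      obtain ⟨A, hA, hA'⟩ := exists_regularAlgorithm dom hred hF hlarge.2 hp hg h1 h2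
        ((le_max_right _ _).trans hlarge.1)
      refine ⟨A, fun _ => ⟨hA, fun R hR D hD => ?_⟩⟩
      have hpN : p ≤ R.inSize := by
        have : (p : ℝ) ≤ (p : ℝ) ^ (1 + ε) := by
          conv_lhs => rw [← Real.rpow_one (p : ℝ)]
          exact Real.rpow_le_rpow_of_exponent_le hp1 (by linarith)
        exact_mod_cast this.trans hR
      obtain ⟨g1, g2, g3⟩ := hA' R hpN (by exact_mod_cast h3.trans hR) D hD
      refine ⟨g1, g2, fun X hX hq => (g3 X hX hq).trans ?_⟩
      have := hX0 R X hX
      refine mul_le_mul_of_nonneg_right ?_ this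
      push_cast
      linarith [Nat.cast_nonneg (α := ℝ) p₀]
    · obtain ⟨A, hA, hA'⟩ := exists_broadcastAlgorithm (dom := dom) (E := E) hp
      refine ⟨A, fun _ => ⟨hA.trans (Nat.le_add_left _ _), fun R hR D hD => ?_⟩⟩
      obtain ⟨g1, g2, g3⟩ := hA' R D hD
      refine ⟨g1, g2 _, fun X hX _ => ?_⟩
      have hX' := hX0 R X hX
      -- The other reason for broadcasting is an empty `F`. Then there are no edges and `IN = 0`,
      -- contradicting `p ^ (1 + ε) ≤ IN`.
      have hpp : p ≤ p₀ := by
        by_contra hpp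
        have hFe : F = ∅ := by
          by_contra hne
          exact hlarge ⟨by omega, Finset.nonempty_iff_ne_empty.2 hne⟩
        have : R.inSize = 0 := by
          refine Finset.sum_eq_zero fun e _ => ?_
          obtain ⟨f, hf, -⟩ := hred.exists_superset e.2
          rw [hFe] at hf
          exact absurd hf (Finset.notMem_empty _)
        rw [this, Nat.cast_zero] at hR
        exact absurd hR (not_le.2 (by positivity))
      calc (A.load D : ℝ) ≤ R.inSize := by exact_mod_cast g3
        _ ≤ p * X := hX
        _ ≤ p₀ * X := by gcongr
        _ ≤ _ := by
          refine mul_le_mul_of_nonneg_right ?_ hX'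
          linarith [Nat.cast_nonneg (α := ℝ) (4 * (3 ^ d + 1) + joinFactor E F)]
  choose A hA using key
  exact ⟨A, fun p hp => hA p hp⟩

/-! ### The counting lower bound -/

theorem Algorithm.card_initial_le {τ B : Type*} {p : ℕ} (A : Algorithm τ B p)
    (D : Fin p → Finset τ) (i : Fin p) : (D i).card ≤ A.tupleLoad D :=
  (Finset.le_sup (f := fun i => (D i).card) (Finset.mem_univ i)).trans (le_max_left _ _)

/-- A server holds few tuples. -/
theorem Algorithm.exists_held {τ B : Type*} {p : ℕ} (A : Algorithm τ B p)
    (D : Fin p → Finset τ) (i : Fin p) (t : ℕ) (ht : t ≤ A.rounds) :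
    ∃ H : Finset τ, (∀ x, (A.view D t i).Holds x → x ∈ H) ∧
      H.card ≤ (t + 1) * A.tupleLoad D := by
  classical
  induction t with
  | zero =>
    refine ⟨D i, ?_, by simpa using A.card_initial_le D i⟩
    rintro x (hx | ⟨r, hr, -⟩)
    · exact hx
    · simp [Algorithm.view] at hr
  | succ t ih =>
    obtain ⟨H, h1, h2⟩ := ih (by omega)
    let G : Fin p → Finset τ := fun j => ((A.message D t j i).filterMap Sum.getLeft?).toFinset
    refine ⟨H ∪ Finset.univ.biUnion G, ?_, ?_⟩
    · intro x hx
      rw [Finset.mem_union, Finset.mem_biUnion]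
      rcases hx with hx | ⟨r, hr, j, hx⟩
      · left
        refine h1 x (Or.inl ?_)
        cases t <;> exact hx
      · simp only [Algorithm.view, List.mem_append, List.mem_singleton] at hr
        rcases hr with hr | rfl
        · exact Or.inl (h1 x (Or.inr ⟨r, hr, j, hx⟩))
        · right
          refine ⟨j, Finset.mem_univ _, List.mem_toFinset.2 (List.mem_filterMap.2 ⟨_, hx, rfl⟩)⟩
    · have h3 : (Finset.univ.biUnion G).card ≤ A.tupleLoad D := by
        calc _ ≤ ∑ j, (G j).card := Finset.card_biUnion_le
          _ ≤ ∑ j, (A.message D t j i).countP Sum.isLeft := by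
              refine Finset.sum_le_sum fun j _ => (List.toFinset_card_le _).trans ?_
              generalize A.message D t j i = l
              induction l with
              | nil => simp
              | cons a l ih =>
                cases a
                · rw [List.filterMap_cons, List.countP_cons]
                  simpa using ih
                · rw [List.filterMap_cons, List.countP_cons]
                  simpa using ih
          _ ≤ A.tupleLoad D := by
              refine le_trans ?_ (le_max_right _ _)
              refine le_trans ?_ (Finset.le_sup (f := fun t => Finset.univ.sup fun i =>
                ∑ j, (A.message D t j i).countP Sum.isLeft) (Finset.mem_range.2 ht))
              exact Finset.le_sup (f := fun i =>
                ∑ j, (A.message D t j i).countP Sum.isLeft) (Finset.mem_univ i)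
      calc _ ≤ H.card + (Finset.univ.biUnion G).card := Finset.card_union_le _ _
        _ ≤ _ := by rw [Nat.succ_mul (t + 1)]; omega

/-- Each projection of a result to `S` is a set of `S.card` tuples held by a single server, and a
server has only that many subsets to offer. Since only the held tuples are counted, side information
does not help. -/
theorem Algorithm.card_subResults_le {dom : V → Type*} {B : Type*} {p : ℕ}
    (A : Algorithm (RelTuple dom E) B p) {R : Database dom E}
    {D : Fin p → Finset (RelTuple dom E)} (hc : A.Computes R D) (S : Finset {e // e ∈ E}) :
    (R.subResults S).card ≤ p * ((A.rounds + 1) * A.tupleLoad D) ^ S.card := by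
  classical
  choose H h1 h2 using fun i => A.exists_held D i A.rounds le_rfl
  calc _ ≤ (Finset.univ.biUnion fun i => (H i).powersetCard S.card).card := by
        refine Finset.card_le_card fun U hU => ?_
        obtain ⟨s, hs, rfl⟩ := Finset.mem_image.1 hU
        obtain ⟨i, hi⟩ := hc s hs
        refine Finset.mem_biUnion.2 ⟨i, Finset.mem_univ _, Finset.mem_powersetCard.2
          ⟨fun t ht => h1 i t ?_, card_subResult s S⟩⟩
        have := hi t.1
        rwa [(mem_subResult.1 ht).2] at this
    _ ≤ ∑ i, ((H i).powersetCard S.card).card := Finset.card_biUnion_le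
    _ ≤ ∑ _i : Fin p, ((A.rounds + 1) * A.tupleLoad D) ^ S.card := by
        refine Finset.sum_le_sum fun i _ => ?_
        rw [Finset.card_powersetCard]
        exact (Nat.choose_le_pow _ _).trans (Nat.pow_le_pow_left (h2 i) _)
    _ = _ := by simp

theorem Algorithm.inSize_le {dom : V → Type*} {B : Type*} {p : ℕ}
    (A : Algorithm (RelTuple dom E) B p) {R : Database dom E}
    {D : Fin p → Finset (RelTuple dom E)} (hR : R.IsEvenDistribution D) :
    R.inSize ≤ p * A.tupleLoad D := by
  rw [← hR.sum_card]
  exact (Finset.sum_le_sum fun i _ => A.card_initial_le D i).trans (by simp)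

/-! ### The upper bound in terms of input and output size -/

theorem one_le_kStar (N M : ℕ) : 1 ≤ kStar N M := le_max_left _ _

theorem le_mul_loadBound {p N M : ℕ} (hp : 0 < p) : (N : ℝ) ≤ p * loadBound p N M := by
  have hp1 : (1 : ℝ) ≤ p := by exact_mod_cast hp
  have hk := one_le_kStar N M
  have h1 : (p : ℝ) ^ ((1 : ℝ) / max 1 ((kStar N M : ℝ) - 1)) ≤ p := by
    conv_rhs => rw [← Real.rpow_one (p : ℝ)]
    refine Real.rpow_le_rpow_of_exponent_le hp1 ?_
    rw [div_le_one (by positivity)]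
    exact le_max_left _ _
  have h2 : (N : ℝ) / p ≤ (N : ℝ) / (p : ℝ) ^ ((1 : ℝ) / max 1 ((kStar N M : ℝ) - 1)) := by
    gcongr
  have h3 : 0 ≤ ((M : ℝ) / p) ^ ((1 : ℝ) / kStar N M) := by positivity
  unfold loadBound
  rw [div_le_iff₀ (by linarith)] at h2
  nlinarith

/-- Both trivial bounds on the number of projections are used, `N ^ j` below `k*` and `M` from `k*`
on. The hypothesis `p ≤ N` gives a load bound of at least `1`, so higher powers only help. -/
theorem card_le_mul_loadBound_pow {p N M q j : ℕ} (hp : 0 < p) (hpN : p ≤ N) (hj : 0 < j)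
    (h1 : q ≤ N ^ j) (h2 : q ≤ M) : (q : ℝ) ≤ p * loadBound p N M ^ j := by
  have hp1 : (1 : ℝ) ≤ p := by exact_mod_cast hp
  have hp0 : (0 : ℝ) < p := by linarith
  have hNB := le_mul_loadBound (N := N) (M := M) hp
  have hB1 : 1 ≤ loadBound p N M := by
    have : (p : ℝ) * 1 ≤ p * loadBound p N M := by
      rw [mul_one]; exact le_trans (by exact_mod_cast hpN) hNB
    exact le_of_mul_le_mul_left this hp0
  set k := kStar N M with hk
  have hk1 : 1 ≤ k := one_le_kStar N M
  have ha : 0 ≤ (N : ℝ) / (p : ℝ) ^ ((1 : ℝ) / max 1 ((k : ℝ) - 1)) := by positivity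
  have hb : 0 ≤ ((M : ℝ) / p) ^ ((1 : ℝ) / k) := by positivity
  -- For `j < k` the denominator satisfies `(p ^ (1 / (k - 1))) ^ j ≤ p`, so the first summand alone
  -- suffices. For `j ≥ k` the second summand to the power `k` is `M / p`; if `M < p`, the estimate
  -- `q ≤ M ≤ p` is already enough.
  rcases lt_or_ge j k with hjk | hjk
  · have hk2 : (1 : ℝ) ≤ (k : ℝ) - 1 := by
      have : (2 : ℝ) ≤ k := by exact_mod_cast (by omega : 2 ≤ k)
      linarith
    have hle : (N : ℝ) / (p : ℝ) ^ ((1 : ℝ) / ((k : ℝ) - 1)) ≤ loadBound p N M := by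
      unfold loadBound
      rw [← hk, max_eq_right hk2]
      linarith
    have hpj : ((p : ℝ) ^ ((1 : ℝ) / ((k : ℝ) - 1))) ^ j ≤ p := by
      rw [← Real.rpow_natCast, ← Real.rpow_mul hp0.le]
      conv_rhs => rw [← Real.rpow_one (p : ℝ)]
      refine Real.rpow_le_rpow_of_exponent_le hp1 ?_
      rw [one_div, inv_mul_le_iff₀ (by linarith), mul_one]
      have : (j : ℝ) + 1 ≤ k := by exact_mod_cast hjk
      linarith
    calc (q : ℝ) ≤ (N : ℝ) ^ j := by exact_mod_cast h1
      _ = ((p : ℝ) ^ ((1 : ℝ) / ((k : ℝ) - 1))) ^ j *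
          ((N : ℝ) / (p : ℝ) ^ ((1 : ℝ) / ((k : ℝ) - 1))) ^ j := by
          rw [← mul_pow, mul_div_cancel₀]
          positivity
      _ ≤ p * loadBound p N M ^ j := by gcongr
  · rcases le_total (p : ℝ) M with hM | hM
    · have hle : ((M : ℝ) / p) ^ ((1 : ℝ) / k) ≤ loadBound p N M := by
        unfold loadBound
        rw [← hk]
        linarith
      have hkR : (k : ℝ) ≠ 0 := by positivity
      have hMk : (((M : ℝ) / p) ^ ((1 : ℝ) / k)) ^ k = (M : ℝ) / p := by
        rw [← Real.rpow_natCast, ← Real.rpow_mul (by positivity), one_div_mul_cancel hkR,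
          Real.rpow_one]
      calc (q : ℝ) ≤ M := by exact_mod_cast h2
        _ = p * (((M : ℝ) / p) ^ ((1 : ℝ) / k)) ^ k := by
            rw [hMk, mul_div_cancel₀]
            exact hp0.ne'
        _ ≤ p * loadBound p N M ^ k := by gcongr
        _ ≤ p * loadBound p N M ^ j := by gcongr
    · calc (q : ℝ) ≤ M := by exact_mod_cast h2
        _ ≤ p * 1 := by rw [mul_one]; exact hM
        _ ≤ p * loadBound p N M ^ j := by gcongr; exact one_le_pow₀ hB1

end Bounds

end MPCJoin

end

noncomputable section
namespace MPCJoin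

/-! ### Product instances and the matching lower bound -/

section HardInstances

variable {V : Type*} {E F : Finset (Finset V)}

/-- In a reduced hierarchical hypergraph with several edges, every edge has a private attribute. -/
theorem exists_private (hred : IsReductionOf F E) (hF : IsHierarchical F) (h2 : 2 ≤ F.card)
    {f : Finset V} (hf : f ∈ F) : ∃ x ∈ f, ∀ f' ∈ F, x ∈ f' → f' = f := by
  obtain ⟨f₁, hf₁, hne⟩ := Finset.exists_mem_ne (s := F) (by omega) f
  have hfne : f.Nonempty := by
    rw [Finset.nonempty_iff_ne_empty]
    rintro rfl
    exact hne (hred.eq_of_subset hf hf₁ (Finset.empty_subset _)).symm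
  -- An attribute of `f` in the fewest edges is private: another edge `f'` through `x` misses some
  -- `y ∈ f` because `F` is reduced, and the hierarchy makes the edges of `y` strictly fewer than
  -- those of `x`.
  obtain ⟨x, hx, hmin⟩ := Finset.exists_min_image f (fun x => (edgesAt F x).card) hfne
  refine ⟨x, hx, fun f' hf' hxf' => ?_⟩
  by_contra hne'
  have : ∃ y ∈ f, y ∉ f' := by
    by_contra hall
    push Not at hall
    exact hne' (hred.eq_of_subset hf hf' hall).symm
  obtain ⟨y, hy, hyf'⟩ := this
  have hlt : edgesAt F y ⊂ edgesAt F x := by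
    rw [Finset.ssubset_iff_subset_ne]
    refine ⟨?_, fun he => hyf' (mem_edgesAt.1 (he ▸ mem_edgesAt.2 ⟨hf', hxf'⟩)).2⟩
    rcases hF x y with h | h | h
    · exact absurd (mem_edgesAt.1 (h (mem_edgesAt.2 ⟨hf', hxf'⟩))).2 hyf'
    · exact h
    · exact absurd (mem_edgesAt.2 ⟨hf, hy⟩) (Finset.disjoint_left.1 h (mem_edgesAt.2 ⟨hf, hx⟩))
  exact absurd (hmin y hy) (not_le.2 (Finset.card_lt_card hlt))

/-- Every edge lies in an edge of `F`, so a join result is determined by its tuples over `F`. -/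
theorem Database.outSize_le_prod {dom : V → Type*} (hred : IsReductionOf F E)
    (R : Database dom E) :
    R.outSize ≤ ∏ f ∈ (subEdges F : Finset {e // e ∈ E}), (R f).card := by
  classical
  rw [← Finset.card_pi]
  refine Finset.card_le_card_of_injOn (fun s f _ => s f) ?_ ?_
  · intro s hs
    exact Finset.mem_coe.2 (Finset.mem_pi.2 fun f _ => (Database.mem_joinResults.1 hs).1 f)
  · intro s hs s' hs' he
    funext e x
    obtain ⟨f, hf, hef⟩ := hred.exists_superset e.2
    have h1 := (Database.mem_joinResults.1 hs).2 e ⟨f, hred.subset hf⟩ x.1 x.2 (hef x.2)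
    have h2 := (Database.mem_joinResults.1 hs').2 e ⟨f, hred.subset hf⟩ x.1 x.2 (hef x.2)
    have h3 := congrFun (congrFun he ⟨f, hred.subset hf⟩) (mem_subEdges.2 hf)
    exact h1.trans ((congrFun h3 _).trans h2.symm)

/-- Instances in which the join is a Cartesian product of sets of given sizes. -/
theorem exists_productInstance (hred : IsReductionOf F E) (hF : IsHierarchical F)
    (h2 : 2 ≤ F.card) (dom : V → Type*) (hdom : ∀ x, Infinite (dom x)) (n : Finset V → ℕ)
    (hn : ∀ f, 0 < n f) :
    ∃ R : Database dom E, (∀ f : {e // e ∈ E}, f.1 ∈ F → (R f).card = n f.1) ∧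
      (∀ e, ∃ f ∈ F, (R e).card ≤ n f) ∧
      ∀ S ⊆ (subEdges F : Finset {e // e ∈ E}), ∏ f ∈ S, n f.1 ≤ (R.subResults S).card := by
  classical
  have hpriv : ∀ f : {f // f ∈ F}, ∃ x ∈ f.1, ∀ f' ∈ F, x ∈ f' → f' = f.1 := fun f =>
    exists_private hred hF h2 f.2
  choose x hx hxu using hpriv
  have hsup : ∀ e : {e // e ∈ E}, ∃ f : {f // f ∈ F}, e.1 ⊆ f.1 := fun e => by
    obtain ⟨f, hf, hef⟩ := hred.exists_superset e.2
    exact ⟨⟨f, hf⟩, hef⟩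
  choose sup hsup using hsup
  have hsupF : ∀ e : {e // e ∈ E}, e.1 ∈ F → (sup e).1 = e.1 := fun e he =>
    (hred.eq_of_subset he (sup e).2 (hsup e)).symm
  let ν : (y : V) → ℕ ↪ dom y := fun y => Infinite.natEmbedding (dom y)
  -- Only the private attribute of the covering edge varies; all others have a fixed value. Tuples
  -- over different edges of `F` are therefore always compatible, and a smaller edge sees either the
  -- same index or a constant.
  let tup : (e : {e // e ∈ E}) → ℕ → Tup dom e.1 := fun e i y =>
    ν y.1 (if y.1 = x (sup e) then i else 0)
  let R : Database dom E := fun e => (Finset.range (n (sup e).1)).image (tup e)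
  have htup : ∀ e : {e // e ∈ E}, e.1 ∈ F → Function.Injective (tup e) := by
    intro e he i j hij
    have hmem : x (sup e) ∈ e.1 := hsupF e he ▸ hx (sup e)
    have := congrFun hij ⟨x (sup e), hmem⟩
    simpa [tup] using this
  let comb : (Finset V → ℕ) → (e : {e // e ∈ E}) → Tup dom e.1 := fun b e => tup e (b (sup e).1)
  have hcomb : ∀ b : Finset V → ℕ, (∀ f, b f < n f) → comb b ∈ R.joinResults := by
    intro b hb
    rw [Database.mem_joinResults]
    refine ⟨fun e => Finset.mem_image_of_mem _ (Finset.mem_range.2 (hb _)), ?_⟩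
    intro e e' y hy hy'
    have h0 : ∀ e e' : {e // e ∈ E}, y ∈ e.1 → y ∈ e'.1 → y = x (sup e) →
        sup e' = sup e := fun e e' _ hy' he =>
      Subtype.ext (hxu (sup e) _ (sup e').2 (he ▸ hsup e' hy'))
    simp only [comb, tup]
    by_cases h1 : y = x (sup e)
    · rw [h0 e e' hy hy' h1]
    · by_cases h2 : y = x (sup e')
      · rw [h0 e' e hy' hy h2]
      · rw [if_neg h1, if_neg h2]
  refine ⟨R, fun f hf => ?_, fun e => ⟨(sup e).1, (sup e).2, ?_⟩, fun S hS => ?_⟩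
  · rw [Finset.card_image_of_injective _ (htup f hf), Finset.card_range, hsupF f hf]
  · exact Finset.card_image_le.trans (Finset.card_range _).le
  · have hcard : (S.pi fun f => Finset.range (n f.1)).card = ∏ f ∈ S, n f.1 := by
      simp [Finset.card_pi]
    rw [← hcard]
    let ext : ((f : {e // e ∈ E}) → f ∈ S → ℕ) → Finset V → ℕ := fun b f =>
      if h : ∃ hf : f ∈ E, (⟨f, hf⟩ : {e // e ∈ E}) ∈ S then b ⟨f, h.1⟩ h.2 else 0
    have hext : ∀ b (f : {e // e ∈ E}) (hf : f ∈ S), ext b f.1 = b f hf := fun b f hf =>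
      dif_pos ⟨f.2, hf⟩
    refine Finset.card_le_card_of_injOn (fun b => subResult (comb (ext b)) S) ?_ ?_
    · intro b hb
      have hb := Finset.mem_pi.1 hb
      refine Finset.mem_coe.2 (Finset.mem_image_of_mem _ (hcomb _ fun f => ?_))
      by_cases h : ∃ hf : f ∈ E, (⟨f, hf⟩ : {e // e ∈ E}) ∈ S
      · rw [hext b ⟨f, h.1⟩ h.2]
        exact Finset.mem_range.1 (hb _ _)
      · simp only [ext, dif_neg h]
        exact hn f
    · intro b _ b' _ he
      funext f hf
      have h1 : (⟨f, comb (ext b) f⟩ : RelTuple dom E) ∈ subResult (comb (ext b)) S :=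
        mem_subResult.2 ⟨hf, rfl⟩
      have he : subResult (comb (ext b)) S = subResult (comb (ext b')) S := he
      rw [he, mem_subResult] at h1
      have hfF := mem_subEdges.1 (hS hf)
      have h3 := htup f hfF h1.2
      rw [hsupF f hfF, hext b' f hf, hext b f hf] at h3
      exact h3.symm

/-- If the output is larger than the input, `k*` is at least `2`. -/
theorem kStar_spec {N M : ℕ} (hk : 2 ≤ kStar N M) :
    2 ≤ N ∧ N ^ (kStar N M - 1) < M ∧ M ≤ N ^ kStar N M := by
  have hk' : kStar N M = ⌈Real.logb N M⌉₊ := by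
    unfold kStar at hk ⊢
    omega
  have hlog : 0 < Real.logb N M := Nat.ceil_pos.1 (by omega)
  have hN : 2 ≤ N := by
    by_contra hN
    have : N = 0 ∨ N = 1 := by omega
    rcases this with rfl | rfl <;> simp at hlog
  have hN1 : (1 : ℝ) < N := by exact_mod_cast hN
  have hM : 0 < M := by
    rcases Nat.eq_zero_or_pos M with rfl | h
    · simp at hlog
    · exact h
  have hMR : (0 : ℝ) < M := by exact_mod_cast hM
  refine ⟨hN, ?_, ?_⟩
  · have h1 : ((kStar N M - 1 : ℕ) : ℝ) < Real.logb N M := by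
      rw [← Nat.lt_ceil, ← hk']
      omega
    rw [Real.lt_logb_iff_rpow_lt hN1 hMR, Real.rpow_natCast] at h1
    exact_mod_cast h1
  · have h1 : Real.logb N M ≤ (kStar N M : ℝ) := by
      rw [hk']
      exact Nat.le_ceil _
    rw [Real.logb_le_iff_le_rpow hN1 hMR, Real.rpow_natCast] at h1
    exact_mod_cast h1

/-- The logarithm to base `1` is `0` by convention, so `k*` says nothing about `M` when `N = 1`;
this case is covered by `hN1`. -/
theorem le_of_kStar_eq_one {N M : ℕ} (hN : 0 < N) (hk : kStar N M = 1) (hN1 : N = 1 → M ≤ 1) :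
    M ≤ N := by
  rcases Nat.lt_or_ge N 2 with h | h
  · obtain rfl : N = 1 := by omega
    exact hN1 rfl
  · rcases Nat.eq_zero_or_pos M with rfl | hM
    · exact Nat.zero_le _
    have hN1 : (1 : ℝ) < N := by exact_mod_cast h
    have hMR : (0 : ℝ) < M := by exact_mod_cast hM
    have h1 : Real.logb N M ≤ (1 : ℕ) := by
      rw [← Nat.ceil_le]
      have : ⌈Real.logb N M⌉₊ ≤ kStar N M := le_max_right _ _
      omega
    rw [Real.logb_le_iff_le_rpow hN1 hMR, Real.rpow_natCast, pow_one] at h1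
    exact_mod_cast h1

theorem Database.outSize_le_pow {dom : V → Type*} (hred : IsReductionOf F E)
    (R : Database dom E) : R.outSize ≤ R.inSize ^ F.card := by
  rw [← card_subEdges hred.subset]
  refine (R.outSize_le_prod hred).trans (Finset.prod_le_pow_card _ _ _ fun f _ => ?_)
  exact Finset.single_le_sum (f := fun e => (R e).card) (fun _ _ => Nat.zero_le _)
    (Finset.mem_univ f)

theorem prod_subEdges {G : Finset (Finset V)} (h : G ⊆ E) (w : Finset V → ℕ) :
    ∏ f ∈ (subEdges G : Finset {e // e ∈ E}), w f.1 = ∏ f ∈ G, w f := by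
  classical
  refine Finset.prod_bij (fun f _ => f.1) (fun f hf => mem_subEdges.1 hf)
    (fun f _ f' _ he => Subtype.ext he) (fun f hf => ⟨⟨f, h hf⟩, mem_subEdges.2 hf, rfl⟩)
    fun _ _ => rfl

/-- The loads that the counting bound implies. -/
theorem loadBound_le {p N M : ℕ} (hp : 0 < p) {X : ℝ} (hX : 0 ≤ X) (hk : 2 ≤ kStar N M)
    (h1 : (N : ℝ) ^ (kStar N M - 1) ≤ p * X ^ (kStar N M - 1))
    (h2 : (M : ℝ) ≤ p * X ^ kStar N M) : loadBound p N M ≤ 2 * X := by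
  have hpR : (0 : ℝ) < p := by exact_mod_cast hp
  set k := kStar N M with hkdef
  have hk1 : (1 : ℝ) ≤ (k : ℝ) - 1 := by
    have : (2 : ℝ) ≤ k := by exact_mod_cast hk
    linarith
  have e1 : (N : ℝ) / (p : ℝ) ^ ((1 : ℝ) / ((k : ℝ) - 1)) ≤ X := by
    rw [div_le_iff₀ (by positivity)]
    refine le_of_pow_le_pow_left₀ (n := k - 1) (by omega) (by positivity) ?_
    rw [mul_pow, ← Real.rpow_natCast ((p : ℝ) ^ _), ← Real.rpow_mul hpR.le, Nat.cast_sub (by omega),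
      Nat.cast_one, one_div_mul_cancel (by linarith), Real.rpow_one]
    linarith
  have e2 : ((M : ℝ) / p) ^ ((1 : ℝ) / k) ≤ X := by
    refine le_of_pow_le_pow_left₀ (n := k) (by omega) hX ?_
    rw [← Real.rpow_natCast, ← Real.rpow_mul (by positivity), one_div_mul_cancel (by linarith),
      Real.rpow_one, div_le_iff₀ hpR]
    linarith
  unfold loadBound
  rw [← hkdef, max_eq_right hk1]
  linarith

/-- For every attainable pair of sizes there are instances of about these sizes for which the
counting bound implies the load bound. -/
theorem exists_hardInstance (hred : IsReductionOf F E) (hF : IsHierarchical F) (dom : V → Type*)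
    (hdom : ∀ x, Infinite (dom x)) {N M : ℕ} (hN : 0 < N)
    (hR : ∃ R : Database dom E, R.InClass N M) :
    ∃ R : Database dom E, (N ≤ R.inSize ∧ R.inSize ≤ (2 * E.card + 1) * N) ∧
      (M ≤ R.outSize ∧ R.outSize ≤ 2 * M) ∧
      ∀ (p : ℕ) (X : ℝ), 0 < p → 0 ≤ X → (R.inSize : ℝ) ≤ p * X →
        (∀ S : Finset {e // e ∈ E}, ((R.subResults S).card : ℝ) ≤ p * X ^ S.card) →
        loadBound p N M ≤ 2 * X := by
  classical
  obtain ⟨R₀, hRN, hRM⟩ := hR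
  have hMF : M ≤ N ^ F.card := hRN ▸ hRM ▸ R₀.outSize_le_pow hred
  -- For `k* = 1` the given instance is hard enough: then `M ≤ N` and both summands are at most `N /
  -- p`, which is forced by the initial distribution.
  rcases (one_le_kStar N M).eq_or_lt with hk | hk
  · refine ⟨R₀, ⟨hRN.ge, by rw [hRN]; exact Nat.le_mul_of_pos_left _ (by omega)⟩, ⟨hRM.ge, by omega⟩, fun p X hp hX h1 _ => ?_⟩
    have hMN : M ≤ N := le_of_kStar_eq_one hN hk.symm (by rintro rfl; simpa using hMF)
    have hpR : (0 : ℝ) < p := by exact_mod_cast hp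
    rw [hRN] at h1
    have h2 : (N : ℝ) / p ≤ X := by rw [div_le_iff₀ hpR]; linarith
    have h3 : (M : ℝ) / p ≤ N / p := by gcongr
    unfold loadBound
    rw [← hk]
    norm_num
    linarith
  · obtain ⟨hN2, hM1, hM2⟩ := kStar_spec (N := N) (M := M) hk
    set k := kStar N M with hkdef
    have hkF : k ≤ F.card := by
      by_contra hlt
      exact absurd (hM1.trans_le hMF)
        (not_lt.2 (Nat.pow_le_pow_right hN (by omega)))
    obtain ⟨G, hGF, hGk⟩ := Finset.exists_subset_card_eq hkF
    obtain ⟨f₀, hf₀⟩ := Finset.card_pos.1 (by omega : 0 < G.card)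
    set P := N ^ (k - 1) with hP
    have hPpos : 0 < P := by positivity
    have hNk : N ^ k = N * P := by rw [hP, ← pow_succ']; congr 1; omega
    -- Since `P = N ^ (k - 1) < M`, rounding up to a multiple of `P` keeps the product `P * r`
    -- between `M` and `2 * M`; `M ≤ N ^ k` bounds this last factor by `N + 1`.
    set r := M / P + 1 with hr
    have hr1 : M ≤ P * r := (Nat.lt_mul_div_succ M hPpos).le
    have hr2 : P * r ≤ 2 * M := by
      rw [hr, mul_add, mul_one]
      have := Nat.mul_div_le M P
      omega
    have hrpos : 0 < r := Nat.succ_pos _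
    have hrN : r ≤ N + 1 := by
      have : M / P ≤ N := Nat.div_le_of_le_mul (by rw [mul_comm, ← hNk]; exact hM2)
      omega
    let n : Finset V → ℕ := fun f => if f = f₀ then r else if f ∈ G then N else 1
    have hn : ∀ f, 0 < n f := by
      intro f
      simp only [n]
      split_ifs <;> omega
    have hnle : ∀ f, n f ≤ N + 1 := by
      intro f
      simp only [n]
      split_ifs <;> omega
    obtain ⟨R, hRF, hRe, hRS⟩ := exists_productInstance hred hF (by omega) dom hdom n hn
    have hGE : G ⊆ E := hGF.trans hred.subset
    have hG'E : G.erase f₀ ⊆ E := (Finset.erase_subset _ _).trans hGE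
    have hcard' : (G.erase f₀).card = k - 1 := by rw [Finset.card_erase_of_mem hf₀, hGk]
    have hprod' : ∏ f ∈ G.erase f₀, n f = P := by
      rw [Finset.prod_congr rfl (g := fun _ => N), Finset.prod_const, hcard']
      intro f hf
      simp [n, Finset.ne_of_mem_erase hf, Finset.mem_of_mem_erase hf]
    have hprod : ∏ f ∈ G, n f = P * r := by
      rw [← Finset.prod_erase_mul _ _ hf₀, hprod']
      simp [n]
    have hprodF : ∏ f ∈ F, n f = P * r := by
      rw [← hprod]
      symm
      refine Finset.prod_subset hGF fun f _ hf => ?_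
      have : f ≠ f₀ := fun h => hf (h ▸ hf₀)
      simp [n, this, hf]
    have hq : ∀ G' ⊆ F, ∏ f ∈ G', n f ≤ (R.subResults (subEdges G')).card := by
      intro G' hG'
      rw [← prod_subEdges (hG'.trans hred.subset)]
      exact hRS _ fun f hf => mem_subEdges.2 (hG' (mem_subEdges.1 hf))
    refine ⟨R, ⟨?_, ?_⟩, ⟨?_, ?_⟩, fun p X hp hX _ hS => ?_⟩
    · obtain ⟨f, hf⟩ := Finset.card_pos.1 (by omega : 0 < (G.erase f₀).card)
      have hfE := hG'E hf
      have h1 := hRF ⟨f, hfE⟩ (hGF (Finset.mem_of_mem_erase hf))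
      have h2 : n f = N := by simp [n, Finset.ne_of_mem_erase hf, Finset.mem_of_mem_erase hf]
      rw [← h2, ← h1]
      exact Finset.single_le_sum (f := fun e => (R e).card) (fun _ _ => Nat.zero_le _)
        (Finset.mem_univ _)
    · calc R.inSize ≤ ∑ _e : {e // e ∈ E}, (N + 1) := Finset.sum_le_sum fun e _ => by
            obtain ⟨f, -, hf⟩ := hRe e
            exact hf.trans (hnle f)
        _ = E.card * (N + 1) := by simp
        _ ≤ _ := by nlinarith
    · exact hr1.trans (hprodF ▸ (hq F subset_rfl).trans (R.card_subResults_le_outSize _))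
    · refine (R.outSize_le_prod hred).trans (le_trans (le_of_eq ?_) hr2)
      rw [← hprodF, ← prod_subEdges hred.subset]
      exact Finset.prod_congr rfl fun f hf => hRF f (mem_subEdges.1 hf)
    -- The two summands of the bound come from two sets of edges: the `k - 1` factors of size `N`
    -- give `N ^ (k - 1)` projections, and all `k` nontrivial factors give at least `M`.
    · refine loadBound_le hp hX hk ?_ ?_
      · have h1 := hq (G.erase f₀) ((Finset.erase_subset _ _).trans hGF)
        have h2 := hS (subEdges (G.erase f₀))
        rw [card_subEdges hG'E, hcard'] at h2
        rw [hprod'] at h1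
        have h3 : (P : ℝ) ≤ (R.subResults (subEdges (G.erase f₀))).card := by exact_mod_cast h1
        rw [hP, Nat.cast_pow] at h3
        exact h3.trans h2
      · have h1 := hr1.trans (hprod ▸ hq G hGF)
        have h2 := hS (subEdges G)
        rw [card_subEdges hGE, hGk] at h2
        exact le_trans (by exact_mod_cast h1) h2

end HardInstances

end MPCJoin

end

/-! ### Output-optimality -/

theorem mainTheorem11 {V : Type u} (E : Finset (Finset V))
    (hE : MPCJoin.IsRHierarchical E) :
    -- an O(1)-round algorithm with the claimed load, no worse (up to a constant) than any other
    -- O(1)-round algorithm on any class of instances of the same input and output size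
    (∀ ε : ℝ, 0 < ε →
      ∃ (T c : ℕ) (C : ℝ) (C' : ℕ → ℝ), ∀ dom : V → Type v,
      ∃ A : (p : ℕ) → MPCJoin.Algorithm (MPCJoin.RelTuple dom E) ℕ p,
      ∀ p : ℕ, 0 < p → (A p).rounds ≤ T ∧
        ∀ N M : ℕ, (p : ℝ) ^ (1 + ε) ≤ N →
          (∀ R : MPCJoin.Database dom E, R.InClass N M →
            ∀ D : Fin p → Finset (MPCJoin.RelTuple dom E), R.IsEvenDistribution D →
              (A p).Computes R D ∧ (A p).IntegersAtMost D (N ^ c) ∧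
              ((A p).load D : ℝ) ≤ C * MPCJoin.loadBound p N M) ∧
          (∀ (B : Type w) (A' : MPCJoin.Algorithm (MPCJoin.RelTuple dom E) B p) (L' : ℝ),
            (∀ R : MPCJoin.Database dom E, R.InClass N M →
              ∀ D : Fin p → Finset (MPCJoin.RelTuple dom E), R.IsEvenDistribution D →
                A'.Computes R D ∧ (A'.tupleLoad D : ℝ) ≤ L') →
            ∀ R : MPCJoin.Database dom E, R.InClass N M →
              ∀ D : Fin p → Finset (MPCJoin.RelTuple dom E), R.IsEvenDistribution D →
                ((A p).load D : ℝ) ≤ C' A'.rounds * L')) ∧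
    -- the bound is tight for every attainable pair of input and output sizes
    (∃ a : ℝ, 0 < a ∧ ∀ T : ℕ, ∃ c : ℝ, 0 < c ∧
      ∀ dom : V → Type v, (∀ x, Infinite (dom x)) →
      ∀ p N M : ℕ, 0 < p → 0 < N → (∃ R : MPCJoin.Database dom E, R.InClass N M) →
      ∃ R : MPCJoin.Database dom E,
        ((N : ℝ) ≤ a * R.inSize ∧ (R.inSize : ℝ) ≤ a * N) ∧
        ((M : ℝ) ≤ a * R.outSize ∧ (R.outSize : ℝ) ≤ a * M) ∧
        ∀ (B : Type w) (A' : MPCJoin.Algorithm (MPCJoin.RelTuple dom E) B p),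
          A'.rounds ≤ T →
          ∀ D : Fin p → Finset (MPCJoin.RelTuple dom E), R.IsEvenDistribution D →
            A'.Computes R D → c * MPCJoin.loadBound p N M ≤ (A'.tupleLoad D : ℝ)) := by
  obtain ⟨F, hred, hF⟩ := hE
  refine ⟨fun ε hε => ?_, (2 * E.card + 2 : ℕ), by positivity, fun T => ?_⟩
  · obtain ⟨T, c, C, hC, hA⟩ := MPCJoin.exists_joinAlgorithm hred hF hε
    refine ⟨T, c, C, fun r => C * (r + 1), fun dom => ?_⟩
    obtain ⟨A, hA⟩ := hA dom
    refine ⟨A, fun p hp => ⟨(hA p hp).1, fun N M hpN => ⟨fun R hR D hD => ?_,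
      fun B A' L' hA' R hR D hD => ?_⟩⟩⟩
    · obtain ⟨rfl, rfl⟩ := hR
      obtain ⟨h1, h2, h3⟩ := (hA p hp).2 R hpN D hD
      refine ⟨h1, h2, h3 _ (MPCJoin.le_mul_loadBound hp) fun S _ hS => ?_⟩
      have hpN' : p ≤ R.inSize := by
        have hp1 : (1 : ℝ) ≤ p := by exact_mod_cast hp
        have : (p : ℝ) ≤ (p : ℝ) ^ (1 + ε) := by
          conv_lhs => rw [← Real.rpow_one (p : ℝ)]
          exact Real.rpow_le_rpow_of_exponent_le hp1 (by linarith)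
        exact_mod_cast this.trans hpN
      exact MPCJoin.card_le_mul_loadBound_pow hp hpN' hS.card_pos
        (R.card_subResults_le_pow S) (R.card_subResults_le_outSize S)
    · obtain ⟨hc, hL⟩ := hA' R hR D hD
      obtain ⟨rfl, rfl⟩ := hR
      have hL0 : (0 : ℝ) ≤ L' := le_trans (Nat.cast_nonneg _) hL
      have h1 : (1 : ℝ) * L' ≤ (A'.rounds + 1) * L' := by
        gcongr
        linarith [Nat.cast_nonneg (α := ℝ) A'.rounds]
      -- The competitor's bound times its number of rounds plus one is itself an admissible value,
      -- so the load guarantee applies to it directly.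
      have := ((hA p hp).2 R hpN D hD).2.2 ((A'.rounds + 1) * L') ?_ fun S _ _ => ?_
      · linarith
      · have : (R.inSize : ℝ) ≤ p * A'.tupleLoad D := by exact_mod_cast A'.inSize_le hD
        refine this.trans ?_
        gcongr
        linarith
      · have : ((R.subResults S).card : ℝ) ≤
            p * ((A'.rounds + 1) * A'.tupleLoad D) ^ S.card := by
          exact_mod_cast A'.card_subResults_le hc S
        refine this.trans ?_
        gcongr
  -- On the hard instance an admissible `X` is at least half the bound, and a load over at most `T`
  -- rounds makes `(T + 1)` times that load admissible.
  · refine ⟨1 / (2 * (T + 1)), by positivity, fun dom hdom p N M hp hN hR => ?_⟩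
    obtain ⟨R, ⟨h1, h2⟩, ⟨h3, h4⟩, hX⟩ := MPCJoin.exists_hardInstance hred hF dom hdom hN hR
    have ha : 1 ≤ 2 * E.card + 2 := by omega
    refine ⟨R, ⟨?_, ?_⟩, ⟨?_, ?_⟩, fun B A' hT D hD hc => ?_⟩
    · exact_mod_cast h1.trans (Nat.le_mul_of_pos_left _ ha)
    · exact_mod_cast h2.trans (Nat.mul_le_mul_right _ (by omega))
    · exact_mod_cast h3.trans (Nat.le_mul_of_pos_left _ ha)
    · exact_mod_cast h4.trans (Nat.mul_le_mul_right _ (by omega))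
    · have hT' : (A'.rounds : ℝ) ≤ T := by exact_mod_cast hT
      have h := hX p ((T + 1) * A'.tupleLoad D) hp (by positivity) ?_ fun S => ?_
      · rw [one_div, inv_mul_le_iff₀ (by positivity)]
        linarith
      · have : (R.inSize : ℝ) ≤ p * A'.tupleLoad D := by exact_mod_cast A'.inSize_le hD
        refine this.trans ?_
        gcongr
        nlinarith [Nat.cast_nonneg (α := ℝ) T, Nat.cast_nonneg (α := ℝ) (A'.tupleLoad D)]
      · have : ((R.subResults S).card : ℝ) ≤
            p * ((A'.rounds + 1) * A'.tupleLoad D) ^ S.card := by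
          exact_mod_cast A'.card_subResults_le hc S
        refine this.trans ?_
        gcongr
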